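/- Let $G$ be a locally compact (Hausdorff) group with a fixed left Haar measure, and assume that $G$ is amenable, i.e. there is a state $m$ on $L^\infty(G)$ with $m(\lambda(s)f)=m(f)$ for all $s\in G$, $f\in L^\infty(G)$, where $\lambda(s)f(t)=f(s^{-1}t)$. Let $\sigma:G\times G\to\mathbb T$ be a continuous 2-cocycle, i.e. $\sigma(s,t)\sigma(st,r)=\sigma(s,tr)\sigma(t,r)$ and $\sigma(s,e)=\sigma(e,t)=1$ for all $s,t,r\in G$. A $\sigma$-representation of $G$ is a map $\pi:G\to\mathcal U(\mathcal H)$ into the unitary group of a complex Hilbert space such that $\pi(s)\pi(t)=\sigma(s,t)\pi(st)$ for all $s,t\in G$ and $s\mapsto\pi(s)\xi$ is Borel measurable for every $\xi\in\mathcal H$. The twisted Fourier–Stieltjes space is $$B(G,\sigma)=\{\langle\pi(\cdot)\xi,\eta\rangle : \pi \text{ a } \sigma\text{-representation of } G \text{ on } \mathcal H,\ \xi,\eta\in\mathcal H\}.$$ Let $\lambda_\sigma(s)f(t)=\sigma(s,s^{-1}t)f(s^{-1}t)$ on $L^2(G)$, let $VN(G,\sigma)=\{\lambda_\sigma(s):s\in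 G\}''\subseteq B(L^2(G))$, and let $A(G,\sigma)=VN(G,\sigma)_*$ be its predual, i.e. the norm closed linear span in $VN(G,\sigma)^*$ of the functionals $T\mapsto\langle T\xi,\eta\rangle$, $\xi,\eta\in L^2(G)$, with the operator space structure inherited from the dual $VN(G,\sigma)^*$. An element $\psi\in A(G,\sigma)$ is regarded as the function $s\mapsto\langle\lambda_\sigma(s),\psi\rangle$ on $G$; write $A(G)=A(G,1)$. Let $M(A(G),A(G,\sigma))$ (respectively $M_{cb}(A(G),A(G,\sigma))$) be the set of all functions $\varphi:G\to\mathbb C$ such that $\varphi\psi\in A(G,\sigma)$ for every $\psi\in A(G)$ and the map $m_\varphi:A(G)\to A(G,\sigma)$, $\psi\mapsto\varphi\psi$, is bounded (respectively completely bounded). Then $$B(G,\sigma)=M_{cb}(A(G),A(G,\sigma))=M(A(G),A(G,\sigma)).$$ -/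

import Mathlib

open MeasureTheory
open scoped ENNReal ComplexOrder

universe u

noncomputable section

/-! ### Continuous 2-cocycles and twisted representations -/

/-- A continuous `𝕋`-valued 2-cocycle on a topological group. -/
structure ContinuousTwoCocycle (G : Type u) [Group G] [TopologicalSpace G] where
  toFun : G → G → Circle
  continuous_toFun : Continuous fun p : G × G => toFun p.1 p.2
  cocycle : ∀ s t r : G, toFun s t * toFun (s * t) r = toFun s (t * r) * toFun t r
  map_one_right : ∀ s : G, toFun s 1 = 1
  map_one_left : ∀ t : G, toFun 1 t = 1

instance {G : Type u} [Group G] [TopologicalSpace G] :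
    CoeFun (ContinuousTwoCocycle G) (fun _ => G → G → Circle) :=
  ⟨ContinuousTwoCocycle.toFun⟩

/-- The trivial 2-cocycle, constantly equal to `1`. -/
instance {G : Type u} [Group G] [TopologicalSpace G] : One (ContinuousTwoCocycle G) where
  one :=
    { toFun := fun _ _ => 1
      continuous_toFun := continuous_const
      cocycle := fun _ _ _ => rfl
      map_one_right := fun _ => rfl
      map_one_left := fun _ => rfl }

/-- A `σ`-projective unitary representation of `G` on the Hilbert space `H`: every orbit map
`s ↦ π(s)ξ` is Borel measurable for the norm topology of `H`, and `π(s)π(t) = σ(s,t)π(st)`. -/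
structure TwistedRep {G : Type u} [Group G] [TopologicalSpace G] [MeasurableSpace G]
    (σ : ContinuousTwoCocycle G) (H : Type u) [NormedAddCommGroup H] [InnerProductSpace ℂ H]
    [CompleteSpace H] where
  toFun : G → unitary (H →L[ℂ] H)
  measurable_orbit : ∀ ξ : H, Measurable[_, borel H] fun s => (toFun s : H →L[ℂ] H) ξ
  map_mul : ∀ s t : G, (toFun s : H →L[ℂ] H) * (toFun t : H →L[ℂ] H)
    = (σ s t : ℂ) • (toFun (s * t) : H →L[ℂ] H)

/-- The coefficient function `s ↦ ⟨π(s)ξ, η⟩` (inner product linear in the first variable in this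
notation; Mathlib's `inner ℂ` is linear in its second argument). -/
def TwistedRep.coeff {G : Type u} [Group G] [TopologicalSpace G] [MeasurableSpace G]
    {σ : ContinuousTwoCocycle G} {H : Type u} [NormedAddCommGroup H] [InnerProductSpace ℂ H]
    [CompleteSpace H] (π : TwistedRep σ H) (ξ η : H) : G → ℂ :=
  fun s => inner ℂ η ((π.toFun s : H →L[ℂ] H) ξ)

/-- The twisted Fourier–Stieltjes space `B(G,σ)`: all coefficient functions of
`σ`-representations.  (Hilbert spaces in the universe of `G` suffice: a coefficient function only
involves the closed cyclic subspace generated by one vector.) -/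
def twistedFourierStieltjes {G : Type u} [Group G] [TopologicalSpace G] [MeasurableSpace G]
    (σ : ContinuousTwoCocycle G) : Set (G → ℂ) :=
  {φ | ∃ (H : Type u) (_ : NormedAddCommGroup H) (_ : InnerProductSpace ℂ H)
    (_ : CompleteSpace H) (π : TwistedRep σ H) (ξ η : H), φ = π.coeff ξ η}

section Haar

variable {G : Type u} [Group G] [TopologicalSpace G] [IsTopologicalGroup G]
  [MeasurableSpace G] [BorelSpace G]

/-! ### Amenability -/

/-- Left translation `(λ(s)f)(t) = f(s⁻¹t)` on `L^∞(G)`. -/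
def leftTranslateLinf (μ : Measure G) [μ.IsMulLeftInvariant] (s : G) (f : Lp ℂ ∞ μ) :
    Lp ℂ ∞ μ :=
  Lp.compMeasurePreserving (fun t => s⁻¹ * t) (measurePreserving_mul_left μ s⁻¹) f

/-- Amenability: there is a left invariant mean, that is a left invariant state, on `L^∞(G)`.
If `G` is not σ-compact, functions here are identified when they agree off a null set; a mean on the
quotient by locally null sets induces one in the present sense. -/
def IsAmenableGroup (μ : Measure G) [μ.IsMulLeftInvariant] : Prop :=
  ∃ m : StrongDual ℂ (Lp ℂ ∞ μ),
    (∀ f : Lp ℂ ∞ μ, (∀ᵐ t ∂μ, 0 ≤ f t) → 0 ≤ m f) ∧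
    m ((memLp_top_const (1 : ℂ)).toLp fun _ : G => (1 : ℂ)) = 1 ∧
    ∀ (s : G) (f : Lp ℂ ∞ μ), m (leftTranslateLinf μ s f) = m f

/-! ### The left regular `σ`-representation and the twisted group von Neumann algebra -/

theorem memLp_leftRegular (μ : Measure G) [μ.IsMulLeftInvariant] (σ : ContinuousTwoCocycle G)
    (s : G) (f : Lp ℂ 2 μ) :
    MemLp (fun t => (σ s (s⁻¹ * t) : ℂ) * f (s⁻¹ * t)) 2 μ := by
  have hc : Continuous fun t => (σ s (s⁻¹ * t) : ℂ) :=
    continuous_subtype_val.comp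
      (σ.continuous_toFun.comp (continuous_const.prodMk (continuous_const.mul continuous_id)))
  have hf : MemLp (fun t => f (s⁻¹ * t)) 2 μ :=
    (Lp.memLp f).comp_measurePreserving (measurePreserving_mul_left μ s⁻¹)
  refine hf.of_le (hc.aestronglyMeasurable.mul hf.aestronglyMeasurable) ?_
  filter_upwards with t
  rw [norm_mul, Circle.norm_coe, one_mul]

/-- `(λ_σ(s)f)(t) = σ(s, s⁻¹t) f(s⁻¹t)`, as a bounded operator on `L²(G)`. -/
def leftRegular (μ : Measure G) [μ.IsMulLeftInvariant] (σ : ContinuousTwoCocycle G) (s : G) :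
    Lp ℂ 2 μ →L[ℂ] Lp ℂ 2 μ :=
  LinearMap.mkContinuous
    { toFun := fun f => (memLp_leftRegular μ σ s f).toLp
      map_add' := fun f g => by
        rw [← MemLp.toLp_add]
        refine MemLp.toLp_congr _ _ ?_
        filter_upwards [(measurePreserving_mul_left μ s⁻¹).quasiMeasurePreserving.ae
          (Lp.coeFn_add f g)] with t ht
        simp only [Pi.add_apply] at ht ⊢
        rw [ht, mul_add]
      map_smul' := fun c f => by
        rw [RingHom.id_apply, ← MemLp.toLp_const_smul]
        refine MemLp.toLp_congr _ _ ?_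
        filter_upwards [(measurePreserving_mul_left μ s⁻¹).quasiMeasurePreserving.ae
          (Lp.coeFn_smul c f)] with t ht
        simp only [Pi.smul_apply, smul_eq_mul] at ht ⊢
        rw [ht]
        ring }
    1 (fun f => by
      rw [one_mul, LinearMap.coe_mk, AddHom.coe_mk,
        ← Lp.norm_compMeasurePreserving f (measurePreserving_mul_left μ s⁻¹)]
      refine Lp.norm_le_norm_of_ae_le ?_
      filter_upwards [(memLp_leftRegular μ σ s f).coeFn_toLp,
        Lp.coeFn_compMeasurePreserving f (measurePreserving_mul_left μ s⁻¹)] with t h1 h2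
      rw [h1, h2, norm_mul, Circle.norm_coe, one_mul, Function.comp_apply])

/-- The twisted group von Neumann algebra `VN(G,σ)`: the double commutant of
`{λ_σ(s) : s ∈ G}` in `B(L²(G))`.  (`StarSubalgebra.centralizer` is the commutant of the set
together with its adjoints.) -/
def twistedVN (μ : Measure G) [μ.IsMulLeftInvariant] (σ : ContinuousTwoCocycle G) :
    VonNeumannAlgebra (Lp ℂ 2 μ) where
  toStarSubalgebra := StarSubalgebra.centralizer ℂ
    (StarSubalgebra.centralizer ℂ (Set.range (leftRegular μ σ)) :
      Set (Lp ℂ 2 μ →L[ℂ] Lp ℂ 2 μ))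
  centralizer_centralizer' := Set.centralizer_centralizer_centralizer _

/-- `VN(G,σ)` as a type; it carries the operator norm of `B(L²(G))`. -/
abbrev TwistedVN (μ : Measure G) [μ.IsMulLeftInvariant] (σ : ContinuousTwoCocycle G) : Type u :=
  (twistedVN μ σ).toStarSubalgebra

theorem leftRegular_mem (μ : Measure G) [μ.IsMulLeftInvariant] (σ : ContinuousTwoCocycle G)
    (s : G) : leftRegular μ σ s ∈ (twistedVN μ σ).toStarSubalgebra := by
  refine StarSubalgebra.mem_centralizer_iff ℂ |>.2 fun g hg => ?_
  have h := StarSubalgebra.mem_centralizer_iff ℂ |>.1 hg _ (Set.mem_range_self s)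
  refine ⟨h.1.symm, ?_⟩
  have h2 := congrArg star h.2
  simpa [star_mul] using h2

/-- `λ_σ(s)` as an element of `VN(G,σ)`. -/
def leftRegularVN (μ : Measure G) [μ.IsMulLeftInvariant] (σ : ContinuousTwoCocycle G) (s : G) :
    TwistedVN μ σ :=
  ⟨leftRegular μ σ s, leftRegular_mem μ σ s⟩

/-! ### The twisted Fourier space `A(G,σ) = VN(G,σ)_*` -/

/-- The vector functional `ω_{ξ,η} : T ↦ ⟨Tξ, η⟩` restricted to `VN(G,σ)`. -/
def vectorFunctional (μ : Measure G) [μ.IsMulLeftInvariant] (σ : ContinuousTwoCocycle G)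
    (ξ η : Lp ℂ 2 μ) : StrongDual ℂ (TwistedVN μ σ) :=
  LinearMap.mkContinuous
    { toFun := fun T => inner ℂ η ((T : Lp ℂ 2 μ →L[ℂ] Lp ℂ 2 μ) ξ)
      map_add' := fun S T => inner_add_right (𝕜 := ℂ) _ _ _
      map_smul' := fun c T => inner_smul_right (𝕜 := ℂ) _ _ _ }
    (‖η‖ * ‖ξ‖) (fun T => by
      refine (norm_inner_le_norm (𝕜 := ℂ) η ((T : Lp ℂ 2 μ →L[ℂ] Lp ℂ 2 μ) ξ)).trans ?_
      have h : ‖(T : Lp ℂ 2 μ →L[ℂ] Lp ℂ 2 μ) ξ‖ ≤ ‖T‖ * ‖ξ‖ :=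
        (T : Lp ℂ 2 μ →L[ℂ] Lp ℂ 2 μ).le_opNorm ξ
      calc ‖η‖ * ‖(T : Lp ℂ 2 μ →L[ℂ] Lp ℂ 2 μ) ξ‖ ≤ ‖η‖ * (‖T‖ * ‖ξ‖) := by gcongr
        _ = ‖η‖ * ‖ξ‖ * ‖T‖ := by ring)

/-- The twisted Fourier space `A(G,σ)`, the predual `VN(G,σ)_*`: the norm closed linear span of the
vector functionals in the dual Banach space `VN(G,σ)^*`, with the norm of `VN(G,σ)^*`. -/
def twistedFourier (μ : Measure G) [μ.IsMulLeftInvariant] (σ : ContinuousTwoCocycle G) :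
    Submodule ℂ (StrongDual ℂ (TwistedVN μ σ)) :=
  (Submodule.span ℂ {ω | ∃ ξ η : Lp ℂ 2 μ, ω = vectorFunctional μ σ ξ η}).topologicalClosure

/-- The function on `G` given by an element of `A(G,σ)`: `ψ(s) = ⟨λ_σ(s), ψ⟩`. -/
def fourierEval (μ : Measure G) [μ.IsMulLeftInvariant] (σ : ContinuousTwoCocycle G)
    (ψ : twistedFourier μ σ) : G → ℂ :=
  fun s => (ψ : StrongDual ℂ (TwistedVN μ σ)) (leftRegularVN μ σ s)

/-! ### Operator space structure -/

/-- The operator on the Hilbert space direct sum `H ⊕ ⋯ ⊕ H = ℓ²_k ⊗ H` given by a `k × k` matrix of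
operators on `H`: `(x v)_i = ∑_j x_{ij} v_j`. -/
def matrixOperator {H : Type u} [NormedAddCommGroup H] [InnerProductSpace ℂ H] {k : ℕ}
    (x : Matrix (Fin k) (Fin k) (H →L[ℂ] H)) :
    PiLp 2 (fun _ : Fin k => H) →L[ℂ] PiLp 2 (fun _ : Fin k => H) :=
  (PiLp.continuousLinearEquiv 2 ℂ (fun _ : Fin k => H)).symm.toContinuousLinearMap ∘L
    ContinuousLinearMap.pi fun i => ∑ j, x i j ∘L PiLp.proj 2 (fun _ : Fin k => H) j

/-- The norm of `M_k(VN(G,σ)) ⊆ M_k(B(L²(G))) = B(ℓ²_k ⊗ L²(G))`. -/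
def vnMatrixNorm (μ : Measure G) [μ.IsMulLeftInvariant] (σ : ContinuousTwoCocycle G) {k : ℕ}
    (x : Matrix (Fin k) (Fin k) (TwistedVN μ σ)) : ℝ :=
  ‖matrixOperator fun i j => (x i j : Lp ℂ 2 μ →L[ℂ] Lp ℂ 2 μ)‖

/-- The operator space structure on `A(G,σ) = VN(G,σ)_* ⊆ VN(G,σ)^*`: the norm of
`Ψ = [ψ_{ij}] ∈ M_n(A(G,σ))` is the cb-norm of the map `VN(G,σ) → M_n`, `T ↦ [ψ_{ij}(T)]`, that is
the supremum, over all `k` and all `x` in the unit ball of `M_k(VN(G,σ))`, of the operator norm of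
the scalar matrix `[ψ_{ij}(x_{pq})] ∈ M_k(M_n) = M_{kn}`. -/
def fourierMatrixNorm (μ : Measure G) [μ.IsMulLeftInvariant] (σ : ContinuousTwoCocycle G) {n : ℕ}
    (Ψ : Matrix (Fin n) (Fin n) (twistedFourier μ σ)) : ℝ≥0∞ :=
  ⨆ (k : ℕ) (x : Matrix (Fin k) (Fin k) (TwistedVN μ σ)) (_ : vnMatrixNorm μ σ x ≤ 1),
    ‖Matrix.toEuclideanCLM (n := Fin k × Fin n) (𝕜 := ℂ) (Matrix.of fun a b =>
      (Ψ a.2 b.2 : StrongDual ℂ (TwistedVN μ σ)) (x a.1 b.1))‖ₑ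

/-- The cb-norm of a linear map `A(G,σ₁) → A(G,σ₂)`. -/
def fourierCbNorm (μ : Measure G) [μ.IsMulLeftInvariant] {σ₁ σ₂ : ContinuousTwoCocycle G}
    (T : twistedFourier μ σ₁ →ₗ[ℂ] twistedFourier μ σ₂) : ℝ≥0∞ :=
  ⨆ (n : ℕ) (Ψ : Matrix (Fin n) (Fin n) (twistedFourier μ σ₁))
    (_ : fourierMatrixNorm μ σ₁ Ψ ≤ 1), fourierMatrixNorm μ σ₂ (Ψ.map T)

/-! ### Multiplier spaces -/

/-- `T` is the map `m_φ : A(G,σ₁) → A(G,σ₂)`, `ψ ↦ φψ`; in particular `φψ ∈ A(G,σ₂)` for every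
`ψ ∈ A(G,σ₁)`. -/
def IsMultiplicationBy (μ : Measure G) [μ.IsMulLeftInvariant] {σ₁ σ₂ : ContinuousTwoCocycle G}
    (φ : G → ℂ) (T : twistedFourier μ σ₁ →ₗ[ℂ] twistedFourier μ σ₂) : Prop :=
  ∀ (ψ : twistedFourier μ σ₁) (s : G), fourierEval μ σ₂ (T ψ) s = φ s * fourierEval μ σ₁ ψ s

/-- `M(A(G,σ₁), A(G,σ₂))`: the functions `φ` for which `m_φ` is well-defined and bounded. -/
def multiplierSpace (μ : Measure G) [μ.IsMulLeftInvariant] (σ₁ σ₂ : ContinuousTwoCocycle G) :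
    Set (G → ℂ) :=
  {φ | ∃ T : twistedFourier μ σ₁ →L[ℂ] twistedFourier μ σ₂,
    IsMultiplicationBy μ φ (T : twistedFourier μ σ₁ →ₗ[ℂ] twistedFourier μ σ₂)}

/-- `M_cb(A(G,σ₁), A(G,σ₂))`: the functions `φ` for which `m_φ` is well-defined and completely
bounded. -/
def cbMultiplierSpace (μ : Measure G) [μ.IsMulLeftInvariant] (σ₁ σ₂ : ContinuousTwoCocycle G) :
    Set (G → ℂ) :=
  {φ | ∃ T : twistedFourier μ σ₁ →ₗ[ℂ] twistedFourier μ σ₂,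
    IsMultiplicationBy μ φ T ∧ fourierCbNorm μ T < ∞}

end Haar

end

/-! The chain is B(G,σ) ⊆ M_cb ⊆ M ⊆ B(G,σ), and only the last inclusion needs amenability.

B ⊆ M_cb is Fell absorption. For φ = ⟨π(·)ξ,η⟩ and an orthonormal basis (e_i) of H, the map V_ξ f =
(⟨ξ,π(·)e_i⟩ f)_i from L²(G) to ℓ²(ι, L²(G)) is bounded by Bessel's inequality, and Parseval's
identity gives V_η^* (λ_σ(s) ⊕ λ_σ(s) ⊕ ⋯) V_ξ = φ(s) λ(s)
(`TwistedRep.inner_fellColumn_of_vanishing`). The compression x ↦ V_η^* (x ⊕ x ⊕ ⋯) V_ξ is therefore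
a completely bounded map VN(G,σ) → VN(G) whose pre-adjoint is m_φ. No σ-weak topology is used:
`inner_amplify_eq_zero_of_bicommutant` says that an identity between square summable families of
vector functionals holds on VN(G,σ) as soon as it holds on the λ_σ(s).

This requires continuous coefficients, whereas π is only Borel and H may be nonseparable. Strong
continuity (`TwistedRep.continuous_orbit`) follows from Steinhaus' theorem once some small ball has
an orbit preimage of positive measure. That such a ball exists is
`measure_eq_zero_of_null_ball_preimages`, resting on `measure_eq_zero_of_null_fibres`: for a finite
inner regular measure, a partition into null sets all of whose unions are measurable has null union,
whatever its cardinality.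

M_cb ⊆ M holds because the operator space norm of a 1 × 1 matrix is the ordinary norm.

M ⊆ B has two halves. Amenability gives Reiter's property in L¹, then in L², hence |∫ h| ≤ ‖λ(h)‖
for h ∈ C_c(G). Applied to h = fφ, with the coefficients of λ(fφ) computed through m_φ, this yields
|∫ fφ| ≤ ‖m_φ‖ ‖λ_σ(f)‖ (`norm_integral_mul_le_of_isMultiplicationBy`). It remains to realize such a
φ as a coefficient (`mem_twistedFourierStieltjes_of_norm_integral_le`). Pairs (ℓ,B) of a functional
and an invariant positive form with |ℓ(f)|² ≤ B(f,f) form a compact convex set containing the pairs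
from unit vectors of L²(G); Hahn–Banach places the normalized functional f ↦ ∫ fφ in such a pair.
Completing C_c(G) for B gives a σ-representation, Riesz gives η, and a weak limit of approximate
identities gives ξ. -/

noncomputable section

/-! ### Null fibres of maps into the reals: a Vitali argument -/

section NullFibres

open Set Filter Topology

/-- A measurable set of reals of positive Lebesgue measure contains two points whose difference is a
nonzero rational. -/
theorem exists_rat_difference {M : Set ℝ} (hM : MeasurableSet M) (h0 : volume M ≠ 0) :
    ∃ x ∈ M, ∃ y ∈ M, ∃ q : ℚ, x - y = q ∧ q ≠ 0 := by
  have h := Measure.sub_mem_nhds_zero_of_addHaar_pos volume M hM (pos_iff_ne_zero.2 h0)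
  obtain ⟨ε, hε, hball⟩ := Metric.mem_nhds_iff.1 h
  obtain ⟨q, hq0, hq⟩ := exists_rat_btwn hε
  have hqm : (q : ℝ) ∈ Metric.ball (0 : ℝ) ε := by
    rw [Metric.mem_ball, dist_zero_right, Real.norm_eq_abs, abs_of_pos hq0]; exact hq
  obtain ⟨x, hx, y, hy, hxy⟩ := Set.mem_sub.1 (hball hqm)
  refine ⟨x, hx, y, hy, q, hxy, ?_⟩
  rintro rfl
  simp at hq0

/-- An atomless law has a continuous distribution function, which transports it to the uniform law
on (0,1]. This transfers null-fibre questions to Lebesgue measure. -/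
theorem map_cdf_absolutelyContinuous (ν : Measure ℝ) [IsProbabilityMeasure ν]
    (hν : ∀ x, ν {x} = 0) : Measure.map (ProbabilityTheory.cdf ν) ν ≪ volume := by
  set F := ProbabilityTheory.cdf ν with hF
  have hmono : Monotone F := F.mono
  have hcont : Continuous F := by
    refine continuous_iff_continuousAt.2 fun x => ?_
    rw [hmono.continuousAt_iff_leftLim_eq_rightLim, F.rightLim_eq]
    have h := F.measure_singleton x
    rw [hF, ProbabilityTheory.measure_cdf, hν] at h
    have h2 := hmono.leftLim_le (le_refl x)
    have := ENNReal.ofReal_eq_zero.1 h.symm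
    rw [hF] at h2 ⊢
    linarith
  -- The sublevel set of `F` at `a` is a closed half-line, and continuity forces `F` to equal `a` at
  -- its endpoint.
  have key : ∀ a : ℝ, 0 < a → a < 1 → ν (F ⁻¹' Iic a) = ENNReal.ofReal a := by
    intro a ha0 ha1
    set S := F ⁻¹' Iic a with hS
    have hclosed : IsClosed S := isClosed_Iic.preimage hcont
    have hne : S.Nonempty :=
      (((ProbabilityTheory.tendsto_cdf_atBot ν).eventually (gt_mem_nhds ha0)).exists).imp
        fun _ h => le_of_lt h
    have hbdd : BddAbove S := by
      obtain ⟨y, hy⟩ :=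
        ((ProbabilityTheory.tendsto_cdf_atTop ν).eventually (lt_mem_nhds ha1)).exists
      refine ⟨y, fun z hz => ?_⟩
      by_contra hlt
      exact absurd (hmono (not_le.1 hlt).le) (not_le.2 (lt_of_le_of_lt hz hy))
    have hmem : sSup S ∈ S := hclosed.csSup_mem hne hbdd
    have hSeq : S = Iic (sSup S) :=
      Set.Subset.antisymm (fun z hz => le_csSup hbdd hz) fun z hz => (hmono hz).trans hmem
    have hFa : F (sSup S) = a := by
      refine le_antisymm hmem (not_lt.1 fun hlt => ?_)
      have hev : ∀ᶠ y in 𝓝[>] (sSup S), F y < a :=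
        (hcont.continuousAt.eventually (gt_mem_nhds hlt)).filter_mono nhdsWithin_le_nhds
      obtain ⟨y, hy, hy2⟩ := (hev.and self_mem_nhdsWithin).exists
      exact absurd (le_csSup hbdd (show y ∈ S from le_of_lt hy)) (not_le.2 hy2)
    rw [hSeq, ← ProbabilityTheory.ofReal_cdf, ← hF, hFa]
  have heq : Measure.map F ν = volume.restrict (Ioc 0 1) := by
    have : IsFiniteMeasure (Measure.map F ν) := inferInstance
    refine Measure.ext_of_Iic _ _ fun a => ?_
    rw [Measure.map_apply hcont.measurable measurableSet_Iic,
      Measure.restrict_apply measurableSet_Iic]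
    have hinter : Iic a ∩ Ioc (0 : ℝ) 1 = Ioc 0 (min 1 a) := by
      ext x; simp only [mem_inter_iff, mem_Iic, mem_Ioc, le_min_iff]; tauto
    rw [hinter, Real.volume_Ioc, sub_zero]
    rcases le_or_gt 1 a with h1 | h1
    · have : F ⁻¹' Iic a = univ :=
        eq_univ_of_forall fun x => (ProbabilityTheory.cdf_le_one ν x).trans h1
      rw [this, min_eq_left h1]; simp
    rw [min_eq_right h1.le]
    rcases lt_or_ge 0 a with h0 | h0
    · exact key a h0 h1
    · rw [ENNReal.ofReal_of_nonpos h0]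
      -- For `a ≤ 0` the sublevel set is contained in those at arbitrarily small positive levels, to
      -- which `key` applies.
      refine le_antisymm (le_of_forall_pos_le_add ?_) zero_le
      intro ε hε
      rw [zero_add]
      by_cases hε' : ε = ⊤
      · simp [hε']
      have hm : 0 < min ε.toReal (1 / 2) := lt_min (ENNReal.toReal_pos hε.ne' hε') (by norm_num)
      calc ν (F ⁻¹' Iic a) ≤ ν (F ⁻¹' Iic (min ε.toReal (1 / 2))) :=
            measure_mono (preimage_mono (Iic_subset_Iic.2 (h0.trans hm.le)))
        _ = ENNReal.ofReal (min ε.toReal (1 / 2)) :=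
            key _ hm ((min_le_right _ _).trans_lt (by norm_num))
        _ ≤ ENNReal.ofReal ε.toReal := ENNReal.ofReal_le_ofReal (min_le_left _ _)
        _ = ε := ENNReal.ofReal_toReal hε'
  rw [heq]
  exact Measure.absolutelyContinuous_of_le Measure.restrict_le_self

variable {X : Type*} [TopologicalSpace X] [T2Space X] [MeasurableSpace X] [BorelSpace X]

/-- A form of Lusin's theorem. -/
theorem exists_isCompact_continuousOn {Y : Type*} [TopologicalSpace Y]
    [SecondCountableTopology Y] [MeasurableSpace Y] [OpensMeasurableSpace Y]
    (μ : Measure X) [IsFiniteMeasure μ] [μ.InnerRegularCompactLTTop] {g : X → Y}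
    (hg : Measurable g) {A : Set X} (hA : MeasurableSet A) (h0 : μ A ≠ 0) :
    ∃ K ⊆ A, IsCompact K ∧ μ K ≠ 0 ∧ ContinuousOn g K := by
  obtain ⟨b, hbc, -, hb⟩ := TopologicalSpace.exists_countable_basis Y
  have : Countable b := hbc.to_subtype
  have hA2 : μ A / 2 ≠ 0 := by simpa using h0
  obtain ⟨δ, hδ, hsum⟩ := ENNReal.exists_pos_sum_of_countable' hA2 b
  have hU : ∀ U : b, MeasurableSet (g ⁻¹' (U : Set Y)) := fun U =>
    hg (hb.isOpen U.2).measurableSet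
  have h2 : ∀ U : b, (δ U / 2) ≠ 0 := fun U => by simpa using (hδ U).ne'
  -- For each basic open `U`, both `A ∩ g⁻¹U` and `A \ g⁻¹U` are exhausted by compacts up to `δ U /
  -- 2`. On the intersection of the unions `K U ∪ K' U`, the set `g⁻¹U` is the complement of the
  -- closed set `K' U`, hence relatively open.
  choose K hK hKc hKm using fun U : b =>
    (hA.inter (hU U)).exists_isCompact_sdiff_lt (measure_ne_top μ _) (h2 U)
  choose K' hK' hKc' hKm' using fun U : b =>
    (hA.diff (hU U)).exists_isCompact_sdiff_lt (measure_ne_top μ _) (h2 U)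
  rcases isEmpty_or_nonempty b with hbe | ⟨⟨U0⟩⟩
  · obtain ⟨K, hKA, hKc, hKm⟩ := hA.exists_isCompact_sdiff_lt (measure_ne_top μ _) hA2
    refine ⟨K, hKA, hKc, fun h => ?_, ?_⟩
    · have : μ A ≤ μ (A \ K) := by
        calc μ A ≤ μ (A \ K ∪ K) := measure_mono (by rw [sdiff_union_self]; exact subset_union_left)
          _ ≤ _ := (measure_union_le _ _).trans (by rw [h, add_zero])
      exact absurd (this.trans_lt hKm) (not_lt.2 (ENNReal.half_le_self))
    · have : IsEmpty X := ⟨fun x => by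
        obtain ⟨U, hU, -⟩ := hb.exists_subset_of_mem_open (mem_univ (g x)) isOpen_univ
        exact hbe.false ⟨U, hU⟩⟩
      intro x
      exact this.elim x
  · refine ⟨⋂ U, (K U ∪ K' U), ?_, ?_, ?_, ?_⟩
    · intro x hx
      rcases mem_iInter.1 hx U0 with h | h
      · exact (hK U0 h).1
      · exact (hK' U0 h).1
    · exact ((hKc U0).union (hKc' U0)).of_isClosed_subset
        (isClosed_iInter fun U => ((hKc U).union (hKc' U)).isClosed) (iInter_subset _ U0)
    · intro h
      have hsub : A ⊆ (⋂ U, (K U ∪ K' U)) ∪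
          ⋃ U : b, ((A ∩ g ⁻¹' (U : Set Y)) \ K U ∪ (A \ g ⁻¹' (U : Set Y)) \ K' U) := by
        intro x hx
        by_cases hxi : x ∈ ⋂ U, (K U ∪ K' U)
        · exact Or.inl hxi
        · right
          simp only [mem_iInter, mem_union, not_forall, not_or] at hxi
          obtain ⟨U, h1, h2⟩ := hxi
          refine mem_iUnion.2 ⟨U, ?_⟩
          by_cases hxU : g x ∈ (U : Set Y)
          · exact Or.inl ⟨⟨hx, hxU⟩, h1⟩
          · exact Or.inr ⟨⟨hx, hxU⟩, h2⟩
      have hle : μ A ≤ ∑' U, δ U := by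
        calc μ A ≤ _ := measure_mono hsub
          _ ≤ _ := measure_union_le _ _
          _ ≤ 0 + ∑' U, δ U := by
            rw [h]
            gcongr
            refine (measure_iUnion_le _).trans (ENNReal.tsum_le_tsum fun U => ?_)
            refine (measure_union_le _ _).trans ?_
            calc _ ≤ δ U / 2 + δ U / 2 := add_le_add (hKm U).le (hKm' U).le
              _ = δ U := ENNReal.add_halves _
          _ = _ := zero_add _
      exact absurd (hle.trans_lt hsum) (not_lt.2 ENNReal.half_le_self)
    · rw [continuousOn_iff_continuous_domRestrict, hb.continuous_iff]
      intro U hUb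
      have hcl : IsClosed (K' ⟨U, hUb⟩) := (hKc' _).isClosed
      have : (domRestrict (⋂ U, (K U ∪ K' U)) g) ⁻¹' U = (Subtype.val) ⁻¹' (K' ⟨U, hUb⟩)ᶜ := by
        ext ⟨x, hx⟩
        have hx' := mem_iInter.1 hx ⟨U, hUb⟩
        simp only [mem_preimage, domRestrict_apply, mem_compl_iff]
        constructor
        · exact fun h h' => (hK' ⟨U, hUb⟩ h').2 h
        · intro h
          rcases hx' with h' | h'
          · exact (hK ⟨U, hUb⟩ h').2
          · exact absurd h' h
      rw [this]
      exact hcl.isOpen_compl.preimage continuous_subtype_val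

/-- A map to `ℝ` for which the preimage of *every* set is measurable and every fibre is null exists
only for the zero measure. -/
theorem measure_eq_zero_of_null_fibres_real (μ : Measure X) [IsFiniteMeasure μ]
    [μ.InnerRegularCompactLTTop] {g : X → ℝ} (hg : ∀ D : Set ℝ, MeasurableSet (g ⁻¹' D))
    (h0 : ∀ r, μ (g ⁻¹' {r}) = 0) : μ = 0 := by
  by_contra hμ
  have hgm : Measurable g := fun D _ => hg D
  have : NeZero μ := ⟨hμ⟩
  set ν := Measure.map g ((μ univ)⁻¹ • μ) with hν
  have hprob : IsProbabilityMeasure ((μ univ)⁻¹ • μ) := inferInstance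
  have : IsProbabilityMeasure ν := Measure.isProbabilityMeasure_map hgm.aemeasurable
  have hνx : ∀ x, ν {x} = 0 := fun x => by
    rw [hν, Measure.map_apply hgm (measurableSet_singleton x)]
    simp [h0 x]
  set F := ProbabilityTheory.cdf ν with hF
  have hFm : Measurable F := F.mono.measurable
  have hac := map_cdf_absolutelyContinuous ν hνx
  -- A Vitali transversal for ℝ/ℚ: the sets `D q` below are its rational translates. They need not
  -- be Lebesgue measurable, but their preimages are measurable by hypothesis.
  let rep : ℝ → ℝ := fun x => Quotient.out
    (QuotientAddGroup.mk x : ℝ ⧸ ((Rat.castHom ℝ).toAddMonoidHom).range)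
  have hrep : ∀ x, ∃ q : ℚ, x - rep x = q := by
    intro x
    have : (QuotientAddGroup.mk (rep x) : ℝ ⧸ ((Rat.castHom ℝ).toAddMonoidHom).range) =
      QuotientAddGroup.mk x := Quotient.out_eq _
    obtain ⟨q, hq⟩ := QuotientAddGroup.eq.1 this
    exact ⟨q, by rw [sub_eq_neg_add]; exact hq.symm⟩
  let D : ℚ → Set ℝ := fun q => {x | x - rep x = q}
  have hcover : (⋃ q, (F ∘ g) ⁻¹' D q) = univ :=
    eq_univ_of_forall fun x => mem_iUnion.2 (hrep (F (g x)))
  have hex : ∃ q, μ ((F ∘ g) ⁻¹' D q) ≠ 0 := by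
    by_contra! h
    exact hμ (Measure.measure_univ_eq_zero.1 (by rw [← hcover]; exact measure_iUnion_null h))
  obtain ⟨q, hq⟩ := hex
  obtain ⟨K, hKA, hKc, hK0, hKcont⟩ := exists_isCompact_continuousOn μ (g := F ∘ g)
    (hFm.comp hgm) (hg (F ⁻¹' D q)) hq
  have himg : IsCompact ((F ∘ g) '' K) := hKc.image_of_continuousOn hKcont
  -- A Lebesgue null image would have null preimage by absolute continuity, and that preimage
  -- contains `K`. The image lies in `D q`, so two of its points at rational distance share a
  -- representative and coincide.
  have hvol : volume ((F ∘ g) '' K) ≠ 0 := by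
    intro hz
    have h1 := hac hz
    rw [Measure.map_apply hFm himg.measurableSet, hν,
      Measure.map_apply hgm (hFm himg.measurableSet)] at h1
    simp only [Measure.smul_apply, smul_eq_mul, mul_eq_zero, ENNReal.inv_eq_zero,
      measure_ne_top, false_or] at h1
    exact hK0 (measure_mono_null (subset_preimage_image (F ∘ g) K) h1)
  obtain ⟨x, hx, y, hy, p, hxy, hp⟩ := exists_rat_difference himg.measurableSet hvol
  have hDx : x ∈ D q := by obtain ⟨z, hz, rfl⟩ := hx; exact hKA hz
  have hDy : y ∈ D q := by obtain ⟨z, hz, rfl⟩ := hy; exact hKA hz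
  have hrr : rep x = rep y := by
    have : (QuotientAddGroup.mk x : ℝ ⧸ ((Rat.castHom ℝ).toAddMonoidHom).range) = QuotientAddGroup.mk y :=
      QuotientAddGroup.eq.2 ⟨-p, by
        change ((-p : ℚ) : ℝ) = _
        push_cast
        rw [← hxy]; ring⟩
    simp only [rep, this]
  have hDx' : x - rep x = q := hDx
  have hDy' : y - rep y = q := hDy
  apply hp
  have : x - y = 0 := by linarith
  rw [this] at hxy
  exact_mod_cast hxy.symm

end NullFibres

/-! ### Null fibres for two-valued measures -/

section NullFibres

open Set Filter Topology Cardinal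

variable {X : Type*} [TopologicalSpace X] [T2Space X] [MeasurableSpace X] [BorelSpace X]

universe v

/-- A countably complete ideal of measurable sets contains a set of maximal measure, modulo which
all other members are null. -/
theorem exists_maximal_measurableSet_of_iUnion {Y : Type*} [MeasurableSpace Y] (μ : Measure Y)
    [IsFiniteMeasure μ] (𝒩 : Set (Set Y)) (hm : ∀ A ∈ 𝒩, MeasurableSet A) (hne : ∅ ∈ 𝒩)
    (hU : ∀ A : ℕ → Set Y, (∀ n, A n ∈ 𝒩) → ⋃ n, A n ∈ 𝒩) :
    ∃ A₀ ∈ 𝒩, ∀ A ∈ 𝒩, μ (A \ A₀) = 0 := by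
  obtain ⟨u, -, hu, hu2⟩ := exists_seq_tendsto_sSup (S := μ '' 𝒩) ⟨_, mem_image_of_mem _ hne⟩
    (OrderTop.bddAbove _)
  choose A hA hAu using hu2
  refine ⟨⋃ n, A n, hU A hA, fun B hB => ?_⟩
  have hle : ∀ C ∈ 𝒩, μ C ≤ μ (⋃ n, A n) := by
    intro C hC
    refine (le_sSup (mem_image_of_mem μ hC)).trans (le_of_tendsto' hu fun n => ?_)
    rw [← hAu n]
    exact measure_mono (subset_iUnion A n)
  have h2 : B ∪ (⋃ n, A n) ∈ 𝒩 := by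
    have := hU (fun n => Nat.casesOn n B A) (fun n => by cases n; exacts [hB, hA _])
    convert this using 1
    ext x
    simp only [mem_union, mem_iUnion]
    constructor
    · rintro (h | ⟨n, h⟩)
      exacts [⟨0, h⟩, ⟨n + 1, h⟩]
    · rintro ⟨_ | n, h⟩
      exacts [Or.inl h, Or.inr ⟨n, h⟩]
  have h3 := hle _ h2
  rw [← sdiff_union_self, measure_union disjoint_sdiff_left (hm _ (hU A hA))] at h3
  have hfin := measure_ne_top μ (⋃ n, A n)
  by_contra h
  have := ENNReal.lt_add_right hfin h
  rw [add_comm] at this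
  exact absurd h3 (not_le.2 this)

/-- The two-valued case of `measure_eq_zero_of_null_fibres`. -/
theorem measure_eq_zero_of_null_fibres_of_two_valued {I : Type v} (μ : Measure X)
    [IsFiniteMeasure μ] [μ.InnerRegularCompactLTTop] {f : X → I}
    (hf : ∀ J : Set I, MeasurableSet (f ⁻¹' J)) (h0 : ∀ i, μ (f ⁻¹' {i}) = 0)
    (hU : ∀ {α : Type v}, #α < #I → ∀ N : α → Set I, (∀ a, μ (f ⁻¹' N a) = 0) →
      μ (f ⁻¹' ⋃ a, N a) = 0)
    (hI : ℵ₀ < #I)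
    (htwo : ∀ J : Set I, μ (f ⁻¹' J) = 0 ∨ μ (f ⁻¹' Jᶜ) = 0) : μ = 0 := by
  by_contra hμ
  have hinf : Infinite I := Cardinal.infinite_iff.2 hI.le
  -- In the order type of an initial ordinal, every initial segment has smaller cardinality, so its
  -- preimage is null by `hU`.
  obtain ⟨_, _, hord⟩ := exists_ord_eq_type_lt I
  have hIic : ∀ i : I, #(Iic i) < #I := by
    intro i
    have h1 := mk_Iio_lt i hord
    rw [← Iio_insert]
    refine (mk_insert_le).trans_lt (add_lt_of_lt hI.le h1 (one_lt_aleph0.trans hI))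
  have hnull : ∀ i : I, μ (f ⁻¹' Iic i) = 0 := by
    intro i
    have := hU (hIic i) (fun j => {(j : I)}) (fun j => h0 j)
    rwa [iUnion_coe_set, biUnion_of_singleton] at this
  have huniv : μ univ ≠ 0 := fun h => hμ (Measure.measure_univ_eq_zero.1 h)
  have hK : ∀ i : I, ∃ K ⊆ f ⁻¹' Ioi i, IsCompact K ∧ μ K ≠ 0 := by
    intro i
    have hm : 0 < μ (f ⁻¹' Ioi i) := by
      rw [pos_iff_ne_zero]
      intro h
      apply huniv
      have : (univ : Set X) = f ⁻¹' Iic i ∪ f ⁻¹' Ioi i := by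
        rw [← preimage_union, Iic_union_Ioi, preimage_univ]
      rw [this]
      exact measure_union_null (hnull i) h
    obtain ⟨K, hK, hc, hK0⟩ := (hf (Ioi i)).exists_lt_isCompact_of_ne_top (measure_ne_top μ _) hm
    exact ⟨K, hK, hc, hK0.ne'⟩
  choose K hKsub hKc hK0 using hK
  have htwo' : ∀ P : I → Prop, (∀ᵐ x ∂μ, P (f x)) ∨ ∀ᵐ x ∂μ, ¬ P (f x) := by
    intro P
    rcases htwo {i | P i} with h | h
    · exact Or.inr (by rw [ae_iff]; simpa using h)
    · exact Or.inl h
  -- Sets that almost every `K (f x)` misses up to a null set. A largest one, `A₀`, is removed so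
  -- that any remaining non-null set meets almost every `K (f x)` in positive measure.
  let 𝒩 : Set (Set X) := {A | MeasurableSet A ∧ ∀ᵐ x ∂μ, μ (A ∩ K (f x)) = 0}
  obtain ⟨A₀, hA₀, hmax⟩ := exists_maximal_measurableSet_of_iUnion μ 𝒩 (fun A hA => hA.1)
    ⟨MeasurableSet.empty, by simp⟩ (by
      intro A hA
      refine ⟨MeasurableSet.iUnion fun n => (hA n).1, ?_⟩
      filter_upwards [ae_all_iff.2 fun n => (hA n).2] with x hx
      rw [iUnion_inter]
      exact measure_iUnion_null hx)
  -- By two-valuedness the alternative is that almost every `K (f x)` misses `A \ A₀`; then `A \ A₀`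
  -- belongs to `𝒩` and is null by maximality.
  have hstep : ∀ A, MeasurableSet A → μ (A \ A₀) ≠ 0 →
      ∀ᵐ x ∂μ, μ ((A ∩ K (f x)) \ A₀) ≠ 0 := by
    intro A hA hne
    rcases htwo' (fun i => μ ((A ∩ K i) \ A₀) = 0) with h | h
    · exfalso
      apply hne
      have h2 := hmax (A \ A₀) ⟨hA.diff hA₀.1, by
        filter_upwards [h] with x hx
        rwa [← inter_sdiff_right_comm]⟩
      simpa using h2
    · exact h
  let good : Set (Set I) := {S | ∀ T : Finset I, ↑T ⊆ S → μ ((⋂ i ∈ T, K i) \ A₀) ≠ 0}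
  obtain ⟨S, hS⟩ := zorn_subset good (by
    intro c hc hchain
    rcases c.eq_empty_or_nonempty with rfl | hcne
    · refine ⟨∅, ?_, by simp⟩
      intro T hT
      have : T = ∅ := by simpa using hT
      subst this
      simp only [Finset.notMem_empty, iInter_of_empty, iInter_univ]
      intro h
      have hae : ∀ᵐ x ∂μ, x ∈ A₀ := by
        rw [ae_iff]; rwa [← compl_eq_univ_sdiff] at h
      have hne : (ae μ).NeBot := ae_neBot.2 hμ
      obtain ⟨x, hx⟩ := hA₀.2.exists
      apply hK0 (f x)
      refine measure_mono_null (fun y hy => ?_) (measure_union_null hx h)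
      by_cases hyA : y ∈ A₀
      exacts [Or.inl ⟨hyA, hy⟩, Or.inr ⟨trivial, hyA⟩]
    · refine ⟨⋃₀ c, fun T hT => ?_, fun s hs => subset_sUnion_of_mem hs⟩
      obtain ⟨s, hs, hTs⟩ := hchain.directedOn.exists_mem_subset_of_finite_of_subset_sUnion hcne
        T.finite_toSet hT
      exact hc hs T hTs)
  -- A bounded `S` has fewer than `#I` finite subsets, so almost every `x` satisfies `hstep` for all
  -- of them at once. Such an `x` with `f x > b` could be added to `S`, against maximality.
  have hunb : ∀ b : I, ∃ j ∈ S, b < j := by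
    intro b
    by_contra! hb
    have hScard : #S < #I := (mk_le_mk_of_subset hb).trans_lt (hIic b)
    have hfin : #(Finset S) < #I := by
      rcases finite_or_infinite S with h | h
      · exact (Cardinal.mk_lt_aleph0).trans hI
      · rwa [mk_finset_of_infinite]
    have hall : ∀ᵐ x ∂μ, ∀ T : Finset S,
        μ (((⋂ i ∈ T.map (Function.Embedding.subtype _), K i) ∩ K (f x)) \ A₀) ≠ 0 := by
      have h := hU hfin (fun T => {j | ¬ μ (((⋂ i ∈ T.map (Function.Embedding.subtype _), K i) ∩
        K j) \ A₀) ≠ 0}) (fun T => ?_)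
      · rw [ae_iff]
        convert h using 2
        ext x
        simp
      · refine hstep _ (Finset.measurableSet_biInter _ fun i _ => (hKc i).measurableSet) ?_
        refine hS.1 _ fun i hi => ?_
        simp only [Finset.coe_map, mem_image, Function.Embedding.subtype_apply] at hi
        obtain ⟨a, -, rfl⟩ := hi
        exact a.2
    have hgt : ∀ᵐ x ∂μ, b < f x := by
      rw [ae_iff]
      convert hnull b using 2
      ext x; simp
    have hne : (ae μ).NeBot := ae_neBot.2 hμ
    obtain ⟨x, hx, hbx⟩ := (hall.and hgt).exists
    have hins : insert (f x) S ∈ good := by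
      classical
      intro T hT
      have hsub : ((⋂ i ∈ ((T.subtype (· ∈ S)).map (Function.Embedding.subtype _)), K i) ∩
          K (f x)) \ A₀ ⊆ (⋂ i ∈ T, K i) \ A₀ := by
        refine sdiff_subset_sdiff_left fun y hy => mem_iInter₂.2 fun i hi => ?_
        rcases hT hi with rfl | h
        · exact hy.2
        · exact mem_iInter₂.1 hy.1 i (by simp [hi, h])
      exact fun h => hx _ (measure_mono_null hsub h)
    have := hS.2 hins (subset_insert _ _) (mem_insert _ _)
    exact absurd hbx (not_lt.2 (hb _ this))
  obtain ⟨i0⟩ : Nonempty I := inferInstance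
  obtain ⟨j0, hj0, -⟩ := hunb i0
  -- The sets `K j` with `j ∈ S` have the finite intersection property. A common point has `f x > j`
  -- for every `j ∈ S`, which contradicts `hunb`.
  obtain ⟨x, hx⟩ := (hKc j0).inter_iInter_nonempty (fun j : S => K j)
    (fun j => (hKc j).isClosed) (by
      classical
      intro T
      have h := hS.1 (insert j0 (T.map (Function.Embedding.subtype _))) (by
        intro i hi
        simp only [Finset.coe_insert, Finset.coe_map, mem_insert_iff, mem_image,
          Function.Embedding.subtype_apply] at hi
        rcases hi with rfl | ⟨a, -, rfl⟩
        exacts [hj0, a.2])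
      obtain ⟨y, hy⟩ := nonempty_of_measure_ne_zero h
      refine ⟨y, mem_iInter₂.1 hy.1 j0 (by simp), mem_iInter₂.2 fun i hi => ?_⟩
      exact mem_iInter₂.1 hy.1 i (by simp [hi]))
  obtain ⟨j, hj, hlt⟩ := hunb (f x)
  exact absurd (hKsub j (mem_iInter.1 hx.2 ⟨j, hj⟩)) (not_lt.2 hlt.le)

end NullFibres

/-! ### Null fibres in general, and preimages of balls -/

section NullFibres

open Set Filter Topology Cardinal

variable {X : Type*} [TopologicalSpace X] [T2Space X] [MeasurableSpace X] [BorelSpace X]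

universe v

/-- A measure on all subsets of a set, for which no map to the Cantor space has only null fibres, is
two-valued on some set of positive measure. -/
theorem exists_two_valued {Y : Type*} [MeasurableSpace Y] {I : Type v} (μ : Measure Y)
    [IsFiniteMeasure μ] {f : Y → I} (hf : ∀ J : Set I, MeasurableSet (f ⁻¹' J))
    (hC : ∀ h : I → (ℕ → Bool), ∃ c, μ (f ⁻¹' (h ⁻¹' {c})) ≠ 0) :
    ∃ B : Set I, μ (f ⁻¹' B) ≠ 0 ∧ ∀ J ⊆ B, μ (f ⁻¹' J) = 0 ∨ μ (f ⁻¹' (B \ J)) = 0 := by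
  -- `V h` is the sum of the squared masses of the fibres of `h ∘ f`. It decreases under refinement,
  -- so a minimizer has fibres that cannot be split into two non-null pieces.
  let V : (I → (ℕ → Bool)) → ℝ≥0∞ := fun h => ∫⁻ x, μ (f ⁻¹' (h ⁻¹' {h (f x)})) ∂μ
  have hmono : ∀ h h' : I → (ℕ → Bool), (∀ i j, h i = h j → h' i = h' j) → V h ≤ V h' := by
    intro h h' hh
    exact lintegral_mono fun x => measure_mono fun y hy => hh _ _ hy
  have hfinV : ∀ h, V h ≠ ⊤ := fun h => by
    refine ((lintegral_mono fun x => measure_mono (subset_univ _)).trans_lt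
      (b := ∫⁻ _, μ univ ∂μ) ?_).ne
    rw [lintegral_const]
    exact ENNReal.mul_lt_top (measure_lt_top μ _) (measure_lt_top μ _)
  obtain ⟨w, hw⟩ : ∃ w, ∀ h, V w ≤ V h := by
    obtain ⟨u, -, hu, hu2⟩ := exists_seq_tendsto_sInf (S := range V) (range_nonempty V)
      (OrderBot.bddBelow _)
    choose g hg using hu2
    -- Countably many maps to the Cantor space have a common refinement of the same kind, so the
    -- infimum of `V` is attained.
    let e : (ℕ → ℕ → Bool) ≃ (ℕ → Bool) :=
      (Equiv.curry ℕ ℕ Bool).symm.trans (Equiv.arrowCongr Nat.pairEquiv (Equiv.refl _))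
    refine ⟨fun i => e fun n => g n i, fun h => ?_⟩
    refine le_trans ?_ (sInf_le (mem_range_self h))
    refine ge_of_tendsto' hu fun n => ?_
    rw [← hg n]
    exact hmono _ _ fun i j hij => congrFun (e.injective hij) n
  obtain ⟨c, hc⟩ := hC w
  refine ⟨w ⁻¹' {c}, hc, fun J hJ => ?_⟩
  by_contra! hcon
  classical
  -- Prepending the bit of membership in `J` splits the fibre over `c` into `J` and its complement
  -- there.
  let w' : I → (ℕ → Bool) := fun i n => Nat.casesOn n (decide (i ∈ J)) (w i)
  have hw' : ∀ i j, w' i = w' j ↔ (i ∈ J ↔ j ∈ J) ∧ w i = w j := by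
    intro i j
    constructor
    · intro h
      refine ⟨by simpa [w'] using congrFun h 0, funext fun n => congrFun h (n + 1)⟩
    · rintro ⟨h1, h2⟩
      funext n
      cases n
      · simp [w', h1]
      · exact congrFun h2 _
  have hlt : V w' + ∫⁻ x, (f ⁻¹' J).indicator (fun _ => μ (f ⁻¹' (w ⁻¹' {c} \ J))) x ∂μ
      ≤ V w := by
    rw [← lintegral_add_right _ (measurable_const.indicator (hf J))]
    refine lintegral_mono fun x => ?_
    by_cases hx : f x ∈ J
    · rw [indicator_of_mem (show x ∈ f ⁻¹' J from hx)]
      have hwc : w (f x) = c := hJ hx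
      have h1 : f ⁻¹' (w' ⁻¹' {w' (f x)}) = f ⁻¹' J := by
        ext y
        simp only [mem_preimage, mem_singleton_iff, hw']
        exact ⟨fun h => h.1.2 hx, fun h => ⟨by simp [h, hx], (show w (f y) = c from hJ h).trans hwc.symm⟩⟩
      rw [h1, hwc, ← measure_union (disjoint_sdiff_right.preimage f) (hf _), ← preimage_union,
        union_sdiff_cancel hJ]
    · rw [indicator_of_notMem (show x ∉ f ⁻¹' J from hx), add_zero]
      exact measure_mono fun y hy => ((hw' _ _).1 hy).2
  rw [lintegral_indicator (hf J), lintegral_const, Measure.restrict_apply_univ] at hlt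
  have := ENNReal.lt_add_right (hfinV w') (mul_ne_zero hcon.2 hcon.1)
  exact absurd (this.trans_le hlt) (not_lt.2 (hw w'))

/-- If every union of fibres of `f` is measurable and the fibres are null, then the measure, assumed
finite and inner regular, is zero. -/
theorem measure_eq_zero_of_null_fibres {I : Type v} (μ : Measure X)
    [IsFiniteMeasure μ] [μ.InnerRegularCompactLTTop] {f : X → I}
    (hf : ∀ J : Set I, MeasurableSet (f ⁻¹' J)) (h0 : ∀ i, μ (f ⁻¹' {i}) = 0) : μ = 0 := by
  suffices H : ∀ κ : Cardinal.{v}, ∀ (I : Type v), #I = κ → ∀ (μ : Measure X)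
      [IsFiniteMeasure μ] [μ.InnerRegularCompactLTTop] (f : X → I)
      (_ : ∀ J : Set I, MeasurableSet (f ⁻¹' J)) (_ : ∀ i, μ (f ⁻¹' {i}) = 0), μ = 0 from
    H _ I rfl μ f hf h0
  clear h0 hf f
  intro κ
  induction κ using Cardinal.lt_wf.induction with
  | _ κ ih =>
  rintro I rfl μ _ _ f hf h0
  rcases le_or_gt #I 𝔠 with hI | hI
  · have : ∃ e : I → ℝ, Function.Injective e := by
      have h : lift.{0} #I ≤ lift.{v} #ℝ := by rw [Cardinal.mk_real]; simpa using hI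
      obtain ⟨e⟩ := Cardinal.lift_mk_le'.1 h
      exact ⟨e, e.injective⟩
    obtain ⟨e, he⟩ := this
    refine measure_eq_zero_of_null_fibres_real μ (g := e ∘ f) (fun D => hf (e ⁻¹' D)) fun r => ?_
    by_cases hr : ∃ i, e i = r
    · obtain ⟨i, rfl⟩ := hr
      rw [preimage_comp, show e ⁻¹' {e i} = {i} from by ext; simp [he.eq_iff]]
      exact h0 i
    · rw [preimage_comp, show e ⁻¹' {r} = ∅ from by
        ext j; simp only [mem_preimage, mem_singleton_iff, mem_empty_iff_false, iff_false]
        exact fun h => hr ⟨j, h⟩]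
      simp
  have hIinf : ℵ₀ < #I := aleph0_lt_continuum.trans hI
  -- null fibres of maps to smaller sets have null union
  have hsmall : ∀ {α : Type v}, #α < #I → ∀ g : I → α,
      μ (f ⁻¹' (g ⁻¹' {a | μ (f ⁻¹' (g ⁻¹' {a})) = 0})) = 0 := by
    intro α hα g
    -- After restriction to the union of the null fibres, all fibres of `g ∘ f` are null and the
    -- induction hypothesis applies.
    have := ih _ hα α rfl (μ.restrict (f ⁻¹' (g ⁻¹' {a | μ (f ⁻¹' (g ⁻¹' {a})) = 0}))) (g ∘ f)
      (fun J => hf (g ⁻¹' J)) (fun a => by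
        rw [preimage_comp, Measure.restrict_apply (hf (g ⁻¹' {a}))]
        by_cases ha : μ (f ⁻¹' (g ⁻¹' {a})) = 0
        · exact measure_mono_null inter_subset_left ha
        · convert measure_empty (μ := μ) using 2
          ext x
          simp only [mem_inter_iff, mem_preimage, mem_singleton_iff,
            mem_ofPred_eq, mem_empty_iff_false, iff_false, not_and]
          rintro rfl
          exact ha)
    simpa using this
  have hU : ∀ {α : Type v}, #α < #I → ∀ N : α → Set I, (∀ a, μ (f ⁻¹' N a) = 0) →
      μ (f ⁻¹' ⋃ a, N a) = 0 := by
    classical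
    intro α hα N hN
    -- Choosing one index for each point makes the sets `N a` disjoint, so that `hsmall` applies to
    -- the fibres of `g`.
    let g : I → Option α := fun i => if h : ∃ a, i ∈ N a then some h.choose else none
    have hopt : #(Option α) < #I := by
      rw [mk_option]
      exact add_lt_of_lt hIinf.le hα (one_lt_aleph0.trans hIinf)
    refine measure_mono_null (preimage_mono fun i hi => ?_) (hsmall hopt g)
    have hex : ∃ a, i ∈ N a := mem_iUnion.1 hi
    have hgi : g i = some hex.choose := dif_pos hex
    simp only [mem_preimage, mem_ofPred_eq, hgi]
    refine measure_mono_null (preimage_mono fun j hj => ?_) (hN hex.choose)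
    simp only [mem_preimage, mem_singleton_iff, g] at hj
    split_ifs at hj with h
    rw [← Option.some.inj hj]
    exact h.choose_spec
  by_contra hμ
  have huniv : μ univ ≠ 0 := fun h => hμ (Measure.measure_univ_eq_zero.1 h)
  -- The Cantor space has cardinality `𝔠 < #I`, so by `hsmall` a map into it cannot have only null
  -- fibres.
  obtain ⟨B, hB, htwo⟩ := exists_two_valued μ hf (by
    intro h
    by_contra! hcon
    have hc : #(ULift.{v} (ℕ → Bool)) < #I := by
      simpa using hI
    have := hsmall hc (fun i => ULift.up (h i))
    apply huniv
    refine measure_mono_null (fun x _ => ?_) this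
    simp only [mem_preimage, mem_ofPred_eq]
    convert hcon (h (f x)) using 3
    ext i
    simp)
  have hz := measure_eq_zero_of_null_fibres_of_two_valued (μ.restrict (f ⁻¹' B)) hf
    (fun i => by
      rw [Measure.restrict_apply (hf _)]
      exact measure_mono_null inter_subset_left (h0 i))
    (fun hα N hN => by
      rw [Measure.restrict_apply (hf _), ← preimage_inter, iUnion_inter]
      refine hU hα _ fun a => ?_
      have := hN a
      rwa [Measure.restrict_apply (hf _), ← preimage_inter] at this)
    hIinf (fun J => by
      rw [Measure.restrict_apply (hf _), Measure.restrict_apply (hf _), ← preimage_inter,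
        ← preimage_inter]
      have := htwo (J ∩ B) inter_subset_right
      convert this using 4
      ext; simp; tauto)
  apply hB
  simpa using hz

/-- If all balls of radius `ε` have null preimage under a Borel map to a metric space, then the
measure, assumed finite and inner regular, is zero. -/
theorem measure_eq_zero_of_null_ball_preimages {Y : Type v} [PseudoMetricSpace Y] (μ : Measure X)
    [IsFiniteMeasure μ] [μ.InnerRegularCompactLTTop] {F : X → Y}
    (hF : Measurable[_, borel Y] F) {ε : ℝ} (hε : 0 < ε)
    (h0 : ∀ y, μ (F ⁻¹' Metric.ball y ε) = 0) : μ = 0 := by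
  obtain ⟨_, _⟩ := exists_wellFoundedLT Y
  have hne : ∀ y : Y, {h : Y | dist y h < ε}.Nonempty := fun y => ⟨y, by simpa using hε⟩
  -- The least centre whose ball contains `y`. The fibres of `m` lie in balls, and every union of
  -- fibres will turn out to be an F_σ set.
  let m : Y → Y := fun y => WellFounded.min wellFounded_lt {h : Y | dist y h < ε} (hne y)
  have hm1 : ∀ y, dist y (m y) < ε := fun y => WellFounded.min_mem _ _ (hne y)
  have hm2 : ∀ y h, h < m y → ε ≤ dist y h := fun y h hlt => by
    by_contra! hcon
    exact WellFounded.not_lt_min wellFounded_lt {h : Y | dist y h < ε} hcon hlt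
  have hm3 : ∀ y h, dist y h < ε → (∀ h' < h, ε ≤ dist y h') → m y = h := fun y h h1 h2 => by
    rcases lt_trichotomy (m y) h with h3 | h3 | h3
    · exact absurd (hm1 y) (not_lt.2 (h2 _ h3))
    · exact h3
    · exact absurd h1 (not_lt.2 (hm2 y h h3))
  -- Stone's device from the paracompactness of metric spaces: for fixed `n` the sets `W n h` are
  -- closed and pairwise at distance at least `1 / (n + 1)`, so any union of them is closed.
  let W : ℕ → Y → Set Y := fun n h =>
    {y | dist y h ≤ ε - 1 / (n + 1) ∧ ∀ h' < h, ε ≤ dist y h'}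
  have hWm : ∀ n h y, y ∈ W n h → m y = h := fun n h y hy =>
    hm3 y h (hy.1.trans_lt (by have : (0 : ℝ) < 1 / (n + 1) := by positivity
                               linarith)) hy.2
  have hWcl : ∀ n h, IsClosed (W n h) := fun n h => by
    have : W n h = {y | dist y h ≤ ε - 1 / (n + 1)} ∩
        ⋂ h', ⋂ (_ : h' < h), {y | ε ≤ dist y h'} := by
      ext; simp [W]
    rw [this]
    exact (isClosed_le (continuous_id.dist continuous_const) continuous_const).inter
      (isClosed_iInter fun h' => isClosed_iInter fun _ =>
        isClosed_le continuous_const (continuous_id.dist continuous_const))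
  have hsep : ∀ n (J : Set Y), IsClosed (⋃ h ∈ J, W n h) := by
    intro n J
    rw [biUnion_eq_iUnion]
    refine LocallyFinite.isClosed_iUnion ?_ fun h => hWcl n h
    intro y
    refine ⟨Metric.ball y (1 / (n + 1) / 2), Metric.ball_mem_nhds _ (by positivity), ?_⟩
    refine Set.Subsingleton.finite ?_
    have key : ∀ h h', h < h' → ∀ y₁ y₂, y₁ ∈ W n h → y₂ ∈ W n h' → 1 / ((n : ℝ) + 1) ≤ dist y₁ y₂ := by
      intro h h' hlt y₁ y₂ h1 h2
      have h3 := h2.2 h hlt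
      have h4 := h1.1
      have h5 := dist_triangle y₂ y₁ h
      rw [dist_comm y₂ y₁] at h5
      linarith
    rintro ⟨h, hJ⟩ ⟨y₁, hy₁, hb₁⟩ ⟨h', hJ'⟩ ⟨y₂, hy₂, hb₂⟩
    rw [Subtype.mk.injEq]
    have hd : dist y₁ y₂ < 1 / (n + 1) := by
      have := dist_triangle_right y₁ y₂ y
      rw [Metric.mem_ball] at hb₁ hb₂
      linarith
    rcases lt_trichotomy h h' with h3 | h3 | h3
    · exact absurd hd (not_lt.2 (key _ _ h3 _ _ hy₁ hy₂))
    · exact h3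
    · rw [dist_comm] at hd
      exact absurd hd (not_lt.2 (key _ _ h3 _ _ hy₂ hy₁))
  have hpre : ∀ J : Set Y, m ⁻¹' J = ⋃ n : ℕ, ⋃ h ∈ J, W n h := by
    intro J
    ext y
    simp only [mem_preimage, mem_iUnion, exists_prop]
    constructor
    · intro hy
      obtain ⟨n, hn⟩ := exists_nat_one_div_lt (sub_pos.2 (hm1 y))
      exact ⟨n, m y, hy, by linarith, fun h' hh' => hm2 y h' hh'⟩
    · rintro ⟨n, h, hJ, hy⟩
      rwa [hWm n h y hy]
  refine measure_eq_zero_of_null_fibres μ (f := m ∘ F) (fun J => ?_) fun h => ?_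
  · have : MeasurableSet[borel Y] (m ⁻¹' J) := by
      rw [hpre]
      exact @MeasurableSet.iUnion _ _ (borel Y) _ _ fun n => by
        let _ : MeasurableSpace Y := borel Y
        have : BorelSpace Y := ⟨rfl⟩
        exact (hsep n J).measurableSet
    exact hF this
  · refine measure_mono_null (fun x hx => ?_) (h0 h)
    have hx' : m (F x) = h := hx
    have := hm1 (F x)
    rwa [hx'] at this

end NullFibres

/-! ### Strong continuity of measurable twisted representations -/

section TwistedRepContinuity

open Set Filter Topology

theorem norm_sub_le_norm_sub_smul {H : Type*} [NormedAddCommGroup H] [NormedSpace ℂ H] (z : ℂ)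
    (x y : H) : ‖x - y‖ ≤ ‖x - z • y‖ + ‖z - 1‖ * ‖y‖ := by
  calc ‖x - y‖ = ‖(x - z • y) + (z - 1) • y‖ := by congr 1; module
    _ ≤ _ := (norm_add_le _ _).trans (by rw [norm_smul])

namespace TwistedRep

variable {G : Type u} [Group G] [TopologicalSpace G] [MeasurableSpace G]
  {σ : ContinuousTwoCocycle G} {H : Type u} [NormedAddCommGroup H] [InnerProductSpace ℂ H]
  [CompleteSpace H] (π : TwistedRep σ H)

/-- The unitary `π(s)` as an operator. -/
abbrev op (s : G) : H →L[ℂ] H := (π.toFun s : H →L[ℂ] H)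

theorem norm_op (s : G) (x : H) : ‖π.op s x‖ = ‖x‖ :=
  ContinuousLinearMap.norm_map_of_mem_unitary (π.toFun s).2 x

theorem op_op (s t : G) (x : H) : π.op s (π.op t x) = (σ s t : ℂ) • π.op (s * t) x :=
  congrArg (fun T : H →L[ℂ] H => T x) (π.map_mul s t)

theorem star_op_op (s : G) (x : H) : star (π.op s) (π.op s x) = x := by
  have := (Unitary.mem_iff.1 (π.toFun s).2).1
  exact congrArg (fun T : H →L[ℂ] H => T x) this

theorem op_star_op (s : G) (x : H) : π.op s (star (π.op s) x) = x := by
  have := (Unitary.mem_iff.1 (π.toFun s).2).2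
  exact congrArg (fun T : H →L[ℂ] H => T x) this

theorem op_one (x : H) : π.op 1 x = x := by
  have h := π.op_op 1 1 (star (π.op 1) x)
  rw [σ.map_one_right, mul_one, Circle.coe_one, one_smul, op_star_op] at h
  exact h

variable [IsTopologicalGroup G] [T2Space G] [LocallyCompactSpace G] [BorelSpace G]

/-- Some ball of radius `ε` pulls back to a set `E` of positive measure, so `E / E` is a
neighbourhood of 1. For `u = s / t` with `s, t ∈ E`, the vector `π(u)π(t)ξ` is a phase times
`π(s)ξ`; hence `π(u)` almost fixes `π(t₀)ξ`, and conjugation by `t₀` carries this back to `ξ`. -/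
theorem eventually_norm_sub_lt (μ : Measure G) [μ.IsHaarMeasure] [μ.Regular] (ξ : H)
    {δ : ℝ} (hδ : 0 < δ) : ∀ᶠ v in 𝓝 (1 : G), ‖π.op v ξ - ξ‖ < δ := by
  obtain ⟨C, hC, hC1⟩ := exists_compact_mem_nhds (1 : G)
  have hσc : Continuous fun p : G × G => (σ p.1 p.2 : ℂ) :=
    continuous_subtype_val.comp σ.continuous_toFun
  -- Three comparisons inside the ball cost `2 * ε` each; each `ε * ‖ξ‖` pays for removing one
  -- cocycle phase.
  obtain ⟨ε, hε, hεδ⟩ : ∃ ε > 0, 6 * ε + ε * ‖ξ‖ + ε * ‖ξ‖ < δ := by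
    refine ⟨δ / (7 + 2 * ‖ξ‖), by positivity, ?_⟩
    rw [show 6 * (δ / (7 + 2 * ‖ξ‖)) + δ / (7 + 2 * ‖ξ‖) * ‖ξ‖ + δ / (7 + 2 * ‖ξ‖) * ‖ξ‖
      = δ * ((6 + 2 * ‖ξ‖) / (7 + 2 * ‖ξ‖)) by ring]
    refine mul_lt_of_lt_one_right hδ ((div_lt_one (by positivity)).2 (by linarith))
  obtain ⟨h, hh⟩ : ∃ h, μ.restrict C ((fun s => π.op s ξ) ⁻¹' Metric.ball h ε) ≠ 0 := by
    by_contra! hcon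
    have : IsFiniteMeasure (μ.restrict C) := isFiniteMeasure_restrict.2 hC.measure_ne_top
    have h0 := measure_eq_zero_of_null_ball_preimages (μ.restrict C) (π.measurable_orbit ξ) hε hcon
    rw [Measure.restrict_eq_zero] at h0
    exact (Measure.measure_pos_of_mem_nhds μ hC1).ne' h0
  set E := ((fun s => π.op s ξ) ⁻¹' Metric.ball h ε) ∩ C with hE
  have hballm : MeasurableSet ((fun s => π.op s ξ) ⁻¹' Metric.ball h ε) :=
    π.measurable_orbit ξ (MeasurableSpace.measurableSet_generateFrom Metric.isOpen_ball)
  have hEm : MeasurableSet E := hballm.inter hC.measurableSet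
  rw [Measure.restrict_apply hballm] at hh
  have hEE := Measure.div_mem_nhds_one_of_haar_pos_ne_top μ E hEm (pos_iff_ne_zero.2 hh)
    (measure_ne_top_of_subset inter_subset_right hC.measure_ne_top)
  have hdist : ∀ s ∈ E, ∀ t ∈ E, ‖π.op s ξ - π.op t ξ‖ < 2 * ε := by
    intro s hs t ht
    rw [← dist_eq_norm]
    have h1 : dist (π.op s ξ) h < ε := hs.1
    have h2 : dist (π.op t ξ) h < ε := ht.1
    have := dist_triangle_right (π.op s ξ) (π.op t ξ) h
    linarith
  obtain ⟨t₀, ht₀⟩ := nonempty_of_measure_ne_zero hh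
  have hphase : ∀ᶠ u in 𝓝 (1 : G), ∀ t ∈ C, ‖(σ u t : ℂ) - 1‖ < ε := by
    have hcont : Continuous fun p : G × G => ‖(σ p.1 p.2 : ℂ) - 1‖ := by fun_prop
    have := hC.eventually_forall_of_forall_eventually (x₀ := (1 : G))
      (P := fun u t => ‖(σ u t : ℂ) - 1‖ < ε) fun t _ => by
        refine hcont.continuousAt.eventually_lt continuousAt_const ?_
        simpa [σ.map_one_left] using hε
    exact this
  have hw : ∀ᶠ u in 𝓝 (1 : G), ‖π.op u (π.op t₀ ξ) - π.op t₀ ξ‖ < 6 * ε + ε * ‖ξ‖ := by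
    filter_upwards [hEE, hphase] with u hu hph
    obtain ⟨s, hs, t, ht, rfl⟩ := Set.mem_div.1 hu
    set z : ℂ := (σ (s / t) t : ℂ)
    have h1 : ‖π.op (s / t) (π.op t ξ) - z • π.op t ξ‖ < 2 * ε := by
      rw [π.op_op, div_mul_cancel, ← smul_sub, norm_smul, Circle.norm_coe, one_mul]
      exact hdist s hs t ht
    have h2 : ‖π.op (s / t) (π.op t₀ ξ) - π.op (s / t) (π.op t ξ)‖ < 2 * ε := by
      rw [← map_sub, norm_op]
      exact hdist t₀ ht₀ t ht
    have h3 : ‖z • π.op t ξ - z • π.op t₀ ξ‖ < 2 * ε := by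
      rw [← smul_sub, norm_smul, Circle.norm_coe, one_mul]
      exact hdist t ht t₀ ht₀
    have h4 : ‖z - 1‖ * ‖π.op t₀ ξ‖ ≤ ε * ‖ξ‖ := by
      rw [norm_op]
      exact mul_le_mul_of_nonneg_right (hph t ht.2).le (norm_nonneg _)
    have h5 := norm_sub_le_norm_sub_smul z (π.op (s / t) (π.op t₀ ξ))
      (π.op t₀ ξ)
    have h6 : ‖π.op (s / t) (π.op t₀ ξ) - z • π.op t₀ ξ‖ < 6 * ε := by
      calc _ = ‖(π.op (s / t) (π.op t₀ ξ) - π.op (s / t) (π.op t ξ)) +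
            ((π.op (s / t) (π.op t ξ) - z • π.op t ξ) + (z • π.op t ξ - z • π.op t₀ ξ))‖ := by
              congr 1; abel
        _ ≤ _ := (norm_add_le _ _).trans (add_le_add_right (norm_add_le _ _) _)
        _ < 6 * ε := by linarith
    linarith
  have hconj : Tendsto (fun v : G => t₀ * v * t₀⁻¹) (𝓝 1) (𝓝 1) := by
    have : Continuous fun v : G => t₀ * v * t₀⁻¹ := by fun_prop
    simpa using this.tendsto 1
  have hph2 : ∀ᶠ v in 𝓝 (1 : G),
      ‖(σ (t₀ * v * t₀⁻¹) t₀ : ℂ) * (starRingEnd ℂ) (σ t₀ v : ℂ) - 1‖ < ε := by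
    have hc : Continuous fun v : G =>
        ‖(σ (t₀ * v * t₀⁻¹) t₀ : ℂ) * (starRingEnd ℂ) (σ t₀ v : ℂ) - 1‖ := by
      have h1 : Continuous fun v : G => (σ (t₀ * v * t₀⁻¹) t₀ : ℂ) :=
        hσc.comp ((by fun_prop : Continuous fun v : G => (t₀ * v * t₀⁻¹, t₀)))
      have h2 : Continuous fun v : G => (σ t₀ v : ℂ) :=
        hσc.comp ((by fun_prop : Continuous fun v : G => (t₀, v)))
      exact ((h1.mul (Complex.continuous_conj.comp h2)).sub continuous_const).norm
    refine hc.continuousAt.eventually_lt continuousAt_const ?_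
    simpa [σ.map_one_left, σ.map_one_right] using hε
  -- With `u = t₀ v t₀⁻¹`, `π(u)π(t₀)` and `π(t₀)π(v)` are both multiples of `π(t₀ v)`, and their
  -- ratio `z` tends to 1 as `v → 1`.
  filter_upwards [hconj.eventually hw, hph2] with v hv hz
  set u := t₀ * v * t₀⁻¹ with hu
  set z : ℂ := (σ u t₀ : ℂ) * (starRingEnd ℂ) (σ t₀ v : ℂ) with hzdef
  have hut : u * t₀ = t₀ * v := by rw [hu]; group
  have h1 : π.op u (π.op t₀ ξ) = z • π.op t₀ (π.op v ξ) := by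
    rw [π.op_op, π.op_op, smul_smul, hut, hzdef, mul_assoc, mul_comm ((starRingEnd ℂ) _),
      Complex.mul_conj, Circle.normSq_coe]
    simp
  have h2 := norm_sub_le_norm_sub_smul z (π.op t₀ ξ) (π.op t₀ (π.op v ξ))
  rw [← h1, ← map_sub, norm_op, norm_op, norm_op, norm_sub_rev ξ, norm_sub_rev (π.op t₀ ξ)] at h2
  have h3 : ‖z - 1‖ * ‖ξ‖ ≤ ε * ‖ξ‖ := mul_le_mul_of_nonneg_right hz.le (norm_nonneg _)
  linarith

/-- Measurable twisted representations of a locally compact group are strongly continuous. -/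
theorem continuous_orbit (μ : Measure G) [μ.IsHaarMeasure] [μ.Regular] (ξ : H) :
    Continuous fun s => π.op s ξ := by
  refine continuous_iff_continuousAt.2 fun s => ?_
  rw [ContinuousAt, ← map_mul_left_nhds_one, tendsto_map'_iff]
  have h1 : Tendsto (fun v => π.op v ξ) (𝓝 1) (𝓝 ξ) := by
    rw [Metric.tendsto_nhds]
    intro δ hδ
    filter_upwards [π.eventually_norm_sub_lt μ ξ hδ] with v hv
    rwa [dist_eq_norm]
  have h2 : Tendsto (fun v => (starRingEnd ℂ) (σ s v : ℂ)) (𝓝 1) (𝓝 1) := by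
    have : Continuous fun v => (starRingEnd ℂ) (σ s v : ℂ) :=
      Complex.continuous_conj.comp (continuous_subtype_val.comp
        (σ.continuous_toFun.comp (by fun_prop : Continuous fun v : G => (s, v))))
    simpa [σ.map_one_right] using this.tendsto 1
  have h3 := h2.smul (((π.op s).continuous.tendsto ξ).comp h1)
  rw [one_smul] at h3
  refine h3.congr fun v => ?_
  simp only [Function.comp_apply]
  rw [π.op_op, smul_smul, mul_comm, Complex.mul_conj, Circle.normSq_coe]
  simp

end TwistedRep

end TwistedRepContinuity

/-! ### Twisted translations and density in L²(G) -/

section LeftRegular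

open Set Filter Topology
open scoped CompactlySupported Pointwise

variable {G : Type u} [Group G] [TopologicalSpace G] [IsTopologicalGroup G]
  [MeasurableSpace G] [BorelSpace G]

namespace ContinuousTwoCocycle

omit [MeasurableSpace G] [BorelSpace G] [IsTopologicalGroup G] in
theorem continuous_coe (σ : ContinuousTwoCocycle G) :
    Continuous fun p : G × G => (σ p.1 p.2 : ℂ) :=
  continuous_subtype_val.comp σ.continuous_toFun

omit [MeasurableSpace G] [BorelSpace G] [IsTopologicalGroup G] in
theorem cocycle_coe (σ : ContinuousTwoCocycle G) (s t r : G) :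
    (σ s t : ℂ) * σ (s * t) r = σ s (t * r) * σ t r := by
  exact_mod_cast congrArg (fun z : Circle => (z : ℂ)) (σ.cocycle s t r)

omit [MeasurableSpace G] [BorelSpace G] [IsTopologicalGroup G] in
theorem conj_mul_self (σ : ContinuousTwoCocycle G) (s t : G) :
    (starRingEnd ℂ) (σ s t : ℂ) * (σ s t : ℂ) = 1 := by
  rw [mul_comm, Complex.mul_conj, Circle.normSq_coe, Complex.ofReal_one]

end ContinuousTwoCocycle

variable (μ : Measure G) [μ.IsMulLeftInvariant] (σ : ContinuousTwoCocycle G)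

theorem coeFn_leftRegular (s : G) (f : Lp ℂ 2 μ) :
    leftRegular μ σ s f =ᵐ[μ] fun t => (σ s (s⁻¹ * t) : ℂ) * f (s⁻¹ * t) :=
  (memLp_leftRegular μ σ s f).coeFn_toLp

theorem leftRegular_leftRegular (s t : G) (f : Lp ℂ 2 μ) :
    leftRegular μ σ s (leftRegular μ σ t f) = (σ s t : ℂ) • leftRegular μ σ (s * t) f := by
  refine Lp.ext ?_
  filter_upwards [coeFn_leftRegular μ σ s (leftRegular μ σ t f),
    (measurePreserving_mul_left μ s⁻¹).quasiMeasurePreserving.ae (coeFn_leftRegular μ σ t f),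
    Lp.coeFn_smul (σ s t : ℂ) (leftRegular μ σ (s * t) f),
    coeFn_leftRegular μ σ (s * t) f] with r h1 h2 h3 h4
  have h5 := σ.cocycle_coe s t ((s * t)⁻¹ * r)
  rw [show t * ((s * t)⁻¹ * r) = s⁻¹ * r by group] at h5
  rw [h1, h2, h3, Pi.smul_apply, h4, smul_eq_mul,
    show t⁻¹ * (s⁻¹ * r) = (s * t)⁻¹ * r by group]
  linear_combination (-f ((s * t)⁻¹ * r)) * h5

theorem leftRegular_one (f : Lp ℂ 2 μ) : leftRegular μ σ 1 f = f := by
  refine Lp.ext ?_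
  filter_upwards [coeFn_leftRegular μ σ 1 f] with r h1
  rw [h1, σ.map_one_left, inv_one, one_mul, Circle.coe_one, one_mul]

theorem norm_leftRegular_le (s : G) (f : Lp ℂ 2 μ) : ‖leftRegular μ σ s f‖ ≤ ‖f‖ := by
  have := (leftRegular μ σ s).le_of_opNorm_le
    (LinearMap.mkContinuous_norm_le _ zero_le_one _) f
  rwa [one_mul] at this

theorem norm_leftRegular (s : G) (f : Lp ℂ 2 μ) : ‖leftRegular μ σ s f‖ = ‖f‖ := by
  refine le_antisymm (norm_leftRegular_le μ σ s f) ?_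
  have h := leftRegular_leftRegular μ σ s⁻¹ s f
  rw [inv_mul_cancel, leftRegular_one] at h
  calc ‖f‖ = ‖(σ s⁻¹ s : ℂ) • f‖ := by rw [norm_smul, Circle.norm_coe, one_mul]
    _ ≤ _ := by rw [← h]; exact norm_leftRegular_le μ σ _ _

theorem inner_leftRegular (s : G) (f g : Lp ℂ 2 μ) :
    inner ℂ (leftRegular μ σ s f) (leftRegular μ σ s g) = inner ℂ f g :=
  (LinearMap.norm_map_iff_inner_map_map (leftRegular μ σ s)).1 (norm_leftRegular μ σ s) f g

/-! ### Twisted translation of compactly supported functions -/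

omit [MeasurableSpace G] [BorelSpace G] in
/-- `(s · f)(t) = σ(s, s⁻¹t) f(s⁻¹t)` for `f ∈ C_c(G)`. -/
def twistedTranslate (s : G) : C_c(G, ℂ) →ₗ[ℂ] C_c(G, ℂ) where
  toFun f :=
    { toFun := fun t => (σ s (s⁻¹ * t) : ℂ) * f (s⁻¹ * t)
      continuous_toFun := by
        have h1 : Continuous fun t => (σ s (s⁻¹ * t) : ℂ) :=
          σ.continuous_coe.comp (by fun_prop : Continuous fun t => (s, s⁻¹ * t))
        exact h1.mul (f.continuous.comp (continuous_const.mul continuous_id))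
      hasCompactSupport' :=
        (f.hasCompactSupport.comp_homeomorph (Homeomorph.mulLeft s⁻¹)).mul_left }
  map_add' f g := by
    ext t
    exact mul_add _ _ _
  map_smul' c f := by
    ext t
    exact mul_left_comm _ _ _

omit [MeasurableSpace G] [BorelSpace G] in
theorem twistedTranslate_apply (s : G) (f : C_c(G, ℂ)) (t : G) :
    twistedTranslate σ s f t = (σ s (s⁻¹ * t) : ℂ) * f (s⁻¹ * t) := rfl

omit [MeasurableSpace G] [BorelSpace G] in
theorem twistedTranslate_twistedTranslate (s t : G) (f : C_c(G, ℂ)) :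
    twistedTranslate σ s (twistedTranslate σ t f) =
      (σ s t : ℂ) • twistedTranslate σ (s * t) f := by
  ext r
  rw [CompactlySupportedContinuousMap.smul_apply, twistedTranslate_apply, twistedTranslate_apply,
    twistedTranslate_apply, smul_eq_mul, show t⁻¹ * (s⁻¹ * r) = (s * t)⁻¹ * r by group]
  have h5 := σ.cocycle_coe s t ((s * t)⁻¹ * r)
  rw [show t * ((s * t)⁻¹ * r) = s⁻¹ * r by group] at h5
  linear_combination (-f ((s * t)⁻¹ * r)) * h5

omit [MeasurableSpace G] [BorelSpace G] in
theorem twistedTranslate_one (f : C_c(G, ℂ)) : twistedTranslate σ 1 f = f := by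
  ext r
  rw [twistedTranslate_apply, σ.map_one_left, inv_one, one_mul, Circle.coe_one, one_mul]

omit [MeasurableSpace G] [BorelSpace G] in
/-- Twisted translation of a compactly supported function is uniformly continuous, with supports in a
fixed compact set. -/
theorem exists_isCompact_norm_twistedTranslate_sub_le [LocallyCompactSpace G] (f : C_c(G, ℂ)) :
    ∃ K : Set G, IsCompact K ∧ ∀ ε > 0, ∀ᶠ s in 𝓝 (1 : G),
      (∀ t, ‖twistedTranslate σ s f t - f t‖ ≤ ε) ∧
      ∀ t ∉ K, twistedTranslate σ s f t - f t = 0 := by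
  obtain ⟨V, hV, hV1⟩ := exists_compact_mem_nhds (1 : G)
  have hS : IsCompact (tsupport f) := f.hasCompactSupport
  refine ⟨V * tsupport f, hV.mul hS, fun ε hε => ?_⟩
  have hzero : ∀ s ∈ V, ∀ t ∉ V * tsupport f, twistedTranslate σ s f t - f t = 0 := by
    intro s hs t ht
    have h1 : f (s⁻¹ * t) = 0 := image_eq_zero_of_notMem_tsupport fun h =>
      ht (Set.mem_mul.2 ⟨s, hs, s⁻¹ * t, h, by group⟩)
    have h2 : f t = 0 := image_eq_zero_of_notMem_tsupport fun h =>
      ht (Set.mem_mul.2 ⟨1, mem_of_mem_nhds hV1, t, h, one_mul _⟩)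
    rw [twistedTranslate_apply, h1, h2, mul_zero, sub_zero]
  have hcont : Continuous fun p : G × G => ‖twistedTranslate σ p.1 f p.2 - f p.2‖ := by
    simp only [twistedTranslate_apply]
    have h1 : Continuous fun p : G × G => (σ p.1 (p.1⁻¹ * p.2) : ℂ) :=
      σ.continuous_coe.comp (by fun_prop : Continuous fun p : G × G => (p.1, p.1⁻¹ * p.2))
    have h2 : Continuous fun p : G × G => f (p.1⁻¹ * p.2) :=
      f.continuous.comp (by fun_prop)
    exact ((h1.mul h2).sub (f.continuous.comp continuous_snd)).norm
  have hev : ∀ᶠ s in 𝓝 (1 : G), ∀ t ∈ V * tsupport f,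
      ‖twistedTranslate σ s f t - f t‖ < ε :=
    (hV.mul hS).eventually_forall_of_forall_eventually (x₀ := (1 : G))
      (P := fun s t => ‖twistedTranslate σ s f t - f t‖ < ε) fun t _ => by
        refine hcont.continuousAt.eventually_lt continuousAt_const ?_
        simpa [twistedTranslate_one] using hε
  filter_upwards [hev, hV1] with s hs hsV
  refine ⟨fun t => ?_, hzero s hsV⟩
  by_cases ht : t ∈ V * tsupport f
  · exact (hs t ht).le
  · rw [hzero s hsV t ht, norm_zero]; exact hε.le

/-! ### Strong continuity of the left regular representation -/

omit [Group G] [IsTopologicalGroup G] in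
/-- The functions vanishing outside a compact set are dense in `L²`. -/
theorem dense_vanishing_off_compact [T2Space G] (ν : Measure G) [ν.InnerRegularCompactLTTop]
    [IsFiniteMeasureOnCompacts ν] :
    Dense {f : Lp ℂ 2 ν | ∃ K, IsCompact K ∧ ∀ᵐ t ∂ν, t ∉ K → f t = 0} := by
  let S : AddSubgroup (Lp ℂ 2 ν) :=
    { carrier := {f : Lp ℂ 2 ν | ∃ K, IsCompact K ∧ ∀ᵐ t ∂ν, t ∉ K → f t = 0}
      zero_mem' := ⟨∅, isCompact_empty, by
        filter_upwards [Lp.coeFn_zero ℂ 2 ν] with t ht _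
        rw [ht]; rfl⟩
      add_mem' := by
        rintro f g ⟨K, hK, hf⟩ ⟨K', hK', hg⟩
        refine ⟨K ∪ K', hK.union hK', ?_⟩
        filter_upwards [hf, hg, Lp.coeFn_add f g] with t h1 h2 h3 ht
        rw [h3, Pi.add_apply, h1 fun h => ht (Or.inl h), h2 fun h => ht (Or.inr h), add_zero]
      neg_mem' := by
        rintro f ⟨K, hK, hf⟩
        refine ⟨K, hK, ?_⟩
        filter_upwards [hf, Lp.coeFn_neg f] with t h1 h2 ht
        rw [h2, Pi.neg_apply, h1 ht, neg_zero] }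
  intro f
  change f ∈ S.topologicalClosure
  refine Lp.induction (by simp) (motive := fun f => f ∈ S.topologicalClosure) ?_ ?_ ?_ f
  · intro c s hs hμs
    have hex : ∀ n : ℕ, ∃ K ⊆ s, IsCompact K ∧ ν (s \ K) < ((n : ℝ≥0∞) + 1)⁻¹ := fun n =>
      hs.exists_isCompact_sdiff_lt hμs.ne (by simp)
    choose K hKs hK hKm using hex
    refine mem_closure_of_tendsto (f := fun n : ℕ =>
      indicatorConstLp 2 (hK n).measurableSet (hK n).measure_ne_top c) (b := atTop) ?_ (.of_forall fun n => ?_)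
    · refine tendsto_indicatorConstLp_set (hs := hs) (hμs := hμs.ne) (by simp) ?_
      refine tendsto_of_tendsto_of_tendsto_of_le_of_le tendsto_const_nhds
        (h := fun n : ℕ => ((n : ℝ≥0∞) + 1)⁻¹) ?_ (fun _ => zero_le) fun n => ?_
      · have := (tendsto_add_atTop_iff_nat 1).2 ENNReal.tendsto_inv_nat_nhds_zero
        simpa using this
      · rw [symmDiff_def]
        have : K n \ s = ∅ := sdiff_eq_empty.2 (hKs n)
        rw [this]
        exact (measure_mono (union_subset (empty_subset _) subset_rfl)).trans (hKm n).le
    · refine ⟨K n, hK n, ?_⟩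
      filter_upwards [indicatorConstLp_coeFn (p := 2) (hs := (hK n).measurableSet)
        (hμs := (hK n).measure_ne_top) (c := c)] with t ht htK
      rw [ht, indicator_of_notMem htK]
  · intro f g hf hg _ h1 h2
    exact S.topologicalClosure.add_mem h1 h2
  · exact isClosed_closure

variable {μ}

end LeftRegular

/-! ### Continuity of the regular representation and its integrated form -/

section LeftRegular

open Set Filter Topology
open scoped CompactlySupported Pointwise BoundedContinuousFunction

theorem memLp_mulL2 {G : Type u} [TopologicalSpace G] [MeasurableSpace G] [OpensMeasurableSpace G]
    (μ : Measure G) (a : G →ᵇ ℂ) (f : Lp ℂ 2 μ) : MemLp (fun t => a t * f t) 2 μ :=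
  ((Lp.memLp f).const_mul ((‖a‖ : ℝ) : ℂ)).of_le
    (a.continuous.aestronglyMeasurable.mul (Lp.aestronglyMeasurable f)) (by
      filter_upwards with t
      rw [norm_mul, norm_mul, Complex.norm_real, norm_norm]
      exact mul_le_mul_of_nonneg_right (a.norm_coe_le_norm t) (norm_nonneg _))

/-- Multiplication by a bounded continuous function, as an operator on `L²`. -/
def mulL2 {G : Type u} [TopologicalSpace G] [MeasurableSpace G] [OpensMeasurableSpace G]
    (μ : Measure G) (a : G →ᵇ ℂ) : Lp ℂ 2 μ →L[ℂ] Lp ℂ 2 μ :=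
  LinearMap.mkContinuous
    { toFun := fun f => (memLp_mulL2 μ a f).toLp
      map_add' := fun f g => by
        rw [← MemLp.toLp_add]
        refine MemLp.toLp_congr _ _ ?_
        filter_upwards [Lp.coeFn_add f g] with t ht
        rw [ht, Pi.add_apply, Pi.add_apply, mul_add]
      map_smul' := fun c f => by
        rw [RingHom.id_apply, ← MemLp.toLp_const_smul]
        refine MemLp.toLp_congr _ _ ?_
        filter_upwards [Lp.coeFn_smul c f] with t ht
        rw [ht, Pi.smul_apply, Pi.smul_apply, smul_eq_mul, smul_eq_mul]
        ring }
    ‖a‖ fun f => Lp.norm_le_mul_norm_of_ae_le_mul (by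
      filter_upwards [(memLp_mulL2 μ a f).coeFn_toLp] with t ht
      rw [LinearMap.coe_mk, AddHom.coe_mk, ht, norm_mul]
      exact mul_le_mul_of_nonneg_right (a.norm_coe_le_norm t) (norm_nonneg _))

theorem coeFn_mulL2 {G : Type u} [TopologicalSpace G] [MeasurableSpace G] [OpensMeasurableSpace G]
    (μ : Measure G) (a : G →ᵇ ℂ) (f : Lp ℂ 2 μ) : mulL2 μ a f =ᵐ[μ] fun t => a t * f t :=
  (memLp_mulL2 μ a f).coeFn_toLp

variable {G : Type u} [Group G] [TopologicalSpace G] [IsTopologicalGroup G]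
  [MeasurableSpace G] [BorelSpace G] [T2Space G] [LocallyCompactSpace G]
  (μ : Measure G) [μ.IsHaarMeasure] [μ.Regular] (σ : ContinuousTwoCocycle G)

/-- The operator factors into translation, which is continuous on L², and multiplication by the
phase `σ(s, s⁻¹t)`. The phase tends to 1 uniformly only on compact sets, hence the reduction to
vectors vanishing off a compact set; the operators are isometric, so density suffices. -/
theorem tendsto_leftRegular_one (f : Lp ℂ 2 μ) :
    Tendsto (fun s => leftRegular μ σ s f) (𝓝 1) (𝓝 f) := by
  have hclosed : IsClosed {f : Lp ℂ 2 μ | Tendsto (fun s => leftRegular μ σ s f) (𝓝 1) (𝓝 f)} := by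
    refine isClosed_of_closure_subset fun f hf => ?_
    refine Metric.tendsto_nhds.2 fun ε hε => ?_
    obtain ⟨g, hg, hfg⟩ := Metric.mem_closure_iff.1 hf (ε / 3) (by positivity)
    filter_upwards [Metric.tendsto_nhds.1 hg (ε / 3) (by positivity)] with s hs
    have h1 : dist (leftRegular μ σ s f) (leftRegular μ σ s g) = dist f g := by
      rw [dist_eq_norm, ← map_sub, norm_leftRegular, dist_eq_norm]
    have h2 := dist_triangle4 (leftRegular μ σ s f) (leftRegular μ σ s g) g f
    rw [dist_comm g f] at h2
    linarith
  have key : f ∈ {f : Lp ℂ 2 μ | Tendsto (fun s => leftRegular μ σ s f) (𝓝 1) (𝓝 f)} := by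
    have hd := dense_vanishing_off_compact (G := G) μ
    have hsub : {f : Lp ℂ 2 μ | ∃ K, IsCompact K ∧ ∀ᵐ t ∂μ, t ∉ K → f t = 0} ⊆
        {f : Lp ℂ 2 μ | Tendsto (fun s => leftRegular μ σ s f) (𝓝 1) (𝓝 f)} := by
      rintro f ⟨K, hK, hf⟩
      have htr : Tendsto (fun s : G => Lp.compMeasurePreserving (fun t => s⁻¹ * t)
          (measurePreserving_mul_left μ s⁻¹) f) (𝓝 1) (𝓝 f) := by
        have hc : Continuous fun s : G => (⟨fun t => s⁻¹ * t, by fun_prop⟩ : C(G, G)) :=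
          ContinuousMap.continuous_of_continuous_uncurry _ (by
            change Continuous fun p : G × G => p.1⁻¹ * p.2
            fun_prop)
        have h1 : Lp.compMeasurePreserving (fun t => (1 : G)⁻¹ * t)
            (measurePreserving_mul_left μ (1 : G)⁻¹) f = f := by
          refine Lp.ext ?_
          filter_upwards [Lp.coeFn_compMeasurePreserving f
            (measurePreserving_mul_left μ (1 : G)⁻¹)] with t ht
          rw [ht, Function.comp_apply, inv_one, one_mul]
        have h2 := (Continuous.compMeasurePreservingLp (E := ℂ) (p := 2) (μ := μ) (ν := μ)
          (continuous_const : Continuous fun _ : G => f) hc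
          (fun s => measurePreserving_mul_left μ s⁻¹) (by simp)).tendsto 1
        exact (congrArg 𝓝 h1) ▸ h2
      have hphase : ∀ ε > 0, ∀ᶠ s in 𝓝 (1 : G), ∀ t ∈ K, ‖(σ s (s⁻¹ * t) : ℂ) - 1‖ < ε := by
        intro ε hε
        have hcont : Continuous fun p : G × G => ‖(σ p.1 (p.1⁻¹ * p.2) : ℂ) - 1‖ :=
          ((σ.continuous_coe.comp (by fun_prop : Continuous fun p : G × G =>
            (p.1, p.1⁻¹ * p.2))).sub continuous_const).norm
        exact hK.eventually_forall_of_forall_eventually (x₀ := (1 : G))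
          (P := fun s t => ‖(σ s (s⁻¹ * t) : ℂ) - 1‖ < ε) fun t _ => by
            refine hcont.continuousAt.eventually_lt continuousAt_const ?_
            simpa [σ.map_one_left] using hε
      refine Metric.tendsto_nhds.2 fun ε hε => ?_
      obtain ⟨η, hη, hηε⟩ : ∃ η > 0, η * ‖f‖ < ε / 2 :=
        ⟨ε / 2 / (‖f‖ + 1), by positivity, by
          rw [div_mul_eq_mul_div]
          exact (div_lt_iff₀ (by positivity)).2 (by nlinarith [norm_nonneg f])⟩
      filter_upwards [Metric.tendsto_nhds.1 htr (ε / 2) (by positivity), hphase η hη] with s hs hs2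
      let m : G →ᵇ ℂ := BoundedContinuousFunction.ofNormedAddCommGroup
        (fun t => (σ s (s⁻¹ * t) : ℂ))
        (σ.continuous_coe.comp (by fun_prop : Continuous fun t => (s, s⁻¹ * t))) 1
        (fun t => (Circle.norm_coe _).le)
      have h1 : ‖leftRegular μ σ s f - mulL2 μ m f‖ ≤
          ‖Lp.compMeasurePreserving (fun t => s⁻¹ * t) (measurePreserving_mul_left μ s⁻¹) f - f‖ := by
        refine Lp.norm_le_norm_of_ae_le ?_
        filter_upwards [coeFn_leftRegular μ σ s f, coeFn_mulL2 μ m f,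
          Lp.coeFn_sub (leftRegular μ σ s f) (mulL2 μ m f), Lp.coeFn_sub
          (Lp.compMeasurePreserving (fun t => s⁻¹ * t) (measurePreserving_mul_left μ s⁻¹) f) f,
          Lp.coeFn_compMeasurePreserving f (measurePreserving_mul_left μ s⁻¹)] with t e1 e2 e3 e4 e5
        rw [e3, e4, Pi.sub_apply, Pi.sub_apply, e1, e2, e5, Function.comp_apply]
        change ‖_ - (σ s (s⁻¹ * t) : ℂ) * f t‖ ≤ _
        rw [← mul_sub, norm_mul, Circle.norm_coe, one_mul]
      have h2 : ‖mulL2 μ m f - f‖ ≤ η * ‖f‖ := by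
        refine Lp.norm_le_mul_norm_of_ae_le_mul ?_
        filter_upwards [coeFn_mulL2 μ m f, Lp.coeFn_sub (mulL2 μ m f) f, hf] with t e1 e2 e3
        rw [e2, Pi.sub_apply, e1]
        change ‖(σ s (s⁻¹ * t) : ℂ) * f t - f t‖ ≤ _
        by_cases ht : t ∈ K
        · rw [← sub_one_mul, norm_mul]
          exact mul_le_mul_of_nonneg_right (hs2 t ht).le (norm_nonneg _)
        · rw [e3 ht]; simp
      rw [dist_eq_norm] at hs ⊢
      calc ‖leftRegular μ σ s f - f‖ = ‖(leftRegular μ σ s f - mulL2 μ m f) + (mulL2 μ m f - f)‖ := by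
            rw [sub_add_sub_cancel]
        _ ≤ _ := norm_add_le _ _
        _ < ε := by linarith
    exact (hclosed.closure_subset_iff.2 hsub) (hd f)
  exact key

/-- The left regular `σ`-representation is strongly continuous. -/
theorem continuous_leftRegular (f : Lp ℂ 2 μ) : Continuous fun s => leftRegular μ σ s f := by
  refine continuous_iff_continuousAt.2 fun s => ?_
  rw [ContinuousAt, ← map_mul_left_nhds_one, tendsto_map'_iff]
  have h2 : Tendsto (fun v => (starRingEnd ℂ) (σ s v : ℂ)) (𝓝 1) (𝓝 1) := by
    have : Continuous fun v => (starRingEnd ℂ) (σ s v : ℂ) :=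
      Complex.continuous_conj.comp (σ.continuous_coe.comp
        (by fun_prop : Continuous fun v : G => (s, v)))
    simpa [σ.map_one_right] using this.tendsto 1
  have h3 := h2.smul (((leftRegular μ σ s).continuous.tendsto f).comp
    (tendsto_leftRegular_one μ σ f))
  rw [one_smul] at h3
  refine h3.congr fun v => ?_
  simp only [Function.comp_apply]
  rw [leftRegular_leftRegular, smul_smul, σ.conj_mul_self, one_smul]

/-! ### The integrated form -/

omit [Group G] [IsTopologicalGroup G] [T2Space G] [LocallyCompactSpace G] [μ.IsHaarMeasure] in
theorem integrable_cc {E : Type*} [NormedAddCommGroup E] [NormedSpace ℂ E] (f : C_c(G, ℂ)) {F : G → E}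
    (hF : Continuous F) : Integrable (fun s => f s • F s) μ :=
  (f.continuous.smul hF).integrable_of_hasCompactSupport f.hasCompactSupport.smul_right

/-- `λ_σ(f) = ∫ f(s) λ_σ(s) ds` for `f ∈ C_c(G)`. -/
def integratedRegular (f : C_c(G, ℂ)) : Lp ℂ 2 μ →L[ℂ] Lp ℂ 2 μ :=
  LinearMap.mkContinuous
    { toFun := fun ξ => ∫ s, f s • leftRegular μ σ s ξ ∂μ
      map_add' := fun ξ η => by
        rw [← integral_add (integrable_cc μ f (continuous_leftRegular μ σ ξ))
          (integrable_cc μ f (continuous_leftRegular μ σ η))]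
        simp only [map_add, smul_add]
      map_smul' := fun c ξ => by
        rw [RingHom.id_apply, ← integral_smul]
        simp only [map_smul, smul_comm c] }
    (∫ s, ‖f s‖ ∂μ) fun ξ => by
      refine (norm_integral_le_integral_norm _).trans ?_
      rw [← integral_mul_const]
      simp only [norm_smul, norm_leftRegular, le_refl]

theorem integratedRegular_apply (f : C_c(G, ℂ)) (ξ : Lp ℂ 2 μ) :
    integratedRegular μ σ f ξ = ∫ s, f s • leftRegular μ σ s ξ ∂μ := rfl

theorem integratedRegular_add (f g : C_c(G, ℂ)) :
    integratedRegular μ σ (f + g) = integratedRegular μ σ f + integratedRegular μ σ g := by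
  ext1 ξ
  rw [add_apply, integratedRegular_apply, integratedRegular_apply,
    integratedRegular_apply, ← integral_add (integrable_cc μ f (continuous_leftRegular μ σ ξ))
          (integrable_cc μ g (continuous_leftRegular μ σ ξ))]
  simp only [CompactlySupportedContinuousMap.add_apply, add_smul]

theorem integratedRegular_smul (c : ℂ) (f : C_c(G, ℂ)) :
    integratedRegular μ σ (c • f) = c • integratedRegular μ σ f := by
  ext1 ξ
  rw [smul_apply, integratedRegular_apply, integratedRegular_apply, ← integral_smul]
  simp only [CompactlySupportedContinuousMap.smul_apply, smul_assoc]

theorem norm_integratedRegular_apply_le (f : C_c(G, ℂ)) (ξ : Lp ℂ 2 μ) :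
    ‖integratedRegular μ σ f ξ‖ ≤ (∫ s, ‖f s‖ ∂μ) * ‖ξ‖ := by
  rw [integratedRegular_apply, ← integral_mul_const]
  refine (norm_integral_le_integral_norm _).trans ?_
  simp only [norm_smul, norm_leftRegular, le_refl]

theorem leftRegular_integratedRegular (s : G) (f : C_c(G, ℂ)) (ξ : Lp ℂ 2 μ) :
    leftRegular μ σ s (integratedRegular μ σ f ξ) =
      integratedRegular μ σ (twistedTranslate σ s f) ξ := by
  rw [integratedRegular_apply, integratedRegular_apply,
    ← ContinuousLinearMap.integral_comp_comm _ (integrable_cc μ f (continuous_leftRegular μ σ ξ)),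
    ← integral_mul_left_eq_self (fun t => twistedTranslate σ s f t • leftRegular μ σ t ξ) s]
  refine integral_congr_ae (.of_forall fun t => ?_)
  simp only
  rw [map_smul, leftRegular_leftRegular, twistedTranslate_apply, inv_mul_cancel_left, smul_smul,
    mul_comm]

theorem integratedRegular_mem (f : C_c(G, ℂ)) :
    integratedRegular μ σ f ∈ (twistedVN μ σ).toStarSubalgebra := by
  have hcomm : ∀ y : Lp ℂ 2 μ →L[ℂ] Lp ℂ 2 μ, (∀ s, y * leftRegular μ σ s = leftRegular μ σ s * y) →
      y * integratedRegular μ σ f = integratedRegular μ σ f * y := by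
    intro y hy
    ext1 ξ
    change y (integratedRegular μ σ f ξ) = integratedRegular μ σ f (y ξ)
    rw [integratedRegular_apply, integratedRegular_apply,
      ← ContinuousLinearMap.integral_comp_comm _ (integrable_cc μ f (continuous_leftRegular μ σ ξ))]
    refine integral_congr_ae (.of_forall fun t => ?_)
    simp only
    rw [map_smul]
    congr 1
    exact congrArg (fun T : Lp ℂ 2 μ →L[ℂ] Lp ℂ 2 μ => T ξ) (hy t)
  refine StarSubalgebra.mem_centralizer_iff ℂ |>.2 fun g hg => ?_
  have h := fun s => StarSubalgebra.mem_centralizer_iff ℂ |>.1 hg _ (Set.mem_range_self s)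
  refine ⟨hcomm g fun s => (h s).1.symm, hcomm (star g) fun s => ?_⟩
  have := congrArg star (h s).2
  simpa [star_mul] using this

/-- `λ_σ(f)` as an element of `VN(G,σ)`. -/
def integratedRegularVN (f : C_c(G, ℂ)) : TwistedVN μ σ :=
  ⟨integratedRegular μ σ f, integratedRegular_mem μ σ f⟩

omit [T2Space G] [LocallyCompactSpace G] [μ.Regular] in
theorem norm_leftRegularVN_le (s : G) : ‖leftRegularVN μ σ s‖ ≤ 1 :=
  ContinuousLinearMap.opNorm_le_bound _ zero_le_one fun f => by
    rw [one_mul]; exact norm_leftRegular_le μ σ s f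

/-- Elements of `A(G,σ)` define continuous functions, compatible with integration against
compactly supported functions. -/
theorem continuous_and_integral_of_mem_twistedFourier {ω : StrongDual ℂ (TwistedVN μ σ)}
    (hω : ω ∈ twistedFourier μ σ) :
    (Continuous fun s => ω (leftRegularVN μ σ s)) ∧ ∀ f : C_c(G, ℂ),
      ω (integratedRegularVN μ σ f) = ∫ s, f s • ω (leftRegularVN μ σ s) ∂μ := by
  let S : Submodule ℂ (StrongDual ℂ (TwistedVN μ σ)) :=
    { carrier := {ω | (Continuous fun s => ω (leftRegularVN μ σ s)) ∧ ∀ f : C_c(G, ℂ),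
        ω (integratedRegularVN μ σ f) = ∫ s, f s • ω (leftRegularVN μ σ s) ∂μ}
      zero_mem' := ⟨by simpa using continuous_const, by simp⟩
      add_mem' := by
        rintro ω ω' ⟨h1, h2⟩ ⟨h1', h2'⟩
        refine ⟨h1.add h1', fun f => ?_⟩
        simp only [add_apply, smul_add]
        rw [integral_add (integrable_cc μ f h1) (integrable_cc μ f h1'), h2, h2']
      smul_mem' := by
        rintro c ω ⟨h1, h2⟩
        refine ⟨h1.const_smul c, fun f => ?_⟩
        simp only [smul_apply, smul_comm _ c]
        rw [integral_smul, h2] }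
  have hspan : Submodule.span ℂ {ω | ∃ ξ η : Lp ℂ 2 μ, ω = vectorFunctional μ σ ξ η} ≤ S := by
    refine Submodule.span_le.2 ?_
    rintro _ ⟨ξ, η, rfl⟩
    refine ⟨continuous_const.inner (continuous_leftRegular μ σ ξ), fun f => ?_⟩
    change inner ℂ η (integratedRegular μ σ f ξ) = ∫ s, f s • inner ℂ η (leftRegular μ σ s ξ) ∂μ
    rw [integratedRegular_apply,
      ← integral_inner (integrable_cc μ f (continuous_leftRegular μ σ ξ)) η]
    simp only [inner_smul_right, smul_eq_mul]
  have hclosed : IsClosed (S : Set (StrongDual ℂ (TwistedVN μ σ))) := by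
    refine isClosed_of_closure_subset fun ω hω => ?_
    have happ : ∀ ε > 0, ∃ ω' ∈ S, ∀ x, dist (ω x) (ω' x) ≤ ε * ‖x‖ := by
      intro ε hε
      obtain ⟨ω', h', hd⟩ := Metric.mem_closure_iff.1 hω ε hε
      refine ⟨ω', h', fun x => ?_⟩
      rw [dist_eq_norm] at hd ⊢
      exact ((ω - ω').le_opNorm x).trans (mul_le_mul_of_nonneg_right hd.le (norm_nonneg _))
    have happ2 : ∀ ε > 0, ∃ ω' ∈ S, (∀ x, dist (ω x) (ω' x) ≤ ε * ‖x‖) ∧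
        ∀ s, dist (ω (leftRegularVN μ σ s)) (ω' (leftRegularVN μ σ s)) ≤ ε := by
      intro ε hε
      obtain ⟨ω', h', hd⟩ := happ ε hε
      exact ⟨ω', h', hd, fun s => (hd _).trans
        (mul_le_of_le_one_right hε.le (norm_leftRegularVN_le μ σ s))⟩
    have hc : Continuous fun s => ω (leftRegularVN μ σ s) := by
      refine continuous_of_uniform_approx_of_continuous fun u hu => ?_
      obtain ⟨ε, hε, hεu⟩ := Metric.mem_uniformity_dist.1 hu
      obtain ⟨ω', h', -, hd⟩ := happ2 (ε / 2) (by positivity)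
      exact ⟨_, h'.1, fun s => hεu ((hd s).trans_lt (by linarith))⟩
    refine ⟨hc, fun f => ?_⟩
    obtain ⟨A, hA⟩ : ∃ A, A = ‖integratedRegularVN μ σ f‖ + ∫ s, ‖f s‖ ∂μ := ⟨_, rfl⟩
    have hA0 : 0 ≤ A := by
      rw [hA]
      exact add_nonneg (norm_nonneg _) (integral_nonneg fun _ => norm_nonneg _)
    refine eq_of_forall_dist_le fun ε hε => ?_
    obtain ⟨ω', h', hd, hd2⟩ := happ2 (ε / (A + 1)) (by positivity)
    have e1 := hd (integratedRegularVN μ σ f)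
    have e2 : dist (∫ s, f s • ω' (leftRegularVN μ σ s) ∂μ)
        (∫ s, f s • ω (leftRegularVN μ σ s) ∂μ) ≤ ε / (A + 1) * ∫ s, ‖f s‖ ∂μ := by
      rw [dist_eq_norm, ← integral_sub (integrable_cc μ f h'.1) (integrable_cc μ f hc),
        ← integral_const_mul]
      refine norm_integral_le_of_norm_le ?_ (.of_forall fun s => ?_)
      · exact ((f.continuous.integrable_of_hasCompactSupport f.hasCompactSupport).norm).const_mul _
      · rw [← smul_sub, norm_smul, mul_comm, ← dist_eq_norm, dist_comm]
        exact mul_le_mul_of_nonneg_right (hd2 s) (norm_nonneg _)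
    rw [h'.2] at e1
    have e3 := dist_triangle (ω (integratedRegularVN μ σ f))
      (∫ s, f s • ω' (leftRegularVN μ σ s) ∂μ) (∫ s, f s • ω (leftRegularVN μ σ s) ∂μ)
    calc _ ≤ ε / (A + 1) * ‖integratedRegularVN μ σ f‖ + ε / (A + 1) * ∫ s, ‖f s‖ ∂μ :=
          e3.trans (add_le_add e1 e2)
      _ = ε / (A + 1) * A := by rw [← mul_add, ← hA]
      _ ≤ ε := by
        rw [div_mul_eq_mul_div]
        exact (div_le_iff₀ (by positivity)).2 (by nlinarith)
  exact Submodule.topologicalClosure_minimal _ hspan hclosed hω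

end LeftRegular

/-! ### Amplifications and the double commutant argument -/

section Amplification

open Set Filter Topology

variable {κ : Type*} {W E : Type*} [NormedAddCommGroup W] [NormedSpace ℂ W]
  [NormedAddCommGroup E] [InnerProductSpace ℂ E]

/-- The bounded operator into a Hilbert sum with given square summable components. -/
def columnOp (T : κ → W →L[ℂ] E) (C : ℝ) (hC : 0 ≤ C)
    (h : ∀ (w : W) (s : Finset κ), ∑ k ∈ s, ‖T k w‖ ^ 2 ≤ (C * ‖w‖) ^ 2) :
    W →L[ℂ] lp (fun _ : κ => E) 2 :=
  LinearMap.mkContinuous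
    { toFun := fun w => ⟨fun k => T k w, memℓp_gen' (C := (C * ‖w‖) ^ 2) fun s => by
        simpa using h w s⟩
      map_add' := fun v w => by
        ext k
        exact map_add (T k) v w
      map_smul' := fun c w => by
        ext k
        exact map_smul (T k) c w }
    C fun w => by
      refine lp.norm_le_of_forall_sum_le (by simp) (mul_nonneg hC (norm_nonneg _)) fun s => ?_
      simpa using h w s

theorem norm_columnOp_apply_le (T : κ → W →L[ℂ] E) (C : ℝ) (hC : 0 ≤ C)
    (h : ∀ (w : W) (s : Finset κ), ∑ k ∈ s, ‖T k w‖ ^ 2 ≤ (C * ‖w‖) ^ 2) (w : W) :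
    ‖columnOp T C hC h w‖ ≤ C * ‖w‖ :=
  ContinuousLinearMap.le_of_opNorm_le _ (LinearMap.mkContinuous_norm_le _ hC _) w

/-- The amplification `x ⊕ x ⊕ ⋯` of an operator. -/
def amplify (κ : Type*) (x : E →L[ℂ] E) :
    lp (fun _ : κ => E) 2 →L[ℂ] lp (fun _ : κ => E) 2 :=
  columnOp (fun k => x ∘L lp.evalCLM ℂ (fun _ : κ => E) 2 k) ‖x‖ (norm_nonneg _) fun f s => by
    have h1 : ∑ k ∈ s, ‖f k‖ ^ 2 ≤ ‖f‖ ^ 2 := by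
      simpa using lp.sum_rpow_le_norm_rpow (by simp) f s
    calc ∑ k ∈ s, ‖x (f k)‖ ^ 2 ≤ ∑ k ∈ s, ‖x‖ ^ 2 * ‖f k‖ ^ 2 :=
          Finset.sum_le_sum fun k _ => by
            rw [← mul_pow]
            exact pow_le_pow_left₀ (norm_nonneg _) (x.le_opNorm _) 2
      _ ≤ (‖x‖ * ‖f‖) ^ 2 := by
          rw [← Finset.mul_sum, mul_pow]
          exact mul_le_mul_of_nonneg_left h1 (by positivity)

theorem amplify_apply (x : E →L[ℂ] E) (f : lp (fun _ : κ => E) 2) (k : κ) :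
    amplify κ x f k = x (f k) := rfl

theorem amplify_mul (x y : E →L[ℂ] E) (f : lp (fun _ : κ => E) 2) :
    amplify κ (x * y) f = amplify κ x (amplify κ y f) := rfl

theorem amplify_smul (c : ℂ) (x : E →L[ℂ] E) (f : lp (fun _ : κ => E) 2) :
    amplify κ (c • x) f = c • amplify κ x f := rfl

theorem amplify_single [DecidableEq κ] (x : E →L[ℂ] E) (k : κ) (e : E) :
    amplify κ x (lp.single 2 k e) = lp.single 2 k (x e) := by
  ext j
  rw [amplify_apply]
  by_cases h : j = k
  · subst h; simp
  · simp [h]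

variable [CompleteSpace E]

theorem inner_amplify_right (x : E →L[ℂ] E) (f g : lp (fun _ : κ => E) 2) :
    inner ℂ g (amplify κ x f) = inner ℂ (amplify κ (star x) g) f := by
  rw [lp.inner_eq_tsum, lp.inner_eq_tsum]
  refine tsum_congr fun k => ?_
  rw [amplify_apply, amplify_apply, ContinuousLinearMap.star_eq_adjoint,
    ContinuousLinearMap.adjoint_inner_left]

/-- The core of von Neumann's double commutant theorem: if `x` commutes with the commutant of `𝓢`,
then `x^∞ f` belongs to the closed span of the `a^∞ f`, `a ∈ 𝓢`. -/
theorem inner_amplify_eq_zero_of_bicommutant {𝓢 : Set (E →L[ℂ] E)} (h1 : 1 ∈ 𝓢)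
    (hmul : ∀ a ∈ 𝓢, ∀ b ∈ 𝓢, ∃ c : ℂ, ∃ d ∈ 𝓢, a * b = c • d)
    (hstar : ∀ a ∈ 𝓢, ∃ c : ℂ, ∃ d ∈ 𝓢, star a = c • d)
    {x : E →L[ℂ] E} (hx : ∀ y : E →L[ℂ] E, (∀ a ∈ 𝓢, a * y = y * a) → x * y = y * x)
    {f g : lp (fun _ : κ => E) 2} (hfg : ∀ a ∈ 𝓢, inner ℂ g (amplify κ a f) = 0) :
    inner ℂ g (amplify κ x f) = 0 := by
  classical
  set M : Submodule ℂ (lp (fun _ : κ => E) 2) :=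
    (Submodule.span ℂ ((fun a => amplify κ a f) '' 𝓢)).topologicalClosure with hM
  have hMc : IsClosed (M : Set (lp (fun _ : κ => E) 2)) := Submodule.isClosed_topologicalClosure _
  have : CompleteSpace M := hMc.completeSpace_coe
  have hsub : ∀ a ∈ 𝓢, amplify κ a f ∈ M := fun a ha =>
    Submodule.le_topologicalClosure _ (Submodule.subset_span ⟨a, ha, rfl⟩)
  have hfM : f ∈ M := hsub 1 h1
  have hinv : ∀ a ∈ 𝓢, ∀ v ∈ M, amplify κ a v ∈ M := by
    intro a ha v hv
    have hle : M ≤ M.comap (amplify κ a : _ →ₗ[ℂ] _) := by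
      refine Submodule.topologicalClosure_minimal _ (Submodule.span_le.2 ?_)
        (hMc.preimage (amplify κ a).continuous)
      rintro _ ⟨b, hb, rfl⟩
      obtain ⟨c, d, hd, hab⟩ := hmul a ha b hb
      change amplify κ a (amplify κ b f) ∈ M
      rw [← amplify_mul, hab, amplify_smul]
      exact M.smul_mem c (hsub d hd)
    exact hle hv
  have hinv' : ∀ a ∈ 𝓢, ∀ v ∈ M, amplify κ (star a) v ∈ M := by
    intro a ha v hv
    obtain ⟨c, d, hd, hab⟩ := hstar a ha
    rw [hab, amplify_smul]
    exact M.smul_mem c (hinv d hd v hv)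
  let P := M.starProjection
  have hcomm : ∀ a ∈ 𝓢, ∀ v, P (amplify κ a v) = amplify κ a (P v) := by
    intro a ha v
    refine Submodule.eq_starProjection_of_mem_of_inner_eq_zero
      (hinv a ha _ (Submodule.starProjection_apply_mem _ _)) fun w hw => ?_
    rw [← map_sub, ← inner_conj_symm, inner_amplify_right, inner_conj_symm]
    exact Submodule.starProjection_inner_eq_zero _ _ (hinv' a ha w hw)
  -- The matrix entries of the projection `P` commute with `𝓢`, hence with `x`; so `P` commutes with
  -- the amplification of `x`, which therefore leaves `M` invariant.
  let Pe : κ → κ → E →L[ℂ] E := fun i j =>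
    lp.evalCLM ℂ (fun _ : κ => E) 2 i ∘L P ∘L lp.singleContinuousLinearMap ℂ (fun _ : κ => E) 2 j
  have hPe : ∀ i j e, Pe i j e = P (lp.single 2 j e) i := fun _ _ _ => rfl
  have hPecomm : ∀ i j, ∀ a ∈ 𝓢, a * Pe i j = Pe i j * a := by
    intro i j a ha
    ext1 e
    change a (Pe i j e) = Pe i j (a e)
    rw [hPe, hPe, ← amplify_single, hcomm a ha, amplify_apply]
  have hxP : amplify κ x ∘L P = P ∘L amplify κ x := by
    refine lp.ext_continuousLinearMap (by simp) fun j => ?_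
    ext1 e
    change amplify κ x (P (lp.single 2 j e)) = P (amplify κ x (lp.single 2 j e))
    rw [amplify_single]
    ext i
    rw [amplify_apply, ← hPe, ← hPe]
    exact congrArg (fun T : E →L[ℂ] E => T e) (hx (Pe i j) (hPecomm i j))
  have hmem : amplify κ x f ∈ M := by
    have h2 : amplify κ x f = P (amplify κ x f) := by
      conv_lhs => rw [← Submodule.starProjection_eq_self_iff.2 hfM]
      exact congrArg (fun T : lp (fun _ : κ => E) 2 →L[ℂ] lp (fun _ : κ => E) 2 => T f) hxP
    rw [h2]
    exact Submodule.starProjection_apply_mem _ _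
  have hle : M ≤ LinearMap.ker (innerSL ℂ g : lp (fun _ : κ => E) 2 →ₗ[ℂ] ℂ) := by
    refine Submodule.topologicalClosure_minimal _ (Submodule.span_le.2 ?_)
      (innerSL ℂ g).isClosed_ker
    rintro _ ⟨a, ha, rfl⟩
    exact hfg a ha
  exact hle hmem

end Amplification

/-! ### Fell's absorption principle -/

section FellAbsorption

open Set Filter Topology
open scoped CompactlySupported Pointwise BoundedContinuousFunction

theorem norm_sq_eq_integral_norm_sq {X : Type*} [MeasurableSpace X] {ν : Measure X}
    (f : Lp ℂ 2 ν) : ‖f‖ ^ 2 = ∫ t, ‖f t‖ ^ 2 ∂ν := by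
  have h : inner ℂ f f = ∫ t, inner ℂ (f t) (f t) ∂ν := rfl
  simp only [inner_self_eq_norm_sq_to_K] at h
  have h2 : ((‖f‖ ^ 2 : ℝ) : ℂ) = ((∫ t, ‖f t‖ ^ 2 ∂ν : ℝ) : ℂ) := by
    rw [← integral_complex_ofReal]
    push_cast
    exact h
  exact_mod_cast h2

theorem integrable_norm_sq {X : Type*} [MeasurableSpace X] {ν : Measure X}
    (f : Lp ℂ 2 ν) : Integrable (fun t => ‖f t‖ ^ 2) ν :=
  (Lp.memLp f).norm.integrable_sq

/-- Each vector has countably many nonzero coordinates, and a coordinate vanishing on a countable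
set vanishes on its closure. Along a continuous orbit over a compact set only countably many basis
vectors matter, so almost-everywhere statements and term-by-term integration remain available in a
nonseparable `H`. -/
theorem countable_setOf_inner_ne_zero {ι : Type*} {H : Type*} [NormedAddCommGroup H]
    [InnerProductSpace ℂ H] (b : HilbertBasis ι ℂ H) {S : Set H} (hS : IsCompact S) :
    {i | ∃ x ∈ S, inner ℂ (b i) x ≠ 0}.Countable := by
  obtain ⟨D, hDc, hSD⟩ := hS.isSeparable
  have h1 : ∀ x : H, {i | inner ℂ (b i) x ≠ 0}.Countable := fun x => by
    have h := (b.summable_inner_mul_inner x x).countable_support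
    refine h.mono fun i hi => ?_
    have hi' : inner ℂ (b i) x ≠ 0 := hi
    exact mul_ne_zero (fun h0 => hi' (by rw [← inner_conj_symm, h0, map_zero])) hi'
  refine (hDc.biUnion fun d _ => h1 d).mono ?_
  rintro i ⟨x, hx, hix⟩
  by_contra hcon
  simp only [mem_iUnion, not_exists] at hcon
  have hcl : IsClosed {y : H | inner ℂ (b i) y = 0} :=
    isClosed_eq (continuous_const.inner continuous_id) continuous_const
  have hsub : D ⊆ {y : H | inner ℂ (b i) y = 0} := fun d hd => by
    by_contra h0
    exact hcon d hd h0
  exact hix (hcl.closure_subset_iff.2 hsub (hSD hx))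

namespace TwistedRep

variable {G : Type u} [Group G] [TopologicalSpace G] [MeasurableSpace G]
  {σ : ContinuousTwoCocycle G} {H : Type u} [NormedAddCommGroup H] [InnerProductSpace ℂ H]
  [CompleteSpace H] (π : TwistedRep σ H)

theorem op_star_eq {s r t : G} (h : s * r = t) (x : H) :
    (σ s r : ℂ) • π.op t (star (π.op r) x) = π.op s x := by
  rw [← h, ← op_op, op_star_op]

theorem inner_star_op (s : G) (x y : H) :
    inner ℂ x (star (π.op s) y) = inner ℂ (π.op s x) y := by
  rw [ContinuousLinearMap.star_eq_adjoint, ContinuousLinearMap.adjoint_inner_right]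

theorem continuous_star_orbit [IsTopologicalGroup G] (hπ : ∀ x : H, Continuous fun s => π.op s x)
    (x : H) : Continuous fun s => star (π.op s) x := by
  have h : ∀ s : G, star (π.op s) x = (starRingEnd ℂ (σ s⁻¹ s : ℂ)) • π.op s⁻¹ x := fun s => by
    have h1 := π.op_star_eq (inv_mul_cancel s) x
    rw [op_one] at h1
    rw [← h1, smul_smul, σ.conj_mul_self, one_smul]
  simp_rw [h]
  have hc : Continuous fun s : G => (σ s⁻¹ s : ℂ) :=
    σ.continuous_coe.comp (continuous_inv.prodMk continuous_id)
  exact (Complex.continuous_conj.comp hc).smul ((hπ x).comp continuous_inv)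

/-- The bounded continuous function `t ↦ ⟨π(t)v, ξ⟩`, conjugated. -/
def coeffBCF (hπ : ∀ x : H, Continuous fun s => π.op s x) (v ξ : H) : G →ᵇ ℂ :=
  BoundedContinuousFunction.ofNormedAddCommGroup (fun t => inner ℂ (π.op t v) ξ)
    ((hπ v).inner continuous_const) (‖v‖ * ‖ξ‖) fun t => by
      rw [← π.norm_op t v]
      exact norm_inner_le_norm _ _

theorem coeffBCF_apply (hπ : ∀ x : H, Continuous fun s => π.op s x) (v ξ : H) (t : G) :
    π.coeffBCF hπ v ξ t = inner ℂ (π.op t v) ξ := rfl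

theorem orthonormal_op {ι : Type*} {b : ι → H} (hb : Orthonormal ℂ b) (t : G) :
    Orthonormal ℂ fun i => π.op t (b i) := by
  refine ⟨fun i => (π.norm_op t _).trans (hb.1 i), fun i j hij => ?_⟩
  change inner ℂ (π.op t (b i)) (π.op t (b j)) = 0
  rw [← inner_star_op, star_op_op]
  exact hb.2 hij

/-- Parseval's identity for `π(t)^*η` and `π(r)^*ξ`: their inner product recovers the coefficient at
`s`, up to the phase, because `π(s)π(r) = σ(s,r)π(t)`. -/
theorem hasSum_coeffBCF (hπ : ∀ x : H, Continuous fun s => π.op s x) {ι : Type*}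
    (b : HilbertBasis ι ℂ H) (ξ η : H) {s r t : G} (h : s * r = t) :
    HasSum (fun i => starRingEnd ℂ (π.coeffBCF hπ (b i) η t) *
      ((σ s r : ℂ) * π.coeffBCF hπ (b i) ξ r)) (π.coeff ξ η s) := by
  have h1 := (b.hasSum_inner_mul_inner (star (π.op t) η) (star (π.op r) ξ)).mul_left (σ s r : ℂ)
  have h2 : (σ s r : ℂ) * inner ℂ (star (π.op t) η) (star (π.op r) ξ) = π.coeff ξ η s := by
    rw [ContinuousLinearMap.star_eq_adjoint (π.op t), ContinuousLinearMap.adjoint_inner_left]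
    have h3 : inner ℂ η ((σ s r : ℂ) • π.op t (star (π.op r) ξ)) = inner ℂ η (π.op s ξ) := by
      rw [π.op_star_eq h]
    exact (inner_smul_right _ _ _).symm.trans h3
  refine (h2 ▸ h1).congr_fun fun i => ?_
  rw [coeffBCF_apply, coeffBCF_apply, inner_star_op, ← inner_conj_symm (star (π.op t) η),
    inner_star_op]
  ring

variable [BorelSpace G] (μ : Measure G)

/-- Pointwise Bessel inequality for the orthonormal family `π(t)b_i`, integrated against `|f|²`. -/
theorem sum_norm_mulL2_sq_le (hπ : ∀ x : H, Continuous fun s => π.op s x) {ι : Type*} {b : ι → H}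
    (hb : Orthonormal ℂ b) (ξ : H) (f : Lp ℂ 2 μ) (S : Finset ι) :
    ∑ i ∈ S, ‖mulL2 μ (π.coeffBCF hπ (b i) ξ) f‖ ^ 2 ≤ (‖ξ‖ * ‖f‖) ^ 2 := by
  simp_rw [norm_sq_eq_integral_norm_sq (mulL2 μ _ f)]
  rw [← integral_finsetSum _ fun i _ => integrable_norm_sq _, mul_pow,
    norm_sq_eq_integral_norm_sq f, ← integral_const_mul]
  refine integral_mono_ae (integrable_finsetSum _ fun i _ => integrable_norm_sq _)
    ((integrable_norm_sq f).const_mul _) ?_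
  have hae : ∀ᵐ t ∂μ, ∀ i : S, mulL2 μ (π.coeffBCF hπ (b i) ξ) f t
      = π.coeffBCF hπ (b i) ξ t * f t := ae_all_iff.2 fun i => coeFn_mulL2 μ _ f
  filter_upwards [hae] with t ht
  have h1 : ∑ i ∈ S, ‖mulL2 μ (π.coeffBCF hπ (b i) ξ) f t‖ ^ 2
      = (∑ i ∈ S, ‖inner ℂ (π.op t (b i)) ξ‖ ^ 2) * ‖f t‖ ^ 2 := by
    rw [Finset.sum_mul]
    refine Finset.sum_congr rfl fun i hi => ?_
    rw [ht ⟨i, hi⟩, norm_mul, mul_pow, coeffBCF_apply]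
  rw [h1]
  exact mul_le_mul_of_nonneg_right ((π.orthonormal_op hb t).sum_inner_products_le ξ)
    (by positivity)

/-- The operator `f ↦ (⟨ξ, π(·)eᵢ⟩ f)ᵢ` from `L²(G)` to `ℓ²(ι, L²(G))`. -/
def fellColumn (hπ : ∀ x : H, Continuous fun s => π.op s x) {ι : Type*} {b : ι → H}
    (hb : Orthonormal ℂ b) (ξ : H) : Lp ℂ 2 μ →L[ℂ] lp (fun _ : ι => Lp ℂ 2 μ) 2 :=
  columnOp (fun i => mulL2 μ (π.coeffBCF hπ (b i) ξ)) ‖ξ‖ (norm_nonneg _)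
    (π.sum_norm_mulL2_sq_le μ hπ hb ξ)

theorem fellColumn_apply (hπ : ∀ x : H, Continuous fun s => π.op s x) {ι : Type*}
    {b : ι → H} (hb : Orthonormal ℂ b) (ξ : H) (f : Lp ℂ 2 μ) (i : ι) :
    π.fellColumn μ hπ hb ξ f i = mulL2 μ (π.coeffBCF hπ (b i) ξ) f := rfl

variable [IsTopologicalGroup G] [μ.IsMulLeftInvariant]

/-- Under the integral, the sum over the basis is the Parseval sum of `hasSum_coeffBCF` with `r =
s⁻¹t`, whose value does not depend on `t`. The compact set `K` confines the sum to a countable index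
set, which justifies exchanging it with the integral. -/
theorem inner_fellColumn_of_vanishing (hπ : ∀ x : H, Continuous fun s => π.op s x) {ι : Type*}
    (b : HilbertBasis ι ℂ H) (ξ η : H) (s : G) {f : Lp ℂ 2 μ} (g : Lp ℂ 2 μ) {K : Set G}
    (hK : IsCompact K) (hf : ∀ᵐ t ∂μ, t ∉ K → f t = 0) :
    inner ℂ (π.fellColumn μ hπ b.orthonormal η g)
      (amplify ι (leftRegular μ σ s) (π.fellColumn μ hπ b.orthonormal ξ f))
      = π.coeff ξ η s * inner ℂ g (leftRegular μ 1 s f) := by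
  set J : Set ι := {i | ∃ x ∈ (fun r => star (π.op r) ξ) '' K, inner ℂ (b i) x ≠ 0} with hJ
  have hJc : J.Countable :=
    countable_setOf_inner_ne_zero b (hK.image (π.continuous_star_orbit hπ ξ))
  have : Countable J := hJc.to_subtype
  have hzero : ∀ i ∉ J, ∀ r ∈ K, π.coeffBCF hπ (b i) ξ r = 0 := fun i hi r hr => by
    by_contra h0
    exact hi ⟨_, ⟨r, hr, rfl⟩, by rwa [inner_star_op]⟩
  set U : ι → Lp ℂ 2 μ := fun i => π.fellColumn μ hπ b.orthonormal η g i with hU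
  set V : ι → Lp ℂ 2 μ := fun i => leftRegular μ σ s (π.fellColumn μ hπ b.orthonormal ξ f i)
    with hV
  have hqm := (measurePreserving_mul_left μ s⁻¹).quasiMeasurePreserving
  have hUae : ∀ i, ∀ᵐ t ∂μ, U i t = π.coeffBCF hπ (b i) η t * g t := fun i => coeFn_mulL2 μ _ g
  have hVae : ∀ i, ∀ᵐ t ∂μ, V i t = (σ s (s⁻¹ * t) : ℂ) *
      (π.coeffBCF hπ (b i) ξ (s⁻¹ * t) * f (s⁻¹ * t)) := fun i => by
    filter_upwards [coeFn_leftRegular μ σ s (mulL2 μ (π.coeffBCF hπ (b i) ξ) f),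
      hqm.ae (coeFn_mulL2 μ (π.coeffBCF hπ (b i) ξ) f)] with t h1 h2
    rw [hV]
    dsimp only
    rw [fellColumn_apply, h1, h2]
  have hV0 : ∀ i ∉ J, V i = 0 := fun i hi => by
    refine Lp.ext ?_
    filter_upwards [hVae i, hqm.ae hf, Lp.coeFn_zero ℂ 2 μ] with t h1 h2 h3
    rw [h1, h3, Pi.zero_apply]
    by_cases hr : s⁻¹ * t ∈ K
    · rw [hzero i hi _ hr]; ring
    · rw [h2 hr]; ring
  have hsum : HasSum (fun i : J => inner ℂ (U i) (V i)) (inner ℂ (π.fellColumn μ hπ b.orthonormal η g)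
      (amplify ι (leftRegular μ σ s) (π.fellColumn μ hπ b.orthonormal ξ f))) := by
    have h1 := lp.hasSum_inner (𝕜 := ℂ) (π.fellColumn μ hπ b.orthonormal η g)
      (amplify ι (leftRegular μ σ s) (π.fellColumn μ hπ b.orthonormal ξ f))
    refine (hasSum_subtype_iff_of_support_subset ?_).2 h1
    intro i hi
    by_contra hiJ
    exact hi (by
      change inner ℂ (U i) (V i) = 0
      rw [hV0 i hiJ, inner_zero_right])
  have hsq : ∀ F : lp (fun _ : ι => Lp ℂ 2 μ) 2, Summable fun i => ‖F i‖ ^ 2 := fun F => by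
    have := (lp.memℓp F).summable (by simp)
    simpa using this
  have hint : ∀ i : J, Integrable (fun t => inner ℂ (U i t) (V i t)) μ := fun i =>
    L2.integrable_inner (U i) (V i)
  have hsummable : Summable fun i : J => ∫ t, ‖inner ℂ (U i t) (V i t)‖ ∂μ := by
    refine Summable.of_nonneg_of_le (fun i => integral_nonneg fun t => norm_nonneg _) (fun i => ?_)
      (((hsq (π.fellColumn μ hπ b.orthonormal η g)).add (hsq
        (amplify ι (leftRegular μ σ s) (π.fellColumn μ hπ b.orthonormal ξ f)))).comp_injective
        (Subtype.val_injective (p := (· ∈ J))))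
    change _ ≤ ‖U i‖ ^ 2 + ‖V i‖ ^ 2
    rw [norm_sq_eq_integral_norm_sq, norm_sq_eq_integral_norm_sq,
      ← integral_add (integrable_norm_sq _) (integrable_norm_sq _)]
    refine integral_mono (hint i).norm ((integrable_norm_sq _).add (integrable_norm_sq _))
      fun t => ?_
    refine (norm_inner_le_norm _ _).trans ?_
    change _ ≤ ‖U i t‖ ^ 2 + ‖V i t‖ ^ 2
    nlinarith [sq_nonneg (‖U i t‖ - ‖V i t‖), sq_nonneg ‖U i t‖, sq_nonneg ‖V i t‖]
  have hsum2 := hasSum_integral_of_summable_integral_norm hint hsummable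
  have h3 : HasSum (fun i : J => inner ℂ (U i) (V i)) (∫ t, ∑' i : J, inner ℂ (U i t) (V i t) ∂μ) :=
    hsum2
  rw [hsum.unique h3]
  have h4 : inner ℂ g (leftRegular μ 1 s f) = ∫ t, inner ℂ (g t) (leftRegular μ 1 s f t) ∂μ := rfl
  rw [h4, ← integral_const_mul]
  refine integral_congr_ae ?_
  filter_upwards [ae_all_iff.2 fun i : J => hUae i, ae_all_iff.2 fun i : J => hVae i,
    hqm.ae hf, coeFn_leftRegular μ 1 s f] with t h5 h6 h7 h8
  rw [h8]
  have h9 : ∀ i : J, inner ℂ (U i t) (V i t) = (starRingEnd ℂ (π.coeffBCF hπ (b i) η t) *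
      ((σ s (s⁻¹ * t) : ℂ) * π.coeffBCF hπ (b i) ξ (s⁻¹ * t))) *
      (starRingEnd ℂ (g t) * f (s⁻¹ * t)) := fun i => by
    rw [h5 i, h6 i, RCLike.inner_apply, (starRingEnd ℂ).map_mul]
    ring
  simp_rw [h9]
  by_cases hr : s⁻¹ * t ∈ K
  · have h10 : HasSum (fun i : J => starRingEnd ℂ (π.coeffBCF hπ (b i) η t) *
        ((σ s (s⁻¹ * t) : ℂ) * π.coeffBCF hπ (b i) ξ (s⁻¹ * t))) (π.coeff ξ η s) := by
      refine (hasSum_subtype_iff_of_support_subset ?_).2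
        (π.hasSum_coeffBCF hπ b ξ η (mul_inv_cancel_left s t))
      intro i hi
      by_contra hiJ
      exact hi (by dsimp only; rw [hzero i hiJ _ hr]; ring)
    rw [(h10.mul_right _).tsum_eq, RCLike.inner_apply]
    change _ = _ * (((1 : Circle) : ℂ) * _ * _)
    rw [Circle.coe_one]
    ring
  · rw [h7 hr]
    simp

end TwistedRep

end FellAbsorption

/-! ### Hilbert sums and matrices of operators -/

section HilbertSums

variable {κ κ' : Type*} {E : Type*} [NormedAddCommGroup E] [InnerProductSpace ℂ E]

theorem hasSum_norm_sq_lp (F : lp (fun _ : κ => E) 2) :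
    HasSum (fun i => ‖F i‖ ^ 2) (‖F‖ ^ 2) := by
  have h := lp.hasSum_inner (𝕜 := ℂ) F F
  simp only [inner_self_eq_norm_sq_to_K] at h
  have h2 := Complex.hasSum_re h
  convert h2 using 1
  · funext i; norm_cast
  · norm_cast

theorem amplify_add_apply (x y : E →L[ℂ] E) (f : lp (fun _ : κ => E) 2) :
    amplify κ (x + y) f = amplify κ x f + amplify κ y f := rfl

/-- The element of the Hilbert sum over `κ ⊕ κ'` with given components. -/
def lpSumElim (F : lp (fun _ : κ => E) 2) (F' : lp (fun _ : κ' => E) 2) :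
    lp (fun _ : κ ⊕ κ' => E) 2 :=
  ⟨fun k => Sum.elim (fun i => F i) (fun i => F' i) k, memℓp_gen (by
    simpa using Summable.sum (fun k : κ ⊕ κ' =>
      ‖(Sum.elim (fun i => F i) (fun i => F' i) k : E)‖ ^ 2)
      (hasSum_norm_sq_lp F).summable (hasSum_norm_sq_lp F').summable)⟩

/-- Turns a sum or difference of two amplified functionals into a single one, the form in which the
bicommutant lemma can be applied. -/
theorem inner_amplify_lpSumElim (x : E →L[ℂ] E) (F G : lp (fun _ : κ => E) 2)
    (F' G' : lp (fun _ : κ' => E) 2) :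
    inner ℂ (lpSumElim G G') (amplify (κ ⊕ κ') x (lpSumElim F F'))
      = inner ℂ G (amplify κ x F) + inner ℂ G' (amplify κ' x F') := by
  have h := lp.hasSum_inner (𝕜 := ℂ) (lpSumElim G G') (amplify (κ ⊕ κ') x (lpSumElim F F'))
  refine h.unique (HasSum.sum ?_ ?_)
  · exact lp.hasSum_inner G (amplify κ x F)
  · exact lp.hasSum_inner G' (amplify κ' x F')

theorem matrixOperator_apply {H : Type u} [NormedAddCommGroup H] [InnerProductSpace ℂ H] {k : ℕ}
    (x : Matrix (Fin k) (Fin k) (H →L[ℂ] H)) (v : PiLp 2 (fun _ : Fin k => H)) (p : Fin k) :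
    matrixOperator x v p = ∑ q, x p q (v q) := by
  simp [matrixOperator]

theorem sum_norm_matrix_sq_le {H : Type u} [NormedAddCommGroup H] [InnerProductSpace ℂ H] {k : ℕ}
    (x : Matrix (Fin k) (Fin k) (H →L[ℂ] H)) (v : Fin k → H) :
    ∑ p, ‖∑ q, x p q (v q)‖ ^ 2 ≤ ‖matrixOperator x‖ ^ 2 * ∑ q, ‖v q‖ ^ 2 := by
  have h := (matrixOperator x).le_opNorm (WithLp.toLp 2 v)
  have h2 := pow_le_pow_left₀ (norm_nonneg _) h 2
  rw [mul_pow, PiLp.norm_sq_eq_of_L2, PiLp.norm_sq_eq_of_L2] at h2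
  simpa [matrixOperator_apply] using h2

theorem norm_matrixOperator_le {H : Type u} [NormedAddCommGroup H] [InnerProductSpace ℂ H] {k : ℕ}
    (x : Matrix (Fin k) (Fin k) (H →L[ℂ] H)) {C : ℝ} (hC : 0 ≤ C)
    (h : ∀ v : Fin k → H, ∑ p, ‖∑ q, x p q (v q)‖ ^ 2 ≤ C ^ 2 * ∑ q, ‖v q‖ ^ 2) :
    ‖matrixOperator x‖ ≤ C := by
  refine ContinuousLinearMap.opNorm_le_bound _ hC fun v => ?_
  refine le_of_sq_le_sq ?_ (mul_nonneg hC (norm_nonneg _))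
  rw [mul_pow, PiLp.norm_sq_eq_of_L2, PiLp.norm_sq_eq_of_L2]
  simpa [matrixOperator_apply] using h v

/-- The scalar block estimate holds in each coordinate of the Hilbert sum, and the coordinates are
then added up. -/
theorem sum_norm_amplify_sq_le {H : Type u} [NormedAddCommGroup H] [InnerProductSpace ℂ H] {k : ℕ}
    (x : Matrix (Fin k) (Fin k) (H →L[ℂ] H)) (F : Fin k → lp (fun _ : κ => H) 2) :
    ∑ p, ‖∑ q, amplify κ (x p q) (F q)‖ ^ 2 ≤ ‖matrixOperator x‖ ^ 2 * ∑ q, ‖F q‖ ^ 2 := by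
  have h1 := hasSum_sum (s := Finset.univ) fun (p : Fin k) _ =>
    hasSum_norm_sq_lp (∑ q, amplify κ (x p q) (F q))
  have h2 := (hasSum_sum (s := Finset.univ) fun (q : Fin k) _ =>
    hasSum_norm_sq_lp (F q)).mul_left (‖matrixOperator x‖ ^ 2)
  refine hasSum_le (fun i => ?_) h1 h2
  have h3 := sum_norm_matrix_sq_le x fun q => F q i
  have h4 : ∀ p, (∑ q, amplify κ (x p q) (F q)) i = ∑ q, x p q (F q i) := fun p =>
    map_sum (lp.evalCLM ℂ (fun _ : κ => H) 2 i) _ _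
  simp_rw [h4]
  exact h3

end HilbertSums

/-! ### The twisted group von Neumann algebra and its normal functionals -/

section TwistedVN

open Set Filter Topology

variable {G : Type u} [Group G] [TopologicalSpace G] [IsTopologicalGroup G]
  [MeasurableSpace G] [BorelSpace G] (μ : Measure G) [μ.IsMulLeftInvariant]
  (σ : ContinuousTwoCocycle G)

theorem star_leftRegular (s : G) :
    star (leftRegular μ σ s) = starRingEnd ℂ (σ s⁻¹ s : ℂ) • leftRegular μ σ s⁻¹ := by
  have h1 : leftRegular μ σ s⁻¹ * leftRegular μ σ s = (σ s⁻¹ s : ℂ) • 1 := by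
    ext1 f
    refine (leftRegular_leftRegular μ σ s⁻¹ s f).trans ?_
    rw [inv_mul_cancel, leftRegular_one]
    rfl
  have h2 : leftRegular μ σ s * leftRegular μ σ s⁻¹ = (σ s s⁻¹ : ℂ) • 1 := by
    ext1 f
    refine (leftRegular_leftRegular μ σ s s⁻¹ f).trans ?_
    rw [mul_inv_cancel, leftRegular_one]
    rfl
  have h3 : star (leftRegular μ σ s) * leftRegular μ σ s = 1 := by
    ext1 f
    refine ext_inner_left ℂ fun g => ?_
    change inner ℂ g (star (leftRegular μ σ s) (leftRegular μ σ s f)) = inner ℂ g f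
    rw [ContinuousLinearMap.star_eq_adjoint, ContinuousLinearMap.adjoint_inner_right,
      inner_leftRegular]
  have h4 : (σ s s⁻¹ : ℂ) • star (leftRegular μ σ s) = leftRegular μ σ s⁻¹ := by
    calc (σ s s⁻¹ : ℂ) • star (leftRegular μ σ s)
        = star (leftRegular μ σ s) * (leftRegular μ σ s * leftRegular μ σ s⁻¹) := by
          rw [h2, mul_smul_comm, mul_one]
      _ = leftRegular μ σ s⁻¹ := by rw [← mul_assoc, h3, one_mul]
  have h5 : (σ s s⁻¹ : ℂ) = σ s⁻¹ s := by
    have := σ.cocycle_coe s s⁻¹ s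
    rw [mul_inv_cancel, inv_mul_cancel, σ.map_one_left, σ.map_one_right, Circle.coe_one] at this
    linear_combination this
  rw [← h4, smul_smul, h5, σ.conj_mul_self, one_smul]

theorem commute_of_mem_twistedVN {x y : Lp ℂ 2 μ →L[ℂ] Lp ℂ 2 μ}
    (hx : x ∈ (twistedVN μ σ).toStarSubalgebra)
    (hy : ∀ s, leftRegular μ σ s * y = y * leftRegular μ σ s) : x * y = y * x := by
  have hy' : y ∈ StarSubalgebra.centralizer ℂ (Set.range (leftRegular μ σ)) := by
    refine StarSubalgebra.mem_centralizer_iff ℂ |>.2 ?_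
    rintro _ ⟨s, rfl⟩
    refine ⟨hy s, ?_⟩
    rw [star_leftRegular, smul_mul_assoc, mul_smul_comm, hy]
  exact ((StarSubalgebra.mem_centralizer_iff ℂ |>.1 hx _ hy').1).symm

theorem mem_twistedVN_of_commute {x : Lp ℂ 2 μ →L[ℂ] Lp ℂ 2 μ}
    (h : ∀ y, (∀ s, leftRegular μ σ s * y = y * leftRegular μ σ s) → y * x = x * y) :
    x ∈ (twistedVN μ σ).toStarSubalgebra := by
  refine StarSubalgebra.mem_centralizer_iff ℂ |>.2 fun g hg => ?_
  have hg' := fun s => StarSubalgebra.mem_centralizer_iff ℂ |>.1 hg _ (Set.mem_range_self s)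
  refine ⟨h g fun s => (hg' s).1, h (star g) fun s => ?_⟩
  have := congrArg star (hg' s).2
  simpa [star_mul] using this.symm

/-- If two square summable families of vector functionals agree on all `λ_σ(s)`, they agree on
`VN(G,σ)`. -/
theorem inner_amplify_eq_zero_of_mem_twistedVN {κ : Type*} {x : Lp ℂ 2 μ →L[ℂ] Lp ℂ 2 μ}
    (hx : x ∈ (twistedVN μ σ).toStarSubalgebra) {f g : lp (fun _ : κ => Lp ℂ 2 μ) 2}
    (h : ∀ s, inner ℂ g (amplify κ (leftRegular μ σ s) f) = 0) :
    inner ℂ g (amplify κ x f) = 0 := by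
  refine inner_amplify_eq_zero_of_bicommutant (𝓢 := Set.range (leftRegular μ σ)) ⟨1, ?_⟩ ?_ ?_ ?_ ?_
  · ext1 f
    exact leftRegular_one μ σ f
  · rintro _ ⟨s, rfl⟩ _ ⟨t, rfl⟩
    refine ⟨σ s t, _, ⟨s * t, rfl⟩, ?_⟩
    ext1 f
    exact leftRegular_leftRegular μ σ s t f
  · rintro _ ⟨s, rfl⟩
    exact ⟨_, _, ⟨s⁻¹, rfl⟩, star_leftRegular μ σ s⟩
  · intro y hy
    exact commute_of_mem_twistedVN μ σ hx fun s => hy _ ⟨s, rfl⟩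
  · rintro _ ⟨s, rfl⟩
    exact h s

theorem norm_vectorFunctional_le (ξ η : Lp ℂ 2 μ) : ‖vectorFunctional μ σ ξ η‖ ≤ ‖η‖ * ‖ξ‖ :=
  LinearMap.mkContinuous_norm_le _ (by positivity) _

theorem vectorFunctional_apply (ξ η : Lp ℂ 2 μ) (x : TwistedVN μ σ) :
    vectorFunctional μ σ ξ η x = inner ℂ η ((x : Lp ℂ 2 μ →L[ℂ] Lp ℂ 2 μ) ξ) := rfl

theorem vectorFunctional_mem (ξ η : Lp ℂ 2 μ) : vectorFunctional μ σ ξ η ∈ twistedFourier μ σ :=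
  Submodule.le_topologicalClosure _ (Submodule.subset_span ⟨ξ, η, rfl⟩)

/-- The componentwise vector functionals are norm summable, since `‖E i‖ ‖F i‖` is at most `‖E i‖² +
‖F i‖²`; their sum stays in the closed span. -/
theorem mem_twistedFourier_of_inner_amplify {κ : Type*} (F E : lp (fun _ : κ => Lp ℂ 2 μ) 2)
    (ω : StrongDual ℂ (TwistedVN μ σ))
    (h : ∀ x : TwistedVN μ σ, ω x = inner ℂ E (amplify κ (x : Lp ℂ 2 μ →L[ℂ] Lp ℂ 2 μ) F)) :
    ω ∈ twistedFourier μ σ := by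
  have hs : Summable fun i => vectorFunctional μ σ (F i) (E i) := by
    refine Summable.of_norm_bounded
      ((hasSum_norm_sq_lp E).summable.add (hasSum_norm_sq_lp F).summable) fun i => ?_
    refine (norm_vectorFunctional_le μ σ _ _).trans ?_
    nlinarith [sq_nonneg (‖E i‖ - ‖F i‖), sq_nonneg ‖E i‖, sq_nonneg ‖F i‖]
  have h1 : ω = ∑' i, vectorFunctional μ σ (F i) (E i) := by
    ext x
    have h2 := (ContinuousLinearMap.apply ℂ ℂ x).hasSum hs.hasSum
    have h3 := lp.hasSum_inner (𝕜 := ℂ) E (amplify κ (x : Lp ℂ 2 μ →L[ℂ] Lp ℂ 2 μ) F)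
    rw [h x]
    exact h3.unique h2
  rw [h1]
  refine (Submodule.isClosed_topologicalClosure _).mem_of_tendsto hs.hasSum
    (.of_forall fun S => ?_)
  exact Submodule.sum_mem _ fun i _ => vectorFunctional_mem μ σ _ _

end TwistedVN

/-! ### The compression VN(G,σ) → VN(G) and its pre-adjoint -/

section FellMap

open Set Filter Topology

/-- The compression `x ↦ W^* (x ⊕ x ⊕ ⋯) V` of an amplification. -/
def compress {κ : Type*} {E : Type*} [NormedAddCommGroup E] [InnerProductSpace ℂ E]
    [CompleteSpace E] (V W : E →L[ℂ] lp (fun _ : κ => E) 2) (x : E →L[ℂ] E) : E →L[ℂ] E :=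
  ContinuousLinearMap.adjoint W ∘L amplify κ x ∘L V

section Compress

variable {κ : Type*} {E : Type*} [NormedAddCommGroup E] [InnerProductSpace ℂ E]
    [CompleteSpace E] (V W : E →L[ℂ] lp (fun _ : κ => E) 2)

theorem compress_apply (x : E →L[ℂ] E) (f : E) :
    compress V W x f = ContinuousLinearMap.adjoint W (amplify κ x (V f)) := rfl

theorem inner_compress (x : E →L[ℂ] E) (f g : E) :
    inner ℂ g (compress V W x f) = inner ℂ (W g) (amplify κ x (V f)) := by
  rw [compress_apply, ContinuousLinearMap.adjoint_inner_right]

theorem compress_add (x y : E →L[ℂ] E) :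
    compress V W (x + y) = compress V W x + compress V W y := by
  ext1 f
  rw [add_apply, compress_apply, compress_apply, compress_apply,
    amplify_add_apply, map_add]

theorem compress_smul (c : ℂ) (x : E →L[ℂ] E) :
    compress V W (c • x) = c • compress V W x := by
  ext1 f
  rw [smul_apply, compress_apply, compress_apply, amplify_smul, map_smul]

theorem norm_compress_le (x : E →L[ℂ] E) : ‖compress V W x‖ ≤ ‖W‖ * (‖x‖ * ‖V‖) := by
  refine (ContinuousLinearMap.opNorm_comp_le _ _).trans ?_
  rw [LinearIsometryEquiv.norm_map]
  refine mul_le_mul_of_nonneg_left ?_ (norm_nonneg _)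
  refine (ContinuousLinearMap.opNorm_comp_le _ _).trans
    (mul_le_mul_of_nonneg_right ?_ (norm_nonneg _))
  exact ContinuousLinearMap.opNorm_le_bound _ (norm_nonneg _) fun f =>
    norm_columnOp_apply_le _ _ _ _ f

end Compress

/-- The block estimate for amplifications is applied to the vectors `V (v q)` and followed by the
adjoint of `W`. The constant is independent of the matrix size, so the compression is completely
bounded. -/
theorem norm_matrixOperator_compress_le {κ : Type*} {E : Type u} [NormedAddCommGroup E]
    [InnerProductSpace ℂ E] [CompleteSpace E] (V W : E →L[ℂ] lp (fun _ : κ => E) 2) {k : ℕ}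
    (x : Matrix (Fin k) (Fin k) (E →L[ℂ] E)) :
    ‖matrixOperator fun p q => compress V W (x p q)‖ ≤ ‖V‖ * ‖W‖ * ‖matrixOperator x‖ := by
  refine norm_matrixOperator_le _ (by positivity) fun v => ?_
  have h1 : ∀ p, ‖∑ q, compress V W (x p q) (v q)‖
      ≤ ‖W‖ * ‖∑ q, amplify κ (x p q) (V (v q))‖ := fun p => by
    have h2 : ∑ q, compress V W (x p q) (v q)
        = ContinuousLinearMap.adjoint W (∑ q, amplify κ (x p q) (V (v q))) := by
      rw [map_sum]
      rfl
    rw [h2]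
    exact ContinuousLinearMap.le_of_opNorm_le _ (LinearIsometryEquiv.norm_map _ _).le _
  calc ∑ p, ‖∑ q, compress V W (x p q) (v q)‖ ^ 2
      ≤ ∑ p, ‖W‖ ^ 2 * ‖∑ q, amplify κ (x p q) (V (v q))‖ ^ 2 := Finset.sum_le_sum fun p _ => by
        rw [← mul_pow]
        exact pow_le_pow_left₀ (norm_nonneg _) (h1 p) 2
    _ ≤ ‖W‖ ^ 2 * (‖matrixOperator x‖ ^ 2 * ∑ q, ‖V (v q)‖ ^ 2) := by
        rw [← Finset.mul_sum]
        exact mul_le_mul_of_nonneg_left (sum_norm_amplify_sq_le x fun q => V (v q)) (by positivity)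
    _ ≤ ‖W‖ ^ 2 * (‖matrixOperator x‖ ^ 2 * ∑ q, (‖V‖ * ‖v q‖) ^ 2) := by
        gcongr with q _
        exact V.le_opNorm _
    _ = (‖V‖ * ‖W‖ * ‖matrixOperator x‖) ^ 2 * ∑ q, ‖v q‖ ^ 2 := by
        simp_rw [mul_pow, ← Finset.mul_sum]
        ring

theorem comp_mem_of_mem_closure_span {E F : Type*} [NormedAddCommGroup E] [NormedSpace ℂ E]
    [NormedAddCommGroup F] [NormedSpace ℂ F] (Φ : F →L[ℂ] E) {S : Set (StrongDual ℂ E)}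
    {A : Submodule ℂ (StrongDual ℂ F)} (hA : IsClosed (A : Set (StrongDual ℂ F)))
    (h : ∀ ω ∈ S, ω ∘L Φ ∈ A) {ω : StrongDual ℂ E}
    (hω : ω ∈ (Submodule.span ℂ S).topologicalClosure) : ω ∘L Φ ∈ A := by
  let P : StrongDual ℂ E →L[ℂ] StrongDual ℂ F := ContinuousLinearMap.precomp ℂ Φ
  have hle : (Submodule.span ℂ S).topologicalClosure ≤ A.comap P.toLinearMap :=
    Submodule.topologicalClosure_minimal _ (Submodule.span_le.2 h) (hA.preimage P.continuous)
  exact hle hω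

theorem comp_mem_twistedFourier {G : Type u} [Group G] [TopologicalSpace G] [IsTopologicalGroup G]
    [MeasurableSpace G] [BorelSpace G] (μ : Measure G) [μ.IsMulLeftInvariant]
    {σ τ : ContinuousTwoCocycle G} (Φ : TwistedVN μ σ →L[ℂ] TwistedVN μ τ)
    (h : ∀ f g, vectorFunctional μ τ f g ∘L Φ ∈ twistedFourier μ σ)
    {ω : StrongDual ℂ (TwistedVN μ τ)} (hω : ω ∈ twistedFourier μ τ) :
    ω ∘L Φ ∈ twistedFourier μ σ := by
  refine comp_mem_of_mem_closure_span Φ (Submodule.isClosed_topologicalClosure _) ?_ hω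
  rintro _ ⟨f, g, rfl⟩
  exact h f g

namespace TwistedRep

variable {G : Type u} [Group G] [TopologicalSpace G] [MeasurableSpace G] [BorelSpace G]
  {σ : ContinuousTwoCocycle G} {H : Type u} [NormedAddCommGroup H] [InnerProductSpace ℂ H]
  [CompleteSpace H] (π : TwistedRep σ H) (μ : Measure G)
  (hπ : ∀ x : H, Continuous fun s => π.op s x) {ι : Type*} (b : HilbertBasis ι ℂ H) (ξ η : H)

/-- The compression implementing the multiplication by the coefficient `⟨π(·)ξ, η⟩`. -/
def fellMap (x : Lp ℂ 2 μ →L[ℂ] Lp ℂ 2 μ) : Lp ℂ 2 μ →L[ℂ] Lp ℂ 2 μ :=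
  compress (π.fellColumn μ hπ b.orthonormal ξ) (π.fellColumn μ hπ b.orthonormal η) x

theorem inner_fellMap (x : Lp ℂ 2 μ →L[ℂ] Lp ℂ 2 μ) (f g : Lp ℂ 2 μ) :
    inner ℂ g (π.fellMap μ hπ b ξ η x f) = inner ℂ (π.fellColumn μ hπ b.orthonormal η g)
      (amplify ι x (π.fellColumn μ hπ b.orthonormal ξ f)) :=
  inner_compress _ _ x f g

variable [IsTopologicalGroup G] [T2Space G] [LocallyCompactSpace G] [μ.IsHaarMeasure] [μ.Regular]

/-- Fell absorption: the compression maps `λ_σ(s)` to a multiple of `λ(s)`. -/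
theorem fellMap_leftRegular (s : G) :
    π.fellMap μ hπ b ξ η (leftRegular μ σ s) = π.coeff ξ η s • leftRegular μ 1 s := by
  ext1 f
  refine congrFun (Continuous.ext_on (dense_vanishing_off_compact μ)
    (ContinuousLinearMap.continuous _) (ContinuousLinearMap.continuous _) ?_) f
  rintro f ⟨K, hK, hf⟩
  refine ext_inner_left ℂ fun g => ?_
  rw [inner_fellMap, π.inner_fellColumn_of_vanishing μ hπ b ξ η s g hK hf]
  exact (inner_smul_right _ _ _).symm

/-- For `y` in the commutant of the λ(s), each matrix coefficient of the commutator of `y` with the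
compression of `x` is one amplified functional of `x`, indexed by `ι ⊕ ι`. It vanishes at every
λ_σ(s) by `fellMap_leftRegular`, hence on VN(G,σ). -/
theorem fellMap_mem {x : Lp ℂ 2 μ →L[ℂ] Lp ℂ 2 μ} (hx : x ∈ (twistedVN μ σ).toStarSubalgebra) :
    π.fellMap μ hπ b ξ η x ∈ (twistedVN μ 1).toStarSubalgebra := by
  refine mem_twistedVN_of_commute μ 1 fun y hy => ?_
  ext1 f
  refine ext_inner_left ℂ fun g => ?_
  have key : ∀ z : Lp ℂ 2 μ →L[ℂ] Lp ℂ 2 μ,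
      inner ℂ (lpSumElim (π.fellColumn μ hπ b.orthonormal η (star y g))
        (-π.fellColumn μ hπ b.orthonormal η g)) (amplify (ι ⊕ ι) z
        (lpSumElim (π.fellColumn μ hπ b.orthonormal ξ f) (π.fellColumn μ hπ b.orthonormal ξ (y f))))
      = inner ℂ g (y (π.fellMap μ hπ b ξ η z f)) - inner ℂ g (π.fellMap μ hπ b ξ η z (y f)) := by
    intro z
    rw [inner_amplify_lpSumElim, inner_neg_left, ← inner_fellMap, ← inner_fellMap,
      ContinuousLinearMap.star_eq_adjoint, ContinuousLinearMap.adjoint_inner_left, sub_eq_add_neg]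
  have h := inner_amplify_eq_zero_of_mem_twistedVN μ σ hx fun s => by
    rw [key, sub_eq_zero, fellMap_leftRegular]
    have := congrArg (fun T : Lp ℂ 2 μ →L[ℂ] Lp ℂ 2 μ => T f) (hy s)
    change leftRegular μ 1 s (y f) = y (leftRegular μ 1 s f) at this
    change inner ℂ g (y (π.coeff ξ η s • leftRegular μ 1 s f))
      = inner ℂ g (π.coeff ξ η s • leftRegular μ 1 s (y f))
    rw [map_smul, this]
  rw [key, sub_eq_zero] at h
  exact h

/-- The compression as a bounded map `VN(G,σ) → VN(G)`. -/
def fellMapVN : TwistedVN μ σ →L[ℂ] TwistedVN μ 1 :=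
  LinearMap.mkContinuous
    { toFun := fun x => ⟨π.fellMap μ hπ b ξ η x, π.fellMap_mem μ hπ b ξ η x.2⟩
      map_add' := fun x y => Subtype.ext (compress_add _ _ _ _)
      map_smul' := fun c x => Subtype.ext (compress_smul _ _ _ _) }
    (‖π.fellColumn μ hπ b.orthonormal η‖ * ‖π.fellColumn μ hπ b.orthonormal ξ‖) fun x =>
      (norm_compress_le _ _ _).trans_eq (by
        rw [mul_comm ‖(x : Lp ℂ 2 μ →L[ℂ] Lp ℂ 2 μ)‖, mul_assoc]
        rfl)

theorem fellMapVN_coe (x : TwistedVN μ σ) :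
    (π.fellMapVN μ hπ b ξ η x : Lp ℂ 2 μ →L[ℂ] Lp ℂ 2 μ) = π.fellMap μ hπ b ξ η x := rfl

theorem comp_fellMapVN_mem {ω : StrongDual ℂ (TwistedVN μ 1)} (hω : ω ∈ twistedFourier μ 1) :
    ω ∘L π.fellMapVN μ hπ b ξ η ∈ twistedFourier μ σ := by
  refine comp_mem_twistedFourier μ _ (fun f g => ?_) hω
  refine mem_twistedFourier_of_inner_amplify μ σ (π.fellColumn μ hπ b.orthonormal ξ f)
    (π.fellColumn μ hπ b.orthonormal η g) _ fun x => ?_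
  rw [ContinuousLinearMap.comp_apply, vectorFunctional_apply, fellMapVN_coe, inner_fellMap]

/-- The adjoint map `A(G) → A(G,σ)` of the compression. -/
def fellPredual : twistedFourier μ 1 →ₗ[ℂ] twistedFourier μ σ where
  toFun ψ := ⟨(ψ : StrongDual ℂ (TwistedVN μ 1)) ∘L π.fellMapVN μ hπ b ξ η,
    π.comp_fellMapVN_mem μ hπ b ξ η ψ.2⟩
  map_add' _ _ := rfl
  map_smul' _ _ := rfl

theorem isMultiplicationBy_fellPredual :
    IsMultiplicationBy μ (π.coeff ξ η) (π.fellPredual μ hπ b ξ η) := by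
  intro ψ s
  have h : π.fellMapVN μ hπ b ξ η (leftRegularVN μ σ s) = π.coeff ξ η s • leftRegularVN μ 1 s :=
    Subtype.ext (π.fellMap_leftRegular μ hπ b ξ η s)
  change (ψ : StrongDual ℂ (TwistedVN μ 1)) (π.fellMapVN μ hπ b ξ η (leftRegularVN μ σ s)) = _
  rw [h, map_smul]
  rfl

end TwistedRep

end FellMap

/-! ### Operator space norms, pre-adjoints, and completely bounded versus bounded -/

section OperatorSpace

open Set Filter Topology

theorem matrixOperator_smul {H : Type u} [NormedAddCommGroup H] [InnerProductSpace ℂ H] {k : ℕ}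
    (c : ℂ) (x : Matrix (Fin k) (Fin k) (H →L[ℂ] H)) :
    matrixOperator (c • x) = c • matrixOperator x := by
  ext v p
  rw [matrixOperator_apply, smul_apply, PiLp.smul_apply, matrixOperator_apply, Finset.smul_sum]
  rfl

variable {G : Type u} [Group G] [TopologicalSpace G] [IsTopologicalGroup G]
  [MeasurableSpace G] [BorelSpace G] (μ : Measure G) [μ.IsMulLeftInvariant]
  {σ τ : ContinuousTwoCocycle G}

theorem enorm_le_fourierMatrixNorm {n k : ℕ} (Ψ : Matrix (Fin n) (Fin n) (twistedFourier μ σ))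
    (x : Matrix (Fin k) (Fin k) (TwistedVN μ σ)) (hx : vnMatrixNorm μ σ x ≤ 1) :
    ‖Matrix.toEuclideanCLM (n := Fin k × Fin n) (𝕜 := ℂ) (Matrix.of fun a b =>
      (Ψ a.2 b.2 : StrongDual ℂ (TwistedVN μ σ)) (x a.1 b.1))‖ₑ ≤ fourierMatrixNorm μ σ Ψ := by
  unfold fourierMatrixNorm
  exact le_iSup_of_le k (le_iSup_of_le x (le_iSup_of_le hx le_rfl))

theorem fourierMatrixNorm_le {n : ℕ} (Ψ : Matrix (Fin n) (Fin n) (twistedFourier μ σ)) (C : ℝ≥0∞)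
    (h : ∀ (k : ℕ) (x : Matrix (Fin k) (Fin k) (TwistedVN μ σ)), vnMatrixNorm μ σ x ≤ 1 →
      ‖Matrix.toEuclideanCLM (n := Fin k × Fin n) (𝕜 := ℂ) (Matrix.of fun a b =>
        (Ψ a.2 b.2 : StrongDual ℂ (TwistedVN μ σ)) (x a.1 b.1))‖ₑ ≤ C) :
    fourierMatrixNorm μ σ Ψ ≤ C := by
  unfold fourierMatrixNorm
  exact iSup_le fun k => iSup_le fun x => iSup_le fun hx => h k x hx

theorem fourierMatrixNorm_le_fourierCbNorm (T : twistedFourier μ τ →ₗ[ℂ] twistedFourier μ σ)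
    {n : ℕ} (Ψ : Matrix (Fin n) (Fin n) (twistedFourier μ τ)) (h : fourierMatrixNorm μ τ Ψ ≤ 1) :
    fourierMatrixNorm μ σ (Ψ.map T) ≤ fourierCbNorm μ T := by
  unfold fourierCbNorm
  exact le_iSup_of_le n (le_iSup_of_le Ψ (le_iSup_of_le h le_rfl))

theorem fourierCbNorm_le (T : twistedFourier μ τ →ₗ[ℂ] twistedFourier μ σ) (C : ℝ≥0∞)
    (h : ∀ (n : ℕ) (Ψ : Matrix (Fin n) (Fin n) (twistedFourier μ τ)),
      fourierMatrixNorm μ τ Ψ ≤ 1 → fourierMatrixNorm μ σ (Ψ.map T) ≤ C) :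
    fourierCbNorm μ T ≤ C := by
  unfold fourierCbNorm
  exact iSup_le fun n => iSup_le fun Ψ => iSup_le fun hΨ => h n Ψ hΨ

theorem vnMatrixNorm_smul {k : ℕ} (x : Matrix (Fin k) (Fin k) (TwistedVN μ σ)) (c : ℂ) :
    vnMatrixNorm μ σ (Matrix.of fun p q => c • x p q) = ‖c‖ * vnMatrixNorm μ σ x := by
  have h := matrixOperator_smul c (Matrix.of fun p q => (x p q : Lp ℂ 2 μ →L[ℂ] Lp ℂ 2 μ))
  exact (congrArg norm h).trans (norm_smul _ _)

theorem apply_eq_mul_apply_smul {E : Type*} [NormedAddCommGroup E] [NormedSpace ℂ E]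
    (ω : StrongDual ℂ E) {c d : ℂ} (h : d * c = 1) (y : E) : ω y = d * ω (c • y) := by
  rw [map_smul, smul_eq_mul, ← mul_assoc, h, one_mul]

theorem enorm_toEuclideanCLM_smul {n : Type*} [Fintype n] [DecidableEq n] (M N : Matrix n n ℂ)
    (c : ℂ) (h : ∀ a b, M a b = c * N a b) : ‖Matrix.toEuclideanCLM (n := n) (𝕜 := ℂ) M‖ₑ
      = ‖c‖ₑ * ‖Matrix.toEuclideanCLM (n := n) (𝕜 := ℂ) N‖ₑ := by
  have h1 : M = c • N := Matrix.ext h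
  rw [h1, map_smul, enorm_smul]

-- The pre-adjoint inherits the cb-bound of `Φ`: evaluating `Ψ.map T` at `x` is evaluating `Ψ` at
-- the image matrix, which lies in the unit ball after division by `C`.
set_option maxHeartbeats 1000000 in
theorem fourierMatrixNorm_map_le_of_predual {T : twistedFourier μ τ →ₗ[ℂ] twistedFourier μ σ}
    (Φ : TwistedVN μ σ →L[ℂ] TwistedVN μ τ)
    (hT : ∀ ψ x, (T ψ : StrongDual ℂ (TwistedVN μ σ)) x = (ψ : StrongDual ℂ (TwistedVN μ τ)) (Φ x))
    {C : ℝ} (hC : 0 < C)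
    (hΦ : ∀ (k : ℕ) (x : Matrix (Fin k) (Fin k) (TwistedVN μ σ)),
      vnMatrixNorm μ τ (x.map Φ) ≤ C * vnMatrixNorm μ σ x) {n : ℕ}
    (Ψ : Matrix (Fin n) (Fin n) (twistedFourier μ τ)) :
    fourierMatrixNorm μ σ (Ψ.map T) ≤ ENNReal.ofReal C * fourierMatrixNorm μ τ Ψ := by
  refine fourierMatrixNorm_le μ _ _ fun k x hx => ?_
  obtain ⟨c, hc⟩ : ∃ c : ℂ, c = ((C⁻¹ : ℝ) : ℂ) := ⟨_, rfl⟩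
  have hcC : (C : ℂ) * c = 1 := by
    rw [hc, ← Complex.ofReal_mul, mul_inv_cancel₀ hC.ne', Complex.ofReal_one]
  have hy1 : vnMatrixNorm μ τ (Matrix.of fun p q => c • (x.map Φ) p q) ≤ 1 := by
    have hcn : ‖c‖ = C⁻¹ := by
      rw [hc, Complex.norm_real, Real.norm_of_nonneg (by positivity)]
    have hreal : ∀ A B : ℝ, A ≤ C * B → B ≤ 1 → ‖c‖ * A ≤ 1 := fun A B h1 h2 => by
      rw [hcn, inv_mul_le_iff₀ hC]
      exact h1.trans (mul_le_mul_of_nonneg_left h2 hC.le)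
    exact (vnMatrixNorm_smul μ (x.map Φ) c).trans_le (hreal _ _ (hΦ k x) hx)
  have h2 := enorm_le_fourierMatrixNorm μ Ψ
    (Matrix.of fun p q => c • (x.map Φ) p q) hy1
  have h3 : ‖(C : ℂ)‖ₑ = ENNReal.ofReal C := by
    rw [← ofReal_norm, Complex.norm_real, Real.norm_of_nonneg hC.le]
  have h4 : ∀ i j z, ((Ψ.map T) i j : StrongDual ℂ (TwistedVN μ σ)) z
      = (C : ℂ) * (Ψ i j : StrongDual ℂ (TwistedVN μ τ)) (c • Φ z) := fun i j z =>
    (hT _ _).trans (apply_eq_mul_apply_smul _ hcC _)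
  rw [enorm_toEuclideanCLM_smul (Matrix.of fun a b : Fin k × Fin n =>
      ((Ψ.map T) a.2 b.2 : StrongDual ℂ (TwistedVN μ σ)) (x a.1 b.1))
    (Matrix.of fun a b : Fin k × Fin n =>
    (Ψ a.2 b.2 : StrongDual ℂ (TwistedVN μ τ)) (c • Φ (x a.1 b.1))) (C : ℂ)
    fun a b => h4 a.2 b.2 (x a.1 b.1), h3]
  exact mul_le_mul_right h2 _

theorem fourierCbNorm_le_of_predual {T : twistedFourier μ τ →ₗ[ℂ] twistedFourier μ σ}
    (Φ : TwistedVN μ σ →L[ℂ] TwistedVN μ τ)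
    (hT : ∀ ψ x, (T ψ : StrongDual ℂ (TwistedVN μ σ)) x = (ψ : StrongDual ℂ (TwistedVN μ τ)) (Φ x))
    {C : ℝ} (hC : 0 < C)
    (hΦ : ∀ (k : ℕ) (x : Matrix (Fin k) (Fin k) (TwistedVN μ σ)),
      vnMatrixNorm μ τ (x.map Φ) ≤ C * vnMatrixNorm μ σ x) :
    fourierCbNorm μ T ≤ ENNReal.ofReal C := by
  refine fourierCbNorm_le μ T _ fun n Ψ hΨ => ?_
  refine (fourierMatrixNorm_map_le_of_predual μ Φ hT hC hΦ Ψ).trans ?_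
  exact (mul_le_mul_right hΨ _).trans_eq (mul_one _)

/-- The sum is a scalar row times `x` times a scalar column; the norm of `x` controls the product
with the column, and Cauchy–Schwarz the product with the row. -/
theorem norm_sum_smul_le {H : Type u} [NormedAddCommGroup H] [InnerProductSpace ℂ H] {k : ℕ}
    (x : Matrix (Fin k) (Fin k) (H →L[ℂ] H)) (hx : ‖matrixOperator x‖ ≤ 1)
    (w v : EuclideanSpace ℂ (Fin k)) :
    ‖∑ p, ∑ q, (w p * v q) • x p q‖ ≤ ‖w‖ * ‖v‖ := by
  refine ContinuousLinearMap.opNorm_le_bound _ (by positivity) fun f => ?_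
  have h1 : (∑ p, ∑ q, (w p * v q) • x p q) f = ∑ p, w p • ∑ q, x p q (v q • f) := by
    rw [sum_apply]
    refine Finset.sum_congr rfl fun p _ => ?_
    rw [sum_apply, Finset.smul_sum]
    refine Finset.sum_congr rfl fun q _ => ?_
    rw [smul_apply, map_smul, smul_smul]
  have h2 := sum_norm_matrix_sq_le x fun q => v q • f
  have h3 : ∑ p, ‖∑ q, x p q (v q • f)‖ ^ 2 ≤ (‖v‖ * ‖f‖) ^ 2 := by
    calc _ ≤ 1 ^ 2 * ∑ q, ‖v q • f‖ ^ 2 := h2.trans (by gcongr)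
      _ = (‖v‖ * ‖f‖) ^ 2 := by
        rw [one_pow, one_mul, mul_pow, EuclideanSpace.norm_sq_eq, Finset.sum_mul]
        simp_rw [norm_smul, mul_pow]
  rw [h1]
  have h4 : (∑ p, ‖w p‖ * ‖∑ q, x p q (v q • f)‖) ^ 2 ≤ ‖w‖ ^ 2 * (‖v‖ * ‖f‖) ^ 2 := by
    refine (Finset.sum_mul_sq_le_sq_mul_sq _ _ _).trans ?_
    rw [EuclideanSpace.norm_sq_eq]
    exact mul_le_mul_of_nonneg_left h3 (by positivity)
  calc ‖∑ p, w p • ∑ q, x p q (v q • f)‖ ≤ ∑ p, ‖w p‖ * ‖∑ q, x p q (v q • f)‖ :=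
        (norm_sum_le _ _).trans (Finset.sum_le_sum fun p _ => (norm_smul _ _).le)
    _ ≤ ‖w‖ * ‖v‖ * ‖f‖ := by
        refine le_of_sq_le_sq (h4.trans_eq (by ring)) (by positivity)

theorem norm_toEuclideanCLM_le {n : Type*} [Fintype n] [DecidableEq n] (M : Matrix n n ℂ) {C : ℝ}
    (hC : 0 ≤ C)
    (h : ∀ w v : EuclideanSpace ℂ n, ‖∑ p, ∑ q, (w p * v q) * M p q‖ ≤ C * (‖w‖ * ‖v‖)) :
    ‖Matrix.toEuclideanCLM (n := n) (𝕜 := ℂ) M‖ ≤ C := by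
  refine ContinuousLinearMap.opNorm_le_bound _ hC fun v => ?_
  set u := Matrix.toEuclideanCLM (n := n) (𝕜 := ℂ) M v with hu
  have hup : ∀ p, u p = ∑ q, M p q * v q := fun p => rfl
  have h1 : ((‖u‖ ^ 2 : ℝ) : ℂ) = ∑ p, ∑ q, (starRingEnd ℂ (u p) * v q) * M p q := by
    rw [EuclideanSpace.norm_sq_eq]
    push_cast
    refine Finset.sum_congr rfl fun p _ => ?_
    rw [← Complex.conj_mul']
    refine (congrArg (starRingEnd ℂ (u p) * ·) (hup p)).trans ?_
    rw [Finset.mul_sum]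
    exact Finset.sum_congr rfl fun q _ => by ring
  -- The form is bilinear rather than sesquilinear, so the test vector producing `‖u‖²` is the
  -- conjugate of `u = M v`.
  have h2 := h (WithLp.toLp 2 fun p => starRingEnd ℂ (u p)) v
  have h3 : ‖(WithLp.toLp 2 fun p => starRingEnd ℂ (u p) : EuclideanSpace ℂ n)‖ = ‖u‖ := by
    rw [EuclideanSpace.norm_eq, EuclideanSpace.norm_eq]
    simp
  have h4 : ‖u‖ ^ 2 ≤ C * (‖u‖ * ‖v‖) := by
    have h5 : ‖((‖u‖ ^ 2 : ℝ) : ℂ)‖ ≤ C * (‖u‖ * ‖v‖) := by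
      rw [h1]
      rw [h3] at h2
      exact h2
    rwa [Complex.norm_real, Real.norm_of_nonneg (by positivity)] at h5
  by_cases h0 : ‖u‖ = 0
  · rw [h0]; positivity
  · have : 0 < ‖u‖ := lt_of_le_of_ne (norm_nonneg _) (Ne.symm h0)
    nlinarith

theorem sum_sum_mul_apply {E : Type*} [NormedAddCommGroup E] [NormedSpace ℂ E]
    (ω : StrongDual ℂ E) {k : ℕ} (x : Matrix (Fin k) (Fin k) E)
    (w v : EuclideanSpace ℂ (Fin k × Fin 1)) :
    ∑ p, ∑ q, (w p * v q) * (Matrix.of fun a b : Fin k × Fin 1 => ω (x a.1 b.1)) p q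
      = ω (∑ p, ∑ q, (w (p, 0) * v (q, 0)) • x p q) := by
  simp_rw [map_sum, map_smul, Fintype.sum_prod_type, Matrix.of_apply, Fin.sum_univ_one]
  rfl

theorem norm_toLp_eq {k : ℕ} (z : EuclideanSpace ℂ (Fin k × Fin 1)) :
    ‖(WithLp.toLp 2 fun p => z (p, 0) : EuclideanSpace ℂ (Fin k))‖ = ‖z‖ := by
  rw [EuclideanSpace.norm_eq, EuclideanSpace.norm_eq, Fintype.sum_prod_type]
  simp

theorem norm_sum_smul_twistedVN_le {k : ℕ} (x : Matrix (Fin k) (Fin k) (TwistedVN μ σ))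
    (hx : vnMatrixNorm μ σ x ≤ 1) (w v : EuclideanSpace ℂ (Fin k)) :
    ‖∑ p, ∑ q, (w p * v q) • x p q‖ ≤ ‖w‖ * ‖v‖ := by
  have h2 := norm_sum_smul_le (Matrix.of fun p q => (x p q : Lp ℂ 2 μ →L[ℂ] Lp ℂ 2 μ)) hx w v
  have h3 : ((∑ p, ∑ q, (w p * v q) • x p q : TwistedVN μ σ) : Lp ℂ 2 μ →L[ℂ] Lp ℂ 2 μ)
      = ∑ p, ∑ q, (w p * v q) • (x p q : Lp ℂ 2 μ →L[ℂ] Lp ℂ 2 μ) := by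
    push_cast
    rfl
  exact (congrArg norm h3).trans_le h2

/-- Bounded functionals are automatically completely bounded with the same norm: testing `[ψ(x_pq)]`
against scalar vectors evaluates `ψ` at a combination of the `x_pq` of norm at most `‖w‖ ‖v‖`. -/
theorem fourierMatrixNorm_single_le (ψ : twistedFourier μ σ) :
    fourierMatrixNorm μ σ (Matrix.of fun _ _ : Fin 1 => ψ) ≤ ENNReal.ofReal ‖ψ‖ := by
  refine fourierMatrixNorm_le μ _ _ fun k x hx => ?_
  rw [← ofReal_norm]
  refine ENNReal.ofReal_le_ofReal (norm_toEuclideanCLM_le _ (norm_nonneg ψ) fun w v => ?_)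
  refine (congrArg norm (sum_sum_mul_apply (ψ : StrongDual ℂ (TwistedVN μ σ)) x w v)).trans_le ?_
  rw [← norm_toLp_eq w, ← norm_toLp_eq v]
  exact (ContinuousLinearMap.le_opNorm _ _).trans (mul_le_mul_of_nonneg_left
    (norm_sum_smul_twistedVN_le μ x hx (WithLp.toLp 2 fun p => w (p, 0))
      (WithLp.toLp 2 fun p => v (p, 0))) (norm_nonneg _))

theorem norm_apply_le_norm_toEuclideanCLM {n : Type*} [Fintype n] [DecidableEq n]
    (M : Matrix n n ℂ) (a b : n) : ‖M a b‖ ≤ ‖Matrix.toEuclideanCLM (n := n) (𝕜 := ℂ) M‖ := by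
  have h3 := (Matrix.toEuclideanCLM (n := n) (𝕜 := ℂ) M).le_opNorm (EuclideanSpace.single b (1 : ℂ))
  have h4 := (PiLp.norm_apply_le _ a).trans h3
  have h5 : Matrix.toEuclideanCLM (n := n) (𝕜 := ℂ) M (EuclideanSpace.single b (1 : ℂ)) a
      = M a b := by
    have h6 : Matrix.toEuclideanCLM (n := n) (𝕜 := ℂ) M (EuclideanSpace.single b (1 : ℂ)) a
      = ∑ q, M a q * EuclideanSpace.single b (1 : ℂ) q := rfl
    rw [h6]
    simp
  rw [h5] at h4
  simpa using h4

theorem vnMatrixNorm_single_le (x : TwistedVN μ σ) :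
    vnMatrixNorm μ σ (Matrix.of fun _ _ : Fin 1 => x) ≤ ‖x‖ := by
  refine norm_matrixOperator_le _ (norm_nonneg x) fun v => ?_
  simp only [Fin.sum_univ_one]
  rw [← mul_pow]
  refine pow_le_pow_left₀ (norm_nonneg _) ?_ 2
  exact ContinuousLinearMap.le_opNorm (x : Lp ℂ 2 μ →L[ℂ] Lp ℂ 2 μ) _

theorem norm_le_of_fourierMatrixNorm_single_le (ψ : twistedFourier μ σ) {C : ℝ} (hC : 0 ≤ C)
    (h : fourierMatrixNorm μ σ (Matrix.of fun _ _ : Fin 1 => ψ) ≤ ENNReal.ofReal C) :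
    ‖ψ‖ ≤ C := by
  refine ContinuousLinearMap.opNorm_le_of_unit_norm hC fun x hx => ?_
  have h2 := (enorm_le_fourierMatrixNorm μ _ _ ((vnMatrixNorm_single_le μ x).trans hx.le)).trans h
  rw [← ofReal_norm, ENNReal.ofReal_le_ofReal_iff hC] at h2
  exact (norm_apply_le_norm_toEuclideanCLM _ ((0 : Fin 1), (0 : Fin 1)) (0, 0)).trans h2

theorem exists_continuousLinearMap_of_bound_of_le_one {E F : Type*} [NormedAddCommGroup E]
    [NormedSpace ℂ E] [NormedAddCommGroup F] [NormedSpace ℂ F] (T : E →ₗ[ℂ] F) {C : ℝ}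
    (h : ∀ ψ, ‖ψ‖ ≤ 1 → ‖T ψ‖ ≤ C) : ∃ S : E →L[ℂ] F, (S : E →ₗ[ℂ] F) = T := by
  refine ⟨T.mkContinuous C fun ψ => ?_, rfl⟩
  by_cases h0 : ψ = 0
  · rw [h0]; simp
  have hpos : 0 < ‖ψ‖ := norm_pos_iff.2 h0
  have h2 := h (((‖ψ‖⁻¹ : ℝ) : ℂ) • ψ) (by
    rw [norm_smul, Complex.norm_real, norm_inv, norm_norm, inv_mul_cancel₀ hpos.ne'])
  rw [map_smul, norm_smul, Complex.norm_real, norm_inv, norm_norm, inv_mul_le_iff₀ hpos] at h2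
  linarith

/-- Matrices of size one already give boundedness, because the matrix norm of a single element
agrees with its norm in both directions. -/
theorem cbMultiplierSpace_subset_multiplierSpace :
    cbMultiplierSpace μ τ σ ⊆ multiplierSpace μ τ σ := by
  rintro φ ⟨T, hT, hcb⟩
  obtain ⟨C, hC0, hC⟩ : ∃ C : ℝ, 0 ≤ C ∧ fourierCbNorm μ T = ENNReal.ofReal C :=
    ⟨_, ENNReal.toReal_nonneg, (ENNReal.ofReal_toReal hcb.ne).symm⟩
  obtain ⟨S, hS⟩ := exists_continuousLinearMap_of_bound_of_le_one (E := twistedFourier μ τ)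
    (F := twistedFourier μ σ) T (C := C) fun ψ hψ => by
    have h1 : ENNReal.ofReal ‖ψ‖ ≤ 1 := ENNReal.ofReal_le_one.2 hψ
    have h2 := (fourierMatrixNorm_single_le μ ψ).trans h1
    exact norm_le_of_fourierMatrixNorm_single_le μ _ hC0
      ((fourierMatrixNorm_le_fourierCbNorm μ T _ h2).trans hC.le)
  exact ⟨S, by rwa [hS]⟩

end OperatorSpace

/-! ### Coefficients are completely bounded multipliers -/

section FourierStieltjes

variable {G : Type u} [Group G] [TopologicalSpace G] [IsTopologicalGroup G] [T2Space G]
  [LocallyCompactSpace G] [MeasurableSpace G] [BorelSpace G] (μ : Measure G) [μ.IsHaarMeasure]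
  [μ.Regular]

theorem twistedFourierStieltjes_subset_cbMultiplierSpace (σ : ContinuousTwoCocycle G) :
    twistedFourierStieltjes σ ⊆ cbMultiplierSpace μ 1 σ := by
  rintro φ ⟨H, _, _, _, π, ξ, η, rfl⟩
  obtain ⟨w, b, -⟩ := exists_hilbertBasis ℂ H
  have hπ := π.continuous_orbit μ
  refine ⟨π.fellPredual μ hπ b ξ η, π.isMultiplicationBy_fellPredual μ hπ b ξ η, ?_⟩
  refine (fourierCbNorm_le_of_predual μ (π.fellMapVN μ hπ b ξ η) (fun _ _ => rfl)
    -- The summand 1 only makes the constant strictly positive.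
    (C := ‖π.fellColumn μ hπ b.orthonormal ξ‖ * ‖π.fellColumn μ hπ b.orthonormal η‖ + 1)
    (by positivity) fun k x => ?_).trans_lt ENNReal.ofReal_lt_top
  refine (norm_matrixOperator_compress_le _ _ _).trans ?_
  exact mul_le_mul_of_nonneg_right (by linarith) (norm_nonneg _)

end FourierStieltjes

/-! ### Integrated contractions and topological invariance -/

section IntegratedForm

open Set Filter Topology
open scoped CompactlySupported Pointwise

variable {G : Type u} [Group G] [TopologicalSpace G] [IsTopologicalGroup G]
  [MeasurableSpace G] [BorelSpace G] [T2Space G] [LocallyCompactSpace G]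
  (μ : Measure G) [μ.IsHaarMeasure] [μ.Regular]

theorem integrable_norm_cc (f : C_c(G, ℂ)) : Integrable (fun t => ‖f t‖) μ :=
  f.continuous.norm.integrable_of_hasCompactSupport f.hasCompactSupport.norm

theorem tendsto_integral_norm_twistedTranslate_sub (σ : ContinuousTwoCocycle G) (f : C_c(G, ℂ)) :
    Tendsto (fun s => ∫ t, ‖twistedTranslate σ s f t - f t‖ ∂μ) (𝓝 1) (𝓝 0) := by
  obtain ⟨K, hK, h⟩ := exists_isCompact_norm_twistedTranslate_sub_le σ f
  refine Metric.tendsto_nhds.2 fun ε hε => ?_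
  have hδ : 0 < ε / (μ.real K + 1) := by positivity
  filter_upwards [h _ hδ] with s hs
  rw [dist_zero_right, ← setIntegral_eq_integral_of_forall_compl_eq_zero fun t ht => by
    rw [hs.2 t ht, norm_zero]]
  have h1 := norm_setIntegral_le_of_norm_le_const (μ := μ) (s := K)
    (f := fun t => ‖twistedTranslate σ s f t - f t‖) hK.measure_lt_top
    (C := ε / (μ.real K + 1)) fun t _ => by
      rw [norm_norm]
      exact hs.1 t
  refine h1.trans_lt ?_
  rw [div_mul_eq_mul_div, div_lt_iff₀ (by positivity)]
  nlinarith [measureReal_nonneg (μ := μ) (s := K)]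

theorem twistedTranslate_trivial_apply (s : G) (f : C_c(G, ℂ)) (t : G) :
    twistedTranslate 1 s f t = f (s⁻¹ * t) := by
  rw [twistedTranslate_apply]
  change ((1 : Circle) : ℂ) * _ = _
  rw [Circle.coe_one, one_mul]

theorem tendsto_integral_norm_translate_sub (f : C_c(G, ℂ)) (s₀ : G) :
    Tendsto (fun s => ∫ t, ‖twistedTranslate 1 s f t - twistedTranslate 1 s₀ f t‖ ∂μ)
      (𝓝 s₀) (𝓝 0) := by
  have h1 : ∀ s, ∫ t, ‖twistedTranslate 1 s f t - twistedTranslate 1 s₀ f t‖ ∂μ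
      = ∫ t, ‖twistedTranslate 1 (s₀⁻¹ * s) f t - f t‖ ∂μ := fun s => by
    rw [← integral_mul_left_eq_self
      (fun t => ‖twistedTranslate 1 s f t - twistedTranslate 1 s₀ f t‖) s₀]
    refine integral_congr_ae (.of_forall fun t => ?_)
    simp only [twistedTranslate_trivial_apply]
    rw [inv_mul_cancel_left, mul_inv_rev, inv_inv, mul_assoc]
  simp_rw [h1]
  refine (tendsto_integral_norm_twistedTranslate_sub μ 1 f).comp ?_
  have : Continuous fun s => s₀⁻¹ * s := continuous_const.mul continuous_id
  simpa using this.tendsto s₀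

variable {E : Type*} [NormedAddCommGroup E] [NormedSpace ℂ E]

/-- `∫ f(r) T(r) dr` for a strongly continuous family of contractions. -/
def intOp (T : G → E →L[ℂ] E) (hc : ∀ x, Continuous fun r => T r x) (h1 : ∀ r x, ‖T r x‖ ≤ ‖x‖)
    (f : C_c(G, ℂ)) : E →L[ℂ] E :=
  LinearMap.mkContinuous
    { toFun := fun x => ∫ r, f r • T r x ∂μ
      map_add' := fun x y => by
        rw [← integral_add (integrable_cc μ f (hc x)) (integrable_cc μ f (hc y))]
        simp only [map_add, smul_add]
      map_smul' := fun c x => by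
        rw [RingHom.id_apply, ← integral_smul]
        simp only [map_smul, smul_comm c] }
    (∫ s, ‖f s‖ ∂μ) fun x => by
      refine (norm_integral_le_integral_norm _).trans ?_
      rw [← integral_mul_const]
      refine integral_mono (integrable_cc μ f (hc x)).norm
        ((integrable_norm_cc μ f).mul_const _) fun r => ?_
      simp only [norm_smul]
      exact mul_le_mul_of_nonneg_left (h1 r x) (norm_nonneg _)

variable (T : G → E →L[ℂ] E) (hc : ∀ x, Continuous fun r => T r x) (h1 : ∀ r x, ‖T r x‖ ≤ ‖x‖)

theorem intOp_apply (f : C_c(G, ℂ)) (x : E) : intOp μ T hc h1 f x = ∫ r, f r • T r x ∂μ := rfl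

theorem norm_intOp_le (f : C_c(G, ℂ)) : ‖intOp μ T hc h1 f‖ ≤ ∫ s, ‖f s‖ ∂μ :=
  LinearMap.mkContinuous_norm_le _ (integral_nonneg fun _ => norm_nonneg _) _

theorem intOp_sub (f g : C_c(G, ℂ)) :
    intOp μ T hc h1 (f - g) = intOp μ T hc h1 f - intOp μ T hc h1 g := by
  ext1 x
  rw [sub_apply, intOp_apply, intOp_apply, intOp_apply,
    ← integral_sub (integrable_cc μ f (hc x)) (integrable_cc μ g (hc x))]
  simp only [CompactlySupportedContinuousMap.sub_apply, sub_smul]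

theorem continuous_intOp_translate (f : C_c(G, ℂ)) :
    Continuous fun s => intOp μ T hc h1 (twistedTranslate 1 s f) := by
  refine continuous_iff_continuousAt.2 fun s₀ => tendsto_iff_norm_sub_tendsto_zero.2 ?_
  refine squeeze_zero (fun _ => norm_nonneg _) (fun s => ?_)
    (tendsto_integral_norm_translate_sub μ f s₀)
  rw [← intOp_sub]
  exact norm_intOp_le μ T hc h1 _

variable [CompleteSpace E]

theorem map_intOp (hmul : ∀ s t x, T s (T t x) = T (s * t) x) (s : G) (f : C_c(G, ℂ)) (x : E) :
    T s (intOp μ T hc h1 f x) = intOp μ T hc h1 (twistedTranslate 1 s f) x := by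
  rw [intOp_apply, intOp_apply, ← ContinuousLinearMap.integral_comp_comm _ (integrable_cc μ f (hc x)),
    ← integral_mul_left_eq_self (fun t => twistedTranslate 1 s f t • T t x) s]
  refine integral_congr_ae (.of_forall fun t => ?_)
  simp only
  rw [map_smul, hmul, twistedTranslate_trivial_apply, inv_mul_cancel_left]

/-- The substitution `r ↦ s * r` moves the group element onto `g`. Integrating `T r⁻¹` rather than
`T r` makes this a left translation, so no modular function enters. -/
theorem intOp_inv_map (hmul : ∀ s t x, T s (T t x) = T (s * t) x) (s : G) (g : C_c(G, ℂ)) :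
    intOp μ (fun r => T r⁻¹) (fun x => (hc x).comp continuous_inv) (fun r => h1 r⁻¹) g ∘L T s
      = intOp μ (fun r => T r⁻¹) (fun x => (hc x).comp continuous_inv) (fun r => h1 r⁻¹)
        (twistedTranslate 1 s⁻¹ g) := by
  ext1 x
  rw [ContinuousLinearMap.comp_apply, intOp_apply, intOp_apply,
    ← integral_mul_left_eq_self (fun r => g r • T r⁻¹ (T s x)) s]
  refine integral_congr_ae (.of_forall fun t => ?_)
  simp only
  rw [hmul, twistedTranslate_trivial_apply, inv_inv, mul_inv_rev, inv_mul_cancel_right]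

/-- `x ↦ T x` is assumed only strongly continuous, but composing on the left with a smoothing
operator makes it norm continuous by `intOp_inv_map`. The integral thus exists in operator norm, and
functionals on operators can be taken inside it. -/
theorem intOp_inv_comp_intOp (hmul : ∀ s t x, T s (T t x) = T (s * t) x) (f g : C_c(G, ℂ)) :
    intOp μ (fun r => T r⁻¹) (fun x => (hc x).comp continuous_inv) (fun r => h1 r⁻¹) g ∘L
      intOp μ T hc h1 f = ∫ x, f x • (intOp μ (fun r => T r⁻¹)
        (fun x => (hc x).comp continuous_inv) (fun r => h1 r⁻¹) g ∘L T x) ∂μ := by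
  have hcont : Continuous fun x => intOp μ (fun r => T r⁻¹)
        (fun x => (hc x).comp continuous_inv) (fun r => h1 r⁻¹) g ∘L T x := by
    simp_rw [intOp_inv_map μ T hc h1 hmul]
    exact (continuous_intOp_translate μ (fun r => T r⁻¹) (fun x => (hc x).comp continuous_inv)
      (fun r => h1 r⁻¹) g).comp continuous_inv
  ext1 e
  rw [ContinuousLinearMap.integral_apply (integrable_cc μ f hcont), ContinuousLinearMap.comp_apply,
    intOp_apply μ T hc h1 f, ← ContinuousLinearMap.integral_comp_comm _ (integrable_cc μ f (hc e))]
  refine integral_congr_ae (.of_forall fun t => ?_)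
  simp only
  rw [map_smul]
  rfl

/-- The difference is an average over the support of `g` of `T r⁻¹` minus the identity on the range
of the integrated operator, where `T r⁻¹` just translates `f`. -/
theorem norm_intOp_inv_comp_sub_le (hmul : ∀ s t x, T s (T t x) = T (s * t) x) (f g : C_c(G, ℂ))
    (hg : ∫ r, g r ∂μ = 1) (hg' : ∫ r, ‖g r‖ ∂μ = 1) {ε : ℝ} (hε : 0 ≤ ε)
    (h : ∀ r, g r ≠ 0 → ∫ t, ‖twistedTranslate 1 r⁻¹ f t - f t‖ ∂μ ≤ ε) :
    ‖intOp μ (fun r => T r⁻¹) (fun x => (hc x).comp continuous_inv) (fun r => h1 r⁻¹) g ∘L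
      intOp μ T hc h1 f - intOp μ T hc h1 f‖ ≤ ε := by
  refine ContinuousLinearMap.opNorm_le_bound _ hε fun e => ?_
  set y := intOp μ T hc h1 f e with hy
  have h2 : (intOp μ (fun r => T r⁻¹) (fun x => (hc x).comp continuous_inv) (fun r => h1 r⁻¹) g ∘L
      intOp μ T hc h1 f - intOp μ T hc h1 f) e = ∫ r, g r • (T r⁻¹ y - y) ∂μ := by
    have hy' : Continuous fun r => T r⁻¹ y := (hc y).comp continuous_inv
    simp only [smul_sub]
    rw [integral_sub (integrable_cc μ g hy') (integrable_cc μ g (continuous_const (y := y))),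
      integral_smul_const, hg, one_smul]
    rfl
  rw [h2]
  calc ‖∫ r, g r • (T r⁻¹ y - y) ∂μ‖ ≤ ∫ r, ‖g r‖ * (ε * ‖e‖) ∂μ := by
        refine norm_integral_le_of_norm_le ((integrable_norm_cc μ g).mul_const _)
          (.of_forall fun r => ?_)
        rw [norm_smul]
        by_cases hr : g r = 0
        · rw [hr, norm_zero, zero_mul, zero_mul]
        refine mul_le_mul_of_nonneg_left ?_ (norm_nonneg _)
        rw [hy, map_intOp μ T hc h1 hmul, ← sub_apply, ← intOp_sub]
        exact ContinuousLinearMap.le_of_opNorm_le _ ((norm_intOp_le μ T hc h1 _).trans (h r hr)) e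
    _ = ε * ‖e‖ := by rw [integral_mul_const, hg', one_mul]

/-- Approximate identities in `C_c(G)`. -/
theorem exists_cc_bump {U : Set G} (hU : U ∈ 𝓝 (1 : G)) :
    ∃ g : C_c(G, ℂ), ∫ r, g r ∂μ = 1 ∧ ∫ r, ‖g r‖ ∂μ = 1 ∧ ∀ r, g r ≠ 0 → r ∈ U := by
  obtain ⟨V, hVU, hVo, hV1⟩ := mem_nhds_iff.1 hU
  obtain ⟨k, hk1, hk0, hkc, hk01⟩ := exists_continuous_one_zero_of_isCompact
    (isCompact_singleton (x := (1 : G))) hVo.isClosed_compl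
    (disjoint_singleton_left.2 fun h => h hV1)
  have hpos : 0 < ∫ r, k r ∂μ := by
    refine k.continuous.integral_pos_of_hasCompactSupport_nonneg_nonzero hkc
      (fun r => (hk01 r).1) (x := 1) ?_
    rw [hk1 (mem_singleton _)]
    exact one_ne_zero
  set c := ∫ r, k r ∂μ
  let g : C_c(G, ℂ) :=
    { toFun := fun r => ((c⁻¹ * k r : ℝ) : ℂ)
      continuous_toFun := by fun_prop
      hasCompactSupport' := by
        refine hkc.mono fun r hr => ?_
        contrapose! hr
        simp [Function.notMem_support.1 hr] }
  have hg : ∀ r, g r = ((c⁻¹ * k r : ℝ) : ℂ) := fun r => rfl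
  refine ⟨g, ?_, ?_, fun r hr => ?_⟩
  · simp_rw [hg]
    rw [integral_complex_ofReal, integral_const_mul, inv_mul_cancel₀ hpos.ne', Complex.ofReal_one]
  · simp_rw [hg, Complex.norm_real]
    have : ∀ r, ‖c⁻¹ * k r‖ = c⁻¹ * k r := fun r =>
      Real.norm_of_nonneg (mul_nonneg (inv_nonneg.2 hpos.le) (hk01 r).1)
    simp_rw [this]
    rw [integral_const_mul, inv_mul_cancel₀ hpos.ne']
  · by_contra hrU
    refine hr ?_
    rw [hg, hk0 fun h => hrU (hVU h)]
    simp

/-- A translation invariant functional on the dual is topologically invariant. -/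
theorem apply_comp_intOp_translate (hmul : ∀ s t x, T s (T t x) = T (s * t) x)
    (ω : StrongDual ℂ (StrongDual ℂ E)) (hω : ∀ h s, ω (h ∘L T s) = ω h) (h : StrongDual ℂ E)
    (f : C_c(G, ℂ)) (s : G) :
    ω (h ∘L intOp μ T hc h1 (twistedTranslate 1 s f)) = ω (h ∘L intOp μ T hc h1 f) := by
  let P : (E →L[ℂ] E) →L[ℂ] ℂ := ω ∘L (ContinuousLinearMap.compL ℂ E E ℂ h)
  have hP : ∀ A, P A = ω (h ∘L A) := fun A => rfl
  let S : C_c(G, ℂ) → E →L[ℂ] E := fun g =>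
    intOp μ (fun r => T r⁻¹) (fun x => (hc x).comp continuous_inv) (fun r => h1 r⁻¹) g
  -- Invariance of `ω` makes the integrand constant apart from `f`. The value thus depends on `f`
  -- only through `∫ f`, which translation preserves; letting `g` concentrate at 1 removes `S g`.
  have key : ∀ f g : C_c(G, ℂ), P (S g ∘L intOp μ T hc h1 f) = (∫ x, f x ∂μ) * P (S g) := by
    intro f g
    have hcont : Continuous fun x => S g ∘L T x := by
      simp_rw [S, intOp_inv_map μ T hc h1 hmul]
      exact (continuous_intOp_translate μ (fun r => T r⁻¹) (fun x => (hc x).comp continuous_inv)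
      (fun r => h1 r⁻¹) g).comp continuous_inv
    simp only [S]
    rw [intOp_inv_comp_intOp μ T hc h1 hmul,
      ← ContinuousLinearMap.integral_comp_comm _ (integrable_cc μ f hcont), ← integral_mul_const]
    refine integral_congr_ae (.of_forall fun t => ?_)
    simp only
    rw [map_smul, smul_eq_mul, hP, hP, ← ContinuousLinearMap.comp_assoc, hω]
  have hint : ∫ x, twistedTranslate 1 s f x ∂μ = ∫ x, f x ∂μ := by
    simp_rw [twistedTranslate_trivial_apply]
    exact integral_mul_left_eq_self f s⁻¹
  have hsmall : ∀ ε > 0, ‖P (intOp μ T hc h1 (twistedTranslate 1 s f)) - P (intOp μ T hc h1 f)‖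
      ≤ ‖P‖ * ε + ‖P‖ * ε := by
    intro ε hε
    have hU : ∀ f : C_c(G, ℂ), ∀ᶠ r in 𝓝 (1 : G),
        ∫ t, ‖twistedTranslate 1 r⁻¹ f t - f t‖ ∂μ ≤ ε := fun f => by
      have h2 : Tendsto (fun r : G => r⁻¹) (𝓝 1) (𝓝 1) := by
        simpa using (continuous_inv (G := G)).tendsto 1
      exact (((tendsto_integral_norm_twistedTranslate_sub μ 1 f).comp h2).eventually_lt_const
        hε).mono fun r hr => le_of_lt hr
    obtain ⟨g, hg1, hg2, hg3⟩ := exists_cc_bump μ ((hU f).and (hU (twistedTranslate 1 s f)))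
    have e1 := norm_intOp_inv_comp_sub_le μ T hc h1 hmul f g hg1 hg2 hε.le fun r hr => (hg3 r hr).1
    have e2 := norm_intOp_inv_comp_sub_le μ T hc h1 hmul (twistedTranslate 1 s f) g hg1 hg2 hε.le
      fun r hr => (hg3 r hr).2
    have e3 := (P.le_opNorm _).trans (mul_le_mul_of_nonneg_left e1 (norm_nonneg P))
    have e4 := (P.le_opNorm _).trans (mul_le_mul_of_nonneg_left e2 (norm_nonneg P))
    rw [map_sub] at e3 e4
    have k1 := key f g
    have k2 := key (twistedTranslate 1 s f) g
    rw [hint, ← k1] at k2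
    simp only [S] at k2
    rw [k2] at e4
    rw [norm_sub_rev] at e4
    refine (norm_sub_le_norm_sub_add_norm_sub _ _ _).trans (add_le_add e4 e3)
  have hzero : ‖P (intOp μ T hc h1 (twistedTranslate 1 s f)) - P (intOp μ T hc h1 f)‖ ≤ 0 := by
    refine le_of_forall_pos_le_add fun δ hδ => ?_
    refine (hsmall (δ / (2 * (‖P‖ + 1))) (by positivity)).trans ?_
    rw [← mul_add, zero_add]
    calc ‖P‖ * (δ / (2 * (‖P‖ + 1)) + δ / (2 * (‖P‖ + 1))) = ‖P‖ / (‖P‖ + 1) * δ := by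
          field_simp; ring
      _ ≤ 1 * δ := by
          refine mul_le_mul_of_nonneg_right ?_ hδ.le
          rw [div_le_one (by positivity)]
          linarith
      _ = δ := one_mul _
  exact sub_eq_zero.1 (norm_le_zero_iff.1 hzero)

end IntegratedForm

/-! ### From functionals on the dual to vectors -/

section HahnBanach

open Set Filter Topology

variable {E W : Type*} [NormedAddCommGroup E] [NormedSpace ℂ E] [NormedAddCommGroup W]
  [NormedSpace ℂ W]

/-- A functional separating `w` from the image of the ball would violate `h`; unimodular multiples
stay in the ball, which turns the bound on real parts into a bound on norms. -/
theorem mem_closure_image_closedBall (L : E →L[ℂ] W) {w : W} {R : ℝ} (hR : 0 < R)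
    (h : ∀ Λ : StrongDual ℂ W, ‖Λ w‖ ≤ R * ‖Λ ∘L L‖) : w ∈ closure (L '' Metric.closedBall 0 R) := by
  by_contra hw
  have hconv : Convex ℝ (closure (L '' Metric.closedBall 0 R)) :=
    ((convex_closedBall (0 : E) R).linear_image (L.restrictScalars ℝ : E →ₗ[ℝ] W)).closure
  obtain ⟨Λ, u, h1, h2⟩ := RCLike.geometric_hahn_banach_closed_point (𝕜 := ℂ) hconv isClosed_closure
    hw
  have h3 : ∀ x : E, ‖x‖ ≤ R → ‖Λ (L x)‖ ≤ u := fun x hx => by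
    obtain ⟨c, hc1, hc⟩ := RCLike.exists_norm_eq_mul_self (Λ (L x))
    have h4 := h1 (L (c • x)) (subset_closure ⟨c • x, by
      rw [mem_closedBall_zero_iff, norm_smul, hc1, one_mul]; exact hx, rfl⟩)
    rw [map_smul, map_smul, smul_eq_mul, ← hc] at h4
    simpa using h4.le
  have hu : 0 ≤ u := (norm_nonneg _).trans (h3 0 (by simpa using hR.le))
  have h5 : ‖Λ ∘L L‖ ≤ u / R := by
    refine ContinuousLinearMap.opNorm_le_of_unit_norm (by positivity) fun x hx => ?_
    have h6 := h3 ((R : ℂ) • x) (by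
      rw [norm_smul, hx, Complex.norm_real, Real.norm_of_nonneg hR.le, mul_one])
    rw [map_smul, map_smul, norm_smul, Complex.norm_real, Real.norm_of_nonneg hR.le] at h6
    rw [le_div_iff₀ hR, mul_comm]
    exact h6
  have h7 := (h Λ).trans (mul_le_mul_of_nonneg_left h5 hR.le)
  rw [mul_div_cancel₀ _ hR.ne'] at h7
  exact absurd (h2.trans_le (Complex.re_le_norm _)) (not_lt.2 h7)

/-- A functional `ω` on the dual of `E` can be approximated by elements of a ball of `E`, so that the
operators `A` in a finite family are almost annihilated when `ω` annihilates their adjoints. -/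
theorem exists_norm_lt_of_bidual {κ : Type*} (ω : StrongDual ℂ (StrongDual ℂ E))
    (I : StrongDual ℂ E) (hI : ω I = 1) (F : Finset κ) (A : κ → E →L[ℂ] E)
    (hA : ∀ k ∈ F, ∀ h : StrongDual ℂ E, ω (h ∘L A k) = 0) {ε : ℝ} (hε : 0 < ε) :
    ∃ p : E, ‖p‖ ≤ ‖ω‖ + 1 ∧ ‖I p - 1‖ < ε ∧ ∀ k ∈ F, ‖A k p‖ < ε := by
  classical
  let L : E →L[ℂ] ℂ × (F → E) := I.prod (ContinuousLinearMap.pi fun k : F => A k)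
  -- Day's convexity trick: all conditions on `p` are collected in one map `L`, and `ω (Λ ∘L L) = Λ
  -- (1, 0)` supplies the norm bound needed for separation.
  have hmem : ((1, 0) : ℂ × (F → E)) ∈ closure (L '' Metric.closedBall 0 (‖ω‖ + 1)) := by
    refine mem_closure_image_closedBall L (by positivity) fun Λ => ?_
    have h1 : Λ ∘L L = Λ (1, 0) • I + ∑ k : F,
        ((Λ ∘L ContinuousLinearMap.inr ℂ ℂ (F → E)) ∘L
          ContinuousLinearMap.single ℂ (fun _ : F => E) k) ∘L A k := by
      ext1 p
      have h2 : L p = I p • ((1, 0) : ℂ × (F → E)) + ∑ k : F, ((0, Pi.single k (A k p)) : ℂ × (F → E)) := by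
        refine Prod.ext ?_ ?_
        · simp [L, Prod.fst_sum]
        · simp only [Prod.snd_add, Prod.smul_snd, smul_zero, zero_add, Prod.snd_sum]
          rw [Finset.univ_sum_single fun k : F => A k p]
          rfl
      rw [ContinuousLinearMap.comp_apply, h2, map_add, map_smul, map_sum, add_apply, smul_apply,
        sum_apply, smul_eq_mul, smul_eq_mul, mul_comm]
      rfl
    have h3 : ω (Λ ∘L L) = Λ (1, 0) := by
      rw [h1, map_add, map_smul, hI, map_sum, Finset.sum_eq_zero fun (k : F) _ => hA k k.2 _, add_zero,
        smul_eq_mul, mul_one]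
    rw [← h3]
    exact (ω.le_opNorm _).trans (mul_le_mul_of_nonneg_right (by linarith) (norm_nonneg _))
  obtain ⟨_, ⟨p, hp, rfl⟩, hd⟩ := Metric.mem_closure_iff.1 hmem ε hε
  rw [dist_comm, dist_eq_norm] at hd
  refine ⟨p, mem_closedBall_zero_iff.1 hp, (norm_fst_le _).trans_lt hd, fun k hk => ?_⟩
  have h4 := (norm_le_pi_norm _ (⟨k, hk⟩ : F)).trans_lt ((norm_snd_le _).trans_lt hd)
  simpa [L] using h4

end HahnBanach

/-! ### Reiter's property and weak containment of the trivial representation -/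

section Amenable

open Set Filter Topology
open scoped CompactlySupported Pointwise

variable {G : Type u} [Group G] [TopologicalSpace G] [IsTopologicalGroup G]
  [MeasurableSpace G] [BorelSpace G] [T2Space G] [LocallyCompactSpace G]
  (μ : Measure G) [μ.IsHaarMeasure] [μ.Regular]

/-- Left translation on `L¹(G)`. -/
def translateL1 (s : G) : Lp ℂ 1 μ →L[ℂ] Lp ℂ 1 μ :=
  (Lp.compMeasurePreservingₗᵢ ℂ (fun t => s⁻¹ * t)
    (measurePreserving_mul_left μ s⁻¹)).toContinuousLinearMap

theorem coeFn_translateL1 (s : G) (p : Lp ℂ 1 μ) : translateL1 μ s p =ᵐ[μ] fun t => p (s⁻¹ * t) :=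
  Lp.coeFn_compMeasurePreserving p (measurePreserving_mul_left μ s⁻¹)

theorem norm_translateL1 (s : G) (p : Lp ℂ 1 μ) : ‖translateL1 μ s p‖ = ‖p‖ :=
  Lp.norm_compMeasurePreserving p (measurePreserving_mul_left μ s⁻¹)

theorem translateL1_translateL1 (s t : G) (p : Lp ℂ 1 μ) :
    translateL1 μ s (translateL1 μ t p) = translateL1 μ (s * t) p := by
  refine Lp.ext ?_
  filter_upwards [coeFn_translateL1 μ s (translateL1 μ t p), coeFn_translateL1 μ (s * t) p,
    (measurePreserving_mul_left μ s⁻¹).quasiMeasurePreserving.ae (coeFn_translateL1 μ t p)]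
    with r h1 h2 h3
  rw [h1, h2, h3, mul_inv_rev, mul_assoc]

theorem continuous_translateL1 (p : Lp ℂ 1 μ) : Continuous fun s => translateL1 μ s p := by
  let g : C(G, C(G, G)) := ContinuousMap.curry ⟨fun q : G × G => q.1⁻¹ * q.2, by fun_prop⟩
  exact Continuous.compMeasurePreservingLp (E := ℂ) (p := 1) (μ := μ) (ν := μ)
    (f := fun _ : G => p) (g := g) continuous_const g.continuous
    (fun s => measurePreserving_mul_left μ s⁻¹) ENNReal.one_ne_top

/-- The integral as a functional on `L¹(G)`. -/
def integralL1 : StrongDual ℂ (Lp ℂ 1 μ) :=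
  LinearMap.mkContinuous
    { toFun := fun p => ∫ t, p t ∂μ
      map_add' := fun p q => by
        rw [← integral_add (L1.integrable_coeFn p) (L1.integrable_coeFn q)]
        exact integral_congr_ae (Lp.coeFn_add p q)
      map_smul' := fun c p => by
        rw [RingHom.id_apply, ← integral_smul]
        exact integral_congr_ae (Lp.coeFn_smul c p) }
    1 fun p => by
      rw [one_mul, L1.norm_eq_integral_norm]
      exact norm_integral_le_integral_norm _

theorem integralL1_apply (p : Lp ℂ 1 μ) : integralL1 μ p = ∫ t, p t ∂μ := rfl

theorem norm_integralL1_apply_le (p : Lp ℂ 1 μ) : ‖integralL1 μ p‖ ≤ ‖p‖ := by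
  rw [integralL1_apply, L1.norm_eq_integral_norm]
  exact norm_integral_le_integral_norm _

theorem integralL1_translateL1 (s : G) (p : Lp ℂ 1 μ) :
    integralL1 μ (translateL1 μ s p) = integralL1 μ p := by
  rw [integralL1_apply, integralL1_apply, integral_congr_ae (coeFn_translateL1 μ s p)]
  exact integral_mul_left_eq_self (fun t => p t) s⁻¹

theorem memLp_orbit (h : StrongDual ℂ (Lp ℂ 1 μ)) (e : Lp ℂ 1 μ) :
    MemLp (fun t => h (translateL1 μ t e)) ∞ μ :=
  memLp_top_of_bound (h.continuous.comp (continuous_translateL1 μ e)).aestronglyMeasurable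
    (‖h‖ * ‖e‖) (.of_forall fun t => by
      rw [← norm_translateL1 μ t e]
      exact h.le_opNorm _)

/-- The functional `h ↦ m(t ↦ ⟨h, λ(t)e⟩)` on `L¹(G)^*`. -/
def orbitMean (m : StrongDual ℂ (Lp ℂ ∞ μ)) (e : Lp ℂ 1 μ) :
    StrongDual ℂ (StrongDual ℂ (Lp ℂ 1 μ)) :=
  LinearMap.mkContinuous
    { toFun := fun h => m ((memLp_orbit μ h e).toLp)
      map_add' := fun h k => by
        rw [← map_add, ← MemLp.toLp_add]
        rfl
      map_smul' := fun c h => by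
        rw [RingHom.id_apply, ← map_smul, ← MemLp.toLp_const_smul]
        rfl }
    (‖m‖ * ‖e‖) fun h => by
      have h1 : ‖(memLp_orbit μ h e).toLp‖ ≤ ‖h‖ * ‖e‖ := by
        rw [Lp.norm_toLp]
        refine ENNReal.toReal_le_of_le_ofReal (by positivity) ?_
        rw [eLpNorm_exponent_top]
        refine eLpNormEssSup_le_of_ae_bound (.of_forall fun t => ?_)
        rw [← norm_translateL1 μ t e]
        exact h.le_opNorm _
      refine (m.le_opNorm _).trans ((mul_le_mul_of_nonneg_left h1 (norm_nonneg _)).trans_eq ?_)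
      ring

theorem orbitMean_apply (m : StrongDual ℂ (Lp ℂ ∞ μ)) (e : Lp ℂ 1 μ)
    (h : StrongDual ℂ (Lp ℂ 1 μ)) : orbitMean μ m e h = m ((memLp_orbit μ h e).toLp) := rfl

theorem orbitMean_comp_translateL1 {m : StrongDual ℂ (Lp ℂ ∞ μ)}
    (hm : ∀ s f, m (leftTranslateLinf μ s f) = m f) (e : Lp ℂ 1 μ)
    (h : StrongDual ℂ (Lp ℂ 1 μ)) (s : G) :
    orbitMean μ m e (h ∘L translateL1 μ s) = orbitMean μ m e h := by
  rw [orbitMean_apply, orbitMean_apply, ← hm s⁻¹ ((memLp_orbit μ h e).toLp)]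
  congr 1
  refine Lp.ext ?_
  have h1 : leftTranslateLinf μ s⁻¹ ((memLp_orbit μ h e).toLp) =ᵐ[μ]
      fun t => ((memLp_orbit μ h e).toLp : Lp ℂ ∞ μ) (s⁻¹⁻¹ * t) :=
    Lp.coeFn_compMeasurePreserving _ (measurePreserving_mul_left μ s⁻¹⁻¹)
  filter_upwards [h1, (memLp_orbit μ (h ∘L translateL1 μ s) e).coeFn_toLp,
    (measurePreserving_mul_left μ s⁻¹⁻¹).quasiMeasurePreserving.ae
      (memLp_orbit μ h e).coeFn_toLp] with t h2 h3 h4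
  rw [h2, h3, h4, ContinuousLinearMap.comp_apply, translateL1_translateL1, inv_inv]

/-- Reiter's property for `L¹`. -/
theorem exists_norm_translateL1_sub_le (hG : IsAmenableGroup μ) {K : Set G} (hK : IsCompact K)
    {δ : ℝ} (hδ : 0 < δ) :
    ∃ p : Lp ℂ 1 μ, 1 / 2 ≤ ‖p‖ ∧ ∀ s ∈ K, ‖translateL1 μ s p - p‖ ≤ δ := by
  obtain ⟨m, -, hm1, hm⟩ := hG
  obtain ⟨f, hf1, -, -⟩ := exists_cc_bump μ (univ_mem (f := 𝓝 (1 : G)))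
  have hfmem : MemLp f 1 μ := memLp_one_iff_integrable.2
    (f.continuous.integrable_of_hasCompactSupport f.hasCompactSupport)
  set e : Lp ℂ 1 μ := hfmem.toLp
  set ω := orbitMean μ m e with hω
  have hIe : integralL1 μ e = 1 := by
    rw [integralL1_apply, integral_congr_ae hfmem.coeFn_toLp, hf1]
  have hI : ω (integralL1 μ) = 1 := by
    rw [hω, orbitMean_apply, ← hm1]
    congr 1
    refine MemLp.toLp_congr _ _ (.of_forall fun t => ?_)
    simp only
    rw [integralL1_translateL1, hIe]
  have hnorm : ∀ s p, ‖translateL1 μ s p‖ ≤ ‖p‖ := fun s p => (norm_translateL1 μ s p).le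
  set A : C_c(G, ℂ) → Lp ℂ 1 μ →L[ℂ] Lp ℂ 1 μ :=
    intOp μ (translateL1 μ) (continuous_translateL1 μ) hnorm with hA
  have hcont : Continuous fun s => A (twistedTranslate 1 s f) :=
    continuous_intOp_translate μ (translateL1 μ) (continuous_translateL1 μ) hnorm f
  set N := ‖ω‖ + 1 with hN
  have hNpos : 0 < N := by positivity
  -- Norm continuity of `s ↦ A (twistedTranslate 1 s f)` reduces the compact set `K` to finitely
  -- many points.
  have hU : ∀ s₀ ∈ K, {s | ‖A (twistedTranslate 1 s f) - A (twistedTranslate 1 s₀ f)‖ < δ / (2 * N)}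
      ∈ 𝓝 s₀ := fun s₀ _ => by
    have h1 := Metric.tendsto_nhds.1 (hcont.tendsto s₀) (δ / (2 * N)) (by positivity)
    filter_upwards [h1] with s hs
    rwa [dist_eq_norm] at hs
  obtain ⟨F, -, hF⟩ := hK.elim_nhds_subcover _ hU
  obtain ⟨p, hp, hpI, hpF⟩ := exists_norm_lt_of_bidual ω (integralL1 μ) hI F
    (fun s => A (twistedTranslate 1 s f) - A f) (fun s _ h => by
      rw [ContinuousLinearMap.comp_sub, map_sub, sub_eq_zero]
      exact apply_comp_intOp_translate μ (translateL1 μ) (continuous_translateL1 μ) hnorm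
        (translateL1_translateL1 μ) ω (orbitMean_comp_translateL1 μ hm e) h f s)
    (ε := min (δ / 2) (1 / 2)) (by positivity)
  have hIp : integralL1 μ (A f p) = integralL1 μ p := by
    rw [hA, intOp_apply]
    refine ((integralL1 μ).integral_comp_comm
      (integrable_cc μ f (continuous_translateL1 μ p))).symm.trans ?_
    simp_rw [map_smul, integralL1_translateL1]
    rw [integral_smul_const, hf1, one_smul]
  -- The witness is the smoothed vector: translating it by `s` amounts to translating `f`. Smoothing
  -- preserves the integral, which is within 1/2 of 1, whence the lower bound on the norm.
  refine ⟨A f p, ?_, fun s hs => ?_⟩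
  · have h1 := norm_integralL1_apply_le μ (A f p)
    rw [hIp] at h1
    have h2 := hpI.trans_le (min_le_right _ _)
    have h3 : ‖(1 : ℂ)‖ ≤ ‖integralL1 μ p‖ + ‖integralL1 μ p - 1‖ := by
      rw [norm_sub_rev]
      exact norm_le_insert' _ _
    rw [norm_one] at h3
    linarith
  · obtain ⟨s₀, hs₀, hs₀'⟩ := mem_iUnion₂.1 (hF hs)
    have h1 : translateL1 μ s (A f p) = A (twistedTranslate 1 s f) p :=
      map_intOp μ (translateL1 μ) (continuous_translateL1 μ) hnorm (translateL1_translateL1 μ) s f p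
    have h2 : ‖(A (twistedTranslate 1 s f) - A (twistedTranslate 1 s₀ f)) p‖ ≤ δ / (2 * N) * N :=
      (ContinuousLinearMap.le_opNorm _ _).trans (mul_le_mul (le_of_lt hs₀') hp (norm_nonneg _)
        (by positivity))
    have h3 := (hpF s₀ hs₀).trans_le (min_le_left _ _)
    have h4 : δ / (2 * N) * N = δ / 2 := by field_simp
    rw [h4] at h2
    rw [h1]
    calc ‖A (twistedTranslate 1 s f) p - A f p‖
        = ‖(A (twistedTranslate 1 s f) - A (twistedTranslate 1 s₀ f)) p
          + (A (twistedTranslate 1 s₀ f) - A f) p‖ := by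
          rw [sub_apply, sub_apply, sub_add_sub_cancel]
      _ ≤ δ / 2 + δ / 2 := (norm_add_le _ _).trans (add_le_add h2 h3.le)
      _ = δ := add_halves δ

theorem sqrt_sub_sqrt_sq_le {a b : ℝ} (ha : 0 ≤ a) (hb : 0 ≤ b) : (√a - √b) ^ 2 ≤ |a - b| := by
  have h1 : |a - b| = |√a - √b| * (√a + √b) := by
    rw [← abs_of_nonneg (add_nonneg (Real.sqrt_nonneg a) (Real.sqrt_nonneg b)), ← abs_mul]
    congr 1
    nlinarith [Real.sq_sqrt ha, Real.sq_sqrt hb]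
  rw [h1, ← sq_abs, sq]
  refine mul_le_mul_of_nonneg_left (abs_le.2 ⟨?_, ?_⟩) (abs_nonneg _) <;>
  linarith [Real.sqrt_nonneg a, Real.sqrt_nonneg b]

/-- Reiter's property for `L²`. -/
theorem exists_norm_leftRegular_sub_le (hG : IsAmenableGroup μ) {K : Set G} (hK : IsCompact K)
    {δ : ℝ} (hδ : 0 < δ) :
    ∃ u : Lp ℂ 2 μ, 1 / 2 ≤ ‖u‖ ∧ ∀ s ∈ K, ‖leftRegular μ 1 s u - u‖ ≤ δ := by
  -- The L² vector is the square root of `|p|`; by `sqrt_sub_sqrt_sq_le` its displacement squared is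
  -- at most the L¹ displacement of `p`, which explains `δ ^ 2`.
  obtain ⟨p, hp, hpK⟩ := exists_norm_translateL1_sub_le μ hG hK (δ := δ ^ 2) (by positivity)
  have hmeas : AEStronglyMeasurable (fun t => ((√‖p t‖ : ℝ) : ℂ)) μ :=
    (Complex.continuous_ofReal.comp (Real.continuous_sqrt.comp continuous_norm)).comp_aestronglyMeasurable
      (Lp.aestronglyMeasurable p)
  have hsq : ∀ t, ‖((√‖p t‖ : ℝ) : ℂ)‖ ^ 2 = ‖p t‖ := fun t => by
    rw [Complex.norm_real, Real.norm_of_nonneg (Real.sqrt_nonneg _), Real.sq_sqrt (norm_nonneg _)]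
  have hmem : MemLp (fun t => ((√‖p t‖ : ℝ) : ℂ)) 2 μ := by
    refine (memLp_two_iff_integrable_sq_norm hmeas).2 ?_
    simp_rw [hsq]
    exact (L1.integrable_coeFn p).norm
  refine ⟨hmem.toLp, ?_, fun s hs => ?_⟩
  · have h1 : ‖hmem.toLp‖ ^ 2 = ‖p‖ := by
      rw [norm_sq_eq_integral_norm_sq, L1.norm_eq_integral_norm]
      refine integral_congr_ae ?_
      filter_upwards [hmem.coeFn_toLp] with t ht
      rw [ht, hsq]
    nlinarith [norm_nonneg (hmem.toLp)]
  · refine le_of_sq_le_sq ((?_ : _ ≤ ‖translateL1 μ s p - p‖).trans (hpK s hs)) hδ.le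
    rw [norm_sq_eq_integral_norm_sq, L1.norm_eq_integral_norm]
    refine integral_mono_ae (integrable_norm_sq _) (L1.integrable_coeFn _).norm ?_
    filter_upwards [Lp.coeFn_sub (leftRegular μ 1 s hmem.toLp) hmem.toLp,
      Lp.coeFn_sub (translateL1 μ s p) p, coeFn_leftRegular μ 1 s hmem.toLp, hmem.coeFn_toLp,
      (measurePreserving_mul_left μ s⁻¹).quasiMeasurePreserving.ae hmem.coeFn_toLp,
      coeFn_translateL1 μ s p] with t h1 h2 h3 h4 h5 h6
    rw [h1, h2, Pi.sub_apply, Pi.sub_apply, h3, h4, h5, h6]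
    have h7 : (((1 : ContinuousTwoCocycle G) s (s⁻¹ * t) : Circle) : ℂ) = 1 := rfl
    rw [h7, one_mul, ← Complex.ofReal_sub, Complex.norm_real, Real.norm_eq_abs, sq_abs]
    exact (sqrt_sub_sqrt_sq_le (norm_nonneg _) (norm_nonneg _)).trans (abs_norm_sub_norm_le _ _)

/-- For an amenable group the trivial representation is weakly contained in the regular one. -/
theorem norm_integral_le_norm_integratedRegular (hG : IsAmenableGroup μ) (h : C_c(G, ℂ)) :
    ‖∫ s, h s ∂μ‖ ≤ ‖integratedRegular μ 1 h‖ := by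
  refine le_of_forall_pos_le_add fun ε hε => ?_
  set C := ∫ s, ‖h s‖ ∂μ with hC
  have hC0 : 0 ≤ C := integral_nonneg fun _ => norm_nonneg _
  obtain ⟨u, hu, huK⟩ := exists_norm_leftRegular_sub_le μ hG h.hasCompactSupport
    (δ := ε / (2 * (C + 1))) (by positivity)
  have h1 : integratedRegular μ 1 h u - (∫ s, h s ∂μ) • u
      = ∫ s, h s • (leftRegular μ 1 s u - u) ∂μ := by
    simp only [smul_sub]
    rw [integral_sub (integrable_cc μ h (continuous_leftRegular μ 1 u))
      (integrable_cc μ h (continuous_const (y := u))), integral_smul_const, integratedRegular_apply]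
  have h2 : ‖integratedRegular μ 1 h u - (∫ s, h s ∂μ) • u‖ ≤ C * (ε / (2 * (C + 1))) := by
    rw [h1, hC, ← integral_mul_const]
    refine norm_integral_le_of_norm_le ((integrable_norm_cc μ h).mul_const _)
      (.of_forall fun s => ?_)
    rw [norm_smul]
    by_cases hs : h s = 0
    · rw [hs, norm_zero, zero_mul, zero_mul]
    exact mul_le_mul_of_nonneg_left (huK s (subset_tsupport _ hs)) (norm_nonneg _)
  have h3 : C * (ε / (2 * (C + 1))) ≤ ε / 2 := by
    rw [mul_div_assoc', div_le_div_iff₀ (by positivity) (by positivity)]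
    nlinarith
  have h4 : ‖∫ s, h s ∂μ‖ * ‖u‖ ≤ ‖integratedRegular μ 1 h‖ * ‖u‖ + ε / 2 := by
    rw [← norm_smul]
    calc ‖(∫ s, h s ∂μ) • u‖ ≤ ‖integratedRegular μ 1 h u‖
          + ‖integratedRegular μ 1 h u - (∫ s, h s ∂μ) • u‖ := by
          rw [norm_sub_rev]
          exact norm_le_insert' _ _
      _ ≤ _ := add_le_add (ContinuousLinearMap.le_opNorm _ _) (h2.trans h3)
  have h5 : ‖∫ s, h s ∂μ‖ * ‖u‖ ≤ (‖integratedRegular μ 1 h‖ + ε) * ‖u‖ := by nlinarith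
  exact le_of_mul_le_mul_right h5 (by linarith)

end Amenable

/-! ### The norm estimate for bounded multipliers -/

section Multiplier

open Set Filter Topology
open scoped CompactlySupported Pointwise

variable {G : Type u} [Group G] [TopologicalSpace G] [IsTopologicalGroup G]
  [MeasurableSpace G] [BorelSpace G] [T2Space G] [LocallyCompactSpace G]
  (μ : Measure G) [μ.IsHaarMeasure] [μ.Regular] {σ : ContinuousTwoCocycle G}

theorem continuous_fourierEval {τ : ContinuousTwoCocycle G} (ψ : twistedFourier μ τ) :
    Continuous (fourierEval μ τ ψ) :=
  (continuous_and_integral_of_mem_twistedFourier μ τ ψ.2).1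

/-- The element of `A(G,τ)` given by a vector functional. -/
def vectorFourier (τ : ContinuousTwoCocycle G) (u v : Lp ℂ 2 μ) : twistedFourier μ τ :=
  ⟨vectorFunctional μ τ u v, vectorFunctional_mem μ τ u v⟩

omit [T2Space G] [LocallyCompactSpace G] [μ.Regular] in
theorem norm_vectorFourier_le (τ : ContinuousTwoCocycle G) (u v : Lp ℂ 2 μ) :
    ‖vectorFourier μ τ u v‖ ≤ ‖v‖ * ‖u‖ :=
  norm_vectorFunctional_le μ τ u v

omit [T2Space G] [LocallyCompactSpace G] [μ.Regular] in
theorem fourierEval_vectorFourier (τ : ContinuousTwoCocycle G) (u v : Lp ℂ 2 μ) (s : G) :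
    fourierEval μ τ (vectorFourier μ τ u v) s = inner ℂ v (leftRegular μ τ s u) := rfl

/-- Near each point, `φ` is the quotient of the continuous functions `m_φ ψ` and `ψ`, for some `ψ`
that does not vanish there. -/
theorem continuous_of_isMultiplicationBy {τ : ContinuousTwoCocycle G} {u : Lp ℂ 2 μ} (hu : u ≠ 0)
    {φ : G → ℂ} {T : twistedFourier μ τ →ₗ[ℂ] twistedFourier μ σ}
    (hT : IsMultiplicationBy μ φ T) : Continuous φ := by
  refine continuous_iff_continuousAt.2 fun s₀ => ?_
  obtain ⟨ψ, hψ⟩ : ∃ ψ, ψ = vectorFourier μ τ u (leftRegular μ τ s₀ u) := ⟨_, rfl⟩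
  have h0 : fourierEval μ τ ψ s₀ ≠ 0 := by
    rw [hψ, fourierEval_vectorFourier, inner_leftRegular]
    exact inner_self_ne_zero.2 hu
  have h1 := (continuous_fourierEval μ ψ).continuousAt (x := s₀)
  have h2 := (continuous_fourierEval μ (T ψ)).continuousAt (x := s₀)
  refine (h2.div h1 h0).congr ?_
  filter_upwards [h1.eventually_ne h0] with s hs
  rw [Pi.div_apply, hT ψ s, mul_div_assoc, div_self hs, mul_one]

theorem norm_integral_mul_fourierEval_le {τ : ContinuousTwoCocycle G} (ψ : twistedFourier μ τ)
    (f : C_c(G, ℂ)) :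
    ‖∫ s, f s * fourierEval μ τ ψ s ∂μ‖ ≤ ‖ψ‖ * ‖integratedRegular μ τ f‖ := by
  have h1 := (continuous_and_integral_of_mem_twistedFourier μ τ ψ.2).2 f
  exact (congrArg norm h1.symm).le.trans
    ((ψ : StrongDual ℂ (TwistedVN μ τ)).le_opNorm (integratedRegularVN μ τ f))

theorem norm_integral_mul_inner_le {τ : ContinuousTwoCocycle G} {φ : G → ℂ}
    {T : twistedFourier μ τ →ₗ[ℂ] twistedFourier μ σ} (hT : IsMultiplicationBy μ φ T)
    (f : C_c(G, ℂ)) (u v : Lp ℂ 2 μ) :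
    ‖∫ s, f s * (φ s * inner ℂ v (leftRegular μ τ s u)) ∂μ‖ ≤
      ‖T (vectorFourier μ τ u v)‖ * ‖integratedRegular μ σ f‖ := by
  have h1 := norm_integral_mul_fourierEval_le μ (T (vectorFourier μ τ u v)) f
  refine Eq.trans_le (congrArg norm (integral_congr_ae (.of_forall fun s => ?_))) h1
  exact congrArg (f s * ·) (hT (vectorFourier μ τ u v) s).symm

/-- A bounded multiplier satisfies `|∫ fφ| ≤ ‖m_φ‖ ‖λ_σ(f)‖` if the trivial representation is
weakly contained in the regular one. -/
theorem norm_integral_mul_le_of_isMultiplicationBy (hG : IsAmenableGroup μ)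
    {φ : G → ℂ} (hφ : Continuous φ) {T : twistedFourier μ 1 →ₗ[ℂ] twistedFourier μ σ}
    (hT : IsMultiplicationBy μ φ T) {C : ℝ} (hC0 : 0 ≤ C) (hC : ∀ ψ, ‖T ψ‖ ≤ C * ‖ψ‖)
    (f : C_c(G, ℂ)) : ‖∫ s, f s * φ s ∂μ‖ ≤ C * ‖integratedRegular μ σ f‖ := by
  let h : C_c(G, ℂ) := ⟨⟨fun s => f s * φ s, f.continuous.mul hφ⟩, f.hasCompactSupport.mul_right⟩
  have hh : ∀ s, h s = f s * φ s := fun s => rfl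
  refine (norm_integral_le_norm_integratedRegular μ hG h).trans ?_
  -- The coefficient of λ(fφ) at `u, v` is, up to conjugation, the pairing of `λ_σ(f)` with `m_φ`
  -- applied to the vector functional of `u, v`, whose norm is at most 1.
  refine ContinuousLinearMap.opNorm_le_of_re_inner_le (by positivity) fun u v hu hv => ?_
  have h1 : inner ℂ (integratedRegular μ 1 h u) v =
      starRingEnd ℂ (∫ s, f s * (φ s * inner ℂ v (leftRegular μ 1 s u)) ∂μ) := by
    rw [← inner_conj_symm, integratedRegular_apply,
      ← integral_inner (integrable_cc μ h (continuous_leftRegular μ 1 u)) v]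
    simp only [inner_smul_right, hh, mul_assoc]
  rw [h1]
  refine (Complex.re_le_norm _).trans ?_
  rw [RCLike.norm_conj]
  refine (norm_integral_mul_inner_le μ hT f u v).trans ?_
  refine mul_le_mul_of_nonneg_right ((hC _).trans ?_) (norm_nonneg _)
  refine (mul_le_mul_of_nonneg_left (norm_vectorFourier_le μ 1 u v) hC0).trans ?_
  rw [hu, hv, one_mul, mul_one]

end Multiplier

/-! ### Functionals dominated by invariant positive forms -/

section DominatedPairs

open Set Filter Topology

/-- A continuous linear functional on a product of lines depends on finitely many coordinates. -/
theorem exists_finset_forall_eq_sum {V : Type*} (Λ : StrongDual ℂ (V → ℂ)) :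
    ∃ (F : Finset V) (c : V → ℂ), ∀ x, Λ x = ∑ v ∈ F, x v * c v := by
  classical
  have h1 : Λ ⁻¹' Metric.ball 0 1 ∈ 𝓝 (0 : V → ℂ) :=
    Λ.continuous.continuousAt.preimage_mem_nhds (by
      rw [map_zero]; exact Metric.ball_mem_nhds _ one_pos)
  rw [nhds_pi, Filter.mem_pi] at h1
  obtain ⟨I, hI, U, hU, hsub⟩ := h1
  have h2 : ∀ x : V → ℂ, (∀ v ∈ I, x v = 0) → Λ x = 0 := by
    intro x hx
    by_contra h0
    have h3 : (Λ x)⁻¹ • x ∈ I.pi U := by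
      intro v hv
      rw [Pi.smul_apply, hx v hv, smul_zero]
      exact mem_of_mem_nhds (hU v)
    have h4 := hsub h3
    rw [mem_preimage, map_smul, smul_eq_mul, inv_mul_cancel₀ h0] at h4
    simp at h4
  refine ⟨hI.toFinset, fun v => Λ (Pi.single v 1), fun x => ?_⟩
  have h3 := h2 (x - ∑ v ∈ hI.toFinset, x v • Pi.single v 1) fun w hw => by
    rw [Pi.sub_apply, Finset.sum_apply, Finset.sum_eq_single w]
    · simp
    · intro v _ hvw
      simp [Pi.single_eq_of_ne hvw.symm]
    · intro h
      exact absurd (hI.mem_toFinset.2 hw) h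
  rw [map_sub, sub_eq_zero] at h3
  rw [h3, map_sum]
  simp only [map_smul, smul_eq_mul]

variable {V : Type*} [AddCommGroup V] [Module ℂ V] {ι : Type*}

/-- Pairs of a linear functional `ℓ` and a positive sesquilinear form `B` with
`|ℓ(f)|² ≤ B(f,f)`, where `B` is invariant under the maps `A i`, and both are bounded by `N`. -/
structure IsDominatedPair (N : V → ℝ) (A : ι → V → V) (p : (V → ℂ) × (V → V → ℂ)) : Prop where
  map_add : ∀ f g, p.1 (f + g) = p.1 f + p.1 g
  map_smul : ∀ (c : ℂ) f, p.1 (c • f) = c * p.1 f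
  add_left : ∀ f g h, p.2 (f + g) h = p.2 f h + p.2 g h
  smul_left : ∀ (c : ℂ) f g, p.2 (c • f) g = starRingEnd ℂ c * p.2 f g
  conj_symm : ∀ f g, starRingEnd ℂ (p.2 g f) = p.2 f g
  nonneg : ∀ f, 0 ≤ (p.2 f f).re
  norm_sq_le : ∀ f, ‖p.1 f‖ ^ 2 ≤ (p.2 f f).re
  invariant : ∀ i f g, p.2 (A i f) (A i g) = p.2 f g
  norm_fst_le : ∀ f, ‖p.1 f‖ ≤ N f
  norm_snd_le : ∀ f g, ‖p.2 f g‖ ≤ N f * N g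

theorem isClosed_setOf_isDominatedPair (N : V → ℝ) (A : ι → V → V) :
    IsClosed {p | IsDominatedPair N A p} := by
  have h : {p | IsDominatedPair N A p} =
      {p : (V → ℂ) × (V → V → ℂ) | (∀ f g, p.1 (f + g) = p.1 f + p.1 g) ∧
        (∀ (c : ℂ) f, p.1 (c • f) = c * p.1 f) ∧
        (∀ f g h, p.2 (f + g) h = p.2 f h + p.2 g h) ∧
        (∀ (c : ℂ) f g, p.2 (c • f) g = starRingEnd ℂ c * p.2 f g) ∧
        (∀ f g, starRingEnd ℂ (p.2 g f) = p.2 f g) ∧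
        (∀ f, 0 ≤ (p.2 f f).re) ∧ (∀ f, ‖p.1 f‖ ^ 2 ≤ (p.2 f f).re) ∧
        (∀ i f g, p.2 (A i f) (A i g) = p.2 f g) ∧ (∀ f, ‖p.1 f‖ ≤ N f) ∧
        (∀ f g, ‖p.2 f g‖ ≤ N f * N g)} := by
    ext p
    exact ⟨fun ⟨a, b, c, d, e, f, g, h, i, j⟩ => ⟨a, b, c, d, e, f, g, h, i, j⟩,
      fun ⟨a, b, c, d, e, f, g, h, i, j⟩ => ⟨a, b, c, d, e, f, g, h, i, j⟩⟩
  have e1 : ∀ f : V, Continuous fun p : (V → ℂ) × (V → V → ℂ) => p.1 f := fun f => by fun_prop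
  have e2 : ∀ f g : V, Continuous fun p : (V → ℂ) × (V → V → ℂ) => p.2 f g := fun f g => by fun_prop
  have e3 : ∀ f : V, Continuous fun p : (V → ℂ) × (V → V → ℂ) => (p.2 f f).re :=
    fun f => Complex.continuous_re.comp (e2 f f)
  rw [h]
  simp only [Set.ofPred_and, Set.ofPred_forall]
  refine .inter ?_ <| .inter ?_ <| .inter ?_ <| .inter ?_ <| .inter ?_ <| .inter ?_ <|
    .inter ?_ <| .inter ?_ <| .inter ?_ ?_
  · exact isClosed_iInter fun f => isClosed_iInter fun g => isClosed_eq (e1 _) ((e1 f).add (e1 g))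
  · exact isClosed_iInter fun c => isClosed_iInter fun f =>
      isClosed_eq (e1 _) (continuous_const.mul (e1 f))
  · exact isClosed_iInter fun f => isClosed_iInter fun g => isClosed_iInter fun h =>
      isClosed_eq (e2 _ _) ((e2 f h).add (e2 g h))
  · exact isClosed_iInter fun c => isClosed_iInter fun f => isClosed_iInter fun g =>
      isClosed_eq (e2 _ _) (continuous_const.mul (e2 f g))
  · exact isClosed_iInter fun f => isClosed_iInter fun g =>
      isClosed_eq (Complex.continuous_conj.comp (e2 g f)) (e2 f g)
  · exact isClosed_iInter fun f => isClosed_le continuous_const (e3 f)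
  · exact isClosed_iInter fun f => isClosed_le ((e1 f).norm.pow 2) (e3 f)
  · exact isClosed_iInter fun i => isClosed_iInter fun f => isClosed_iInter fun g =>
      isClosed_eq (e2 _ _) (e2 f g)
  · exact isClosed_iInter fun f => isClosed_le (e1 f).norm continuous_const
  · exact isClosed_iInter fun f => isClosed_iInter fun g =>
      isClosed_le (e2 f g).norm continuous_const

/-- The bounds by `N` place all pairs in a product of closed discs, compact by Tychonoff, where the
pointwise conditions are closed. -/
theorem isCompact_setOf_isDominatedPair (N : V → ℝ) (A : ι → V → V) :
    IsCompact {p | IsDominatedPair N A p} := by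
  have h1 : IsCompact (Set.univ.pi fun f : V => Metric.closedBall (0 : ℂ) (N f)) :=
    isCompact_univ_pi fun f => isCompact_closedBall _ _
  have h2 : IsCompact (Set.univ.pi fun f : V => Set.univ.pi fun g : V =>
      Metric.closedBall (0 : ℂ) (N f * N g)) :=
    isCompact_univ_pi fun f => isCompact_univ_pi fun g => isCompact_closedBall _ _
  refine (h1.prod h2).of_isClosed_subset (isClosed_setOf_isDominatedPair N A) fun p hp => ?_
  exact ⟨fun f _ => mem_closedBall_zero_iff.2 (hp.norm_fst_le f),
    fun f _ g _ => mem_closedBall_zero_iff.2 (hp.norm_snd_le f g)⟩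

/-- The only quadratic condition, `|ℓ(f)|² ≤ B(f,f)`, survives convex combinations because squaring
is convex; everything else is linear or a norm bound. -/
theorem convex_setOf_isDominatedPair (N : V → ℝ) (A : ι → V → V) :
    Convex ℝ {p | IsDominatedPair N A p} := by
  intro p hp q hq a b ha hb hab
  have hp : IsDominatedPair N A p := hp
  have hq : IsDominatedPair N A q := hq
  have e1 : ∀ f, (a • p + b • q).1 f = a * p.1 f + b * q.1 f := fun f => by
    simp [Complex.real_smul]
  have e2 : ∀ f g, (a • p + b • q).2 f g = a * p.2 f g + b * q.2 f g := fun f g => by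
    simp [Complex.real_smul]
  have e3 : ∀ f, ((a • p + b • q).2 f f).re = a * (p.2 f f).re + b * (q.2 f f).re := fun f => by
    rw [e2]; simp
  have e4 : ∀ f, ‖(a • p + b • q).1 f‖ ≤ a * ‖p.1 f‖ + b * ‖q.1 f‖ := fun f => by
    rw [e1]
    refine (norm_add_le _ _).trans_eq ?_
    rw [norm_mul, norm_mul, Complex.norm_of_nonneg ha, Complex.norm_of_nonneg hb]
  have e5 : ∀ f g, ‖(a • p + b • q).2 f g‖ ≤ a * ‖p.2 f g‖ + b * ‖q.2 f g‖ := fun f g => by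
    rw [e2]
    refine (norm_add_le _ _).trans_eq ?_
    rw [norm_mul, norm_mul, Complex.norm_of_nonneg ha, Complex.norm_of_nonneg hb]
  constructor
  · intro f g; rw [e1, e1, e1, hp.map_add, hq.map_add]; ring
  · intro c f; rw [e1, e1, hp.map_smul, hq.map_smul]; ring
  · intro f g h; rw [e2, e2, e2, hp.add_left, hq.add_left]; ring
  · intro c f g; rw [e2, e2, hp.smul_left, hq.smul_left]; ring
  · intro f g
    rw [e2, e2, _root_.map_add, map_mul, map_mul, hp.conj_symm, hq.conj_symm, Complex.conj_ofReal,
      Complex.conj_ofReal]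
  · intro f
    rw [e3]
    exact add_nonneg (mul_nonneg ha (hp.nonneg f)) (mul_nonneg hb (hq.nonneg f))
  · intro f
    rw [e3]
    have h1 := mul_le_mul_of_nonneg_left (hp.norm_sq_le f) ha
    have h2 := mul_le_mul_of_nonneg_left (hq.norm_sq_le f) hb
    have h3 := pow_le_pow_left₀ (norm_nonneg _) (e4 f) 2
    have h4 : (a * ‖p.1 f‖ + b * ‖q.1 f‖) ^ 2 ≤ a * ‖p.1 f‖ ^ 2 + b * ‖q.1 f‖ ^ 2 := by
      have h5 := (convexOn_pow 2).2 (norm_nonneg (p.1 f)) (norm_nonneg (q.1 f)) ha hb hab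
      simpa using h5
    linarith
  · intro i f g; rw [e2, e2, hp.invariant, hq.invariant]
  · intro f
    refine (e4 f).trans ?_
    have h1 := mul_le_mul_of_nonneg_left (hp.norm_fst_le f) ha
    have h2 := mul_le_mul_of_nonneg_left (hq.norm_fst_le f) hb
    nlinarith [congrArg (· * N f) hab]
  · intro f g
    refine (e5 f g).trans ?_
    have h1 := mul_le_mul_of_nonneg_left (hp.norm_snd_le f g) ha
    have h2 := mul_le_mul_of_nonneg_left (hq.norm_snd_le f g) hb
    nlinarith [congrArg (· * (N f * N g)) hab]

/-- A linear functional bounded by the support function of the dominated pairs is itself part of a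
dominated pair. -/
theorem exists_isDominatedPair (N : V → ℝ) (A : ι → V → V) (ℓ : V →ₗ[ℂ] ℂ)
    (h : ∀ f u, (∀ p, IsDominatedPair N A p → (p.1 f).re < u) → ‖ℓ f‖ ≤ u) :
    ∃ B, IsDominatedPair N A (⇑ℓ, B) := by
  by_contra hno
  have hK : IsCompact (Prod.fst '' {p | IsDominatedPair N A p}) :=
    (isCompact_setOf_isDominatedPair N A).image continuous_fst
  have hc : Convex ℝ (Prod.fst '' {p | IsDominatedPair N A p}) :=
    (convex_setOf_isDominatedPair N A).linear_image (LinearMap.fst ℝ (V → ℂ) (V → V → ℂ))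
  have hn : (ℓ : V → ℂ) ∉ Prod.fst '' {p | IsDominatedPair N A p} := by
    rintro ⟨⟨ℓ', B⟩, hp, rfl⟩
    exact hno ⟨B, hp⟩
  obtain ⟨Λ, u, h1, h2⟩ := RCLike.geometric_hahn_banach_closed_point (𝕜 := ℂ) hc hK.isClosed hn
  -- On linear functionals, a finitely supported `Λ` is evaluation at the single vector `∑ c v • v`,
  -- and at that vector hypothesis `h` contradicts the separation.
  obtain ⟨F, c, hΛ⟩ := exists_finset_forall_eq_sum Λ
  have key : ∀ m : V →ₗ[ℂ] ℂ, Λ m = m (∑ v ∈ F, c v • v) := fun m => by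
    rw [hΛ, map_sum]
    simp only [LinearMap.map_smul, smul_eq_mul, mul_comm]
  have h3 := h (∑ v ∈ F, c v • v) u fun p hp => by
    have h4 := h1 p.1 ⟨p, hp, rfl⟩
    let m : V →ₗ[ℂ] ℂ := ⟨⟨p.1, hp.map_add⟩, fun c f => hp.map_smul c f⟩
    have h5 : Λ p.1 = p.1 (∑ v ∈ F, c v • v) := key m
    rw [h5] at h4
    exact h4
  rw [key] at h2
  exact absurd (h2.trans_le ((Complex.re_le_norm _).trans h3)) (lt_irrefl _)

end DominatedPairs

/-! ### Hilbert space completion and weak limits -/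

section HilbertCompletion

open Set Filter Topology

/-- The Hilbert space associated with a positive semidefinite sesquilinear form. -/
theorem exists_hilbertSpace_of_form {V : Type u} [AddCommGroup V] [Module ℂ V] (B : V → V → ℂ)
    (hadd : ∀ f g h, B (f + g) h = B f h + B g h)
    (hsmul : ∀ (c : ℂ) f g, B (c • f) g = starRingEnd ℂ c * B f g)
    (hsymm : ∀ f g, starRingEnd ℂ (B g f) = B f g) (hnonneg : ∀ f, 0 ≤ (B f f).re) :
    ∃ (H : Type u) (_ : NormedAddCommGroup H) (_ : InnerProductSpace ℂ H) (_ : CompleteSpace H)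
      (j : V →ₗ[ℂ] H), DenseRange j ∧ ∀ f g, inner ℂ (j f) (j g) = B f g := by
  let c : PreInnerProductSpace.Core ℂ V :=
    { inner := B
      conj_inner_symm := hsymm
      re_inner_nonneg := hnonneg
      add_left := hadd
      smul_left := fun f g c => hsmul c f g }
  let : SeminormedAddCommGroup V := InnerProductSpace.Core.toSeminormedAddCommGroup (c := c)
  let : InnerProductSpace ℂ V := InnerProductSpace.ofCore c
  exact ⟨UniformSpace.Completion V, inferInstance, inferInstance, inferInstance,
    (UniformSpace.Completion.toComplL : V →L[ℂ] UniformSpace.Completion V).toLinearMap,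
    UniformSpace.Completion.denseRange_coe, fun f g => UniformSpace.Completion.inner_coe f g⟩

/-- Bounded nets in a Hilbert space converge weakly along ultrafilters. -/
theorem exists_tendsto_inner_ultrafilter {H : Type*} [NormedAddCommGroup H] [InnerProductSpace ℂ H]
    [CompleteSpace H] {α : Type*} (l : Ultrafilter α) (v : α → H) {R : ℝ}
    (hv : ∀ᶠ a in (l : Filter α), ‖v a‖ ≤ R) :
    ∃ ξ : H, ∀ x, Tendsto (fun a => inner ℂ x (v a)) (l : Filter α) (𝓝 (inner ℂ x ξ)) := by
  have h1 : ∀ x, ∃ z ∈ Metric.closedBall (0 : ℂ) (R * ‖x‖),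
      Tendsto (fun a => inner ℂ (v a) x) (l : Filter α) (𝓝 z) := by
    intro x
    have h2 : ((l.map fun a => inner ℂ (v a) x : Ultrafilter ℂ) : Filter ℂ) ≤
        𝓟 (Metric.closedBall (0 : ℂ) (R * ‖x‖)) := by
      refine le_principal_iff.2 ?_
      change ∀ᶠ a in (l : Filter α), _
      filter_upwards [hv] with a ha
      exact mem_closedBall_zero_iff.2 ((norm_inner_le_norm _ _).trans
        (mul_le_mul_of_nonneg_right ha (norm_nonneg _)))
    obtain ⟨z, hz, hle⟩ := (isCompact_closedBall (0 : ℂ) (R * ‖x‖)).ultrafilter_le_nhds _ h2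
    exact ⟨z, hz, hle⟩
  choose L hL hlim using h1
  let Λ : StrongDual ℂ H := LinearMap.mkContinuous
    { toFun := L
      map_add' := fun x y => tendsto_nhds_unique (hlim (x + y)) (by
        simpa only [inner_add_right] using (hlim x).add (hlim y))
      map_smul' := fun c x => tendsto_nhds_unique (hlim (c • x)) (by
        simpa only [inner_smul_right, smul_eq_mul, RingHom.id_apply] using (hlim x).const_mul c) }
    R fun x => mem_closedBall_zero_iff.1 (hL x)
  refine ⟨(InnerProductSpace.toDual ℂ H).symm Λ, fun x => ?_⟩
  have h3 : inner ℂ x ((InnerProductSpace.toDual ℂ H).symm Λ) = starRingEnd ℂ (L x) := by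
    rw [← inner_conj_symm, InnerProductSpace.toDual_symm_apply]
    rfl
  rw [h3]
  refine ((Complex.continuous_conj.tendsto _).comp (hlim x)).congr fun a => ?_
  exact inner_conj_symm _ _

end HilbertCompletion

/-! ### From an invariant form to a σ-representation -/

section FormRepresentation

open Set Filter Topology
open scoped CompactlySupported

variable {G : Type u} [Group G] [TopologicalSpace G] [IsTopologicalGroup G]
  [MeasurableSpace G] [BorelSpace G] [T2Space G] [LocallyCompactSpace G]
  (μ : Measure G) [μ.IsHaarMeasure] [μ.Regular] {σ : ContinuousTwoCocycle G}
  {H : Type u} [NormedAddCommGroup H] [InnerProductSpace ℂ H] [CompleteSpace H]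

/-- An invariant dense image of `C_c(G)` in a Hilbert space carries a `σ`-representation. -/
theorem exists_twistedRep_of_denseRange {j : C_c(G, ℂ) →ₗ[ℂ] H} (hj : DenseRange j)
    (hinv : ∀ s f, ‖j (twistedTranslate σ s f)‖ = ‖j f‖) (hbound : ∀ f, ‖j f‖ ≤ ∫ t, ‖f t‖ ∂μ) :
    ∃ π : TwistedRep σ H, ∀ s f, (π.toFun s : H →L[ℂ] H) (j f) = j (twistedTranslate σ s f) := by
  obtain ⟨U, hU⟩ : ∃ U : G → H →L[ℂ] H, ∀ s f, U s (j f) = j (twistedTranslate σ s f) :=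
    ⟨fun s => (j ∘ₗ twistedTranslate σ s).extendOfNorm j, fun s f =>
      LinearMap.extendOfNorm_eq hj ⟨1, fun f => by
        rw [one_mul]; exact (hinv s f).le⟩ f⟩
  have hnorm : ∀ s x, ‖U s x‖ = ‖x‖ := fun s x =>
    hj.induction_on x (isClosed_eq (U s).continuous.norm continuous_norm) fun f => by
      rw [hU, hinv]
  have hmul : ∀ s t x, U s (U t x) = (σ s t : ℂ) • U (s * t) x := fun s t x =>
    hj.induction_on x (isClosed_eq ((U s).continuous.comp (U t).continuous)
      ((U (s * t)).continuous.const_smul _)) fun f => by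
        rw [hU, hU, hU, twistedTranslate_twistedTranslate, map_smul]
  have hone : ∀ x, U 1 x = x := fun x =>
    hj.induction_on x (isClosed_eq (U 1).continuous continuous_id) fun f => by
      rw [hU, twistedTranslate_one]
  have hleft : ∀ s, star (U s) * U s = 1 := fun s =>
    (ContinuousLinearMap.norm_map_iff_adjoint_comp_self (U s)).1 (hnorm s)
  have hright : ∀ s, U s * star (U s) = 1 := by
    intro s
    have h1 : U s * (starRingEnd ℂ (σ s s⁻¹ : ℂ) • U s⁻¹) = 1 := by
      ext1 x
      change U s (starRingEnd ℂ (σ s s⁻¹ : ℂ) • U s⁻¹ x) = x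
      rw [map_smul, hmul, smul_smul, σ.conj_mul_self, one_smul, mul_inv_cancel, hone]
    rw [left_inv_eq_right_inv (hleft s) h1, h1]
  have hcont1 : ∀ x, Tendsto (fun v => U v x) (𝓝 1) (𝓝 x) := by
    intro x
    refine Metric.tendsto_nhds.2 fun ε hε => ?_
    obtain ⟨f, hf⟩ := hj.exists_dist_lt x (by positivity : 0 < ε / 3)
    -- Continuity at 1 is inherited from the L¹ norm, which dominates the Hilbert norm on the image
    -- of `j`; isometry extends it from the dense range.
    filter_upwards [(tendsto_integral_norm_twistedTranslate_sub μ σ f).eventually_lt_const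
      (by positivity : 0 < ε / 3)] with v hv
    have e1 : dist (U v x) (U v (j f)) = dist x (j f) := by
      rw [dist_eq_norm, ← map_sub, hnorm, dist_eq_norm]
    have e2 : dist (U v (j f)) (j f) < ε / 3 := by
      rw [dist_eq_norm, hU, ← map_sub]
      exact (hbound _).trans_lt hv
    have e3 := dist_triangle4 (U v x) (U v (j f)) (j f) x
    rw [dist_comm (j f) x] at e3
    linarith
  have hcont : ∀ x, Continuous fun s => U s x := by
    intro x
    refine continuous_iff_continuousAt.2 fun s => ?_
    rw [ContinuousAt, ← map_mul_left_nhds_one, tendsto_map'_iff]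
    have h2 : Tendsto (fun v => (starRingEnd ℂ) (σ s v : ℂ)) (𝓝 1) (𝓝 1) := by
      have : Continuous fun v => (starRingEnd ℂ) (σ s v : ℂ) :=
        Complex.continuous_conj.comp (σ.continuous_coe.comp
          (by fun_prop : Continuous fun v : G => (s, v)))
      simpa [σ.map_one_right] using this.tendsto 1
    have h3 := h2.smul (((U s).continuous.tendsto x).comp (hcont1 x))
    rw [one_smul] at h3
    refine h3.congr fun v => ?_
    simp only [Function.comp_apply]
    rw [hmul, smul_smul, σ.conj_mul_self, one_smul]
  refine ⟨{ toFun := fun s => ⟨U s, hleft s, hright s⟩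
            measurable_orbit := fun x => ?_
            map_mul := fun s t => ?_ }, hU⟩
  · let : MeasurableSpace H := borel H
    have : BorelSpace H := ⟨rfl⟩
    exact (hcont x).measurable
  · ext1 x
    exact hmul s t x

/-- Approximate identities in `C_c(G)`. -/
def bumpFilter : Filter C_c(G, ℂ) :=
  (𝓝 (1 : G)).lift' fun U =>
    {g | ∫ r, g r ∂μ = 1 ∧ ∫ r, ‖g r‖ ∂μ = 1 ∧ ∀ r, g r ≠ 0 → r ∈ U}

theorem bumpFilter_neBot : (bumpFilter μ).NeBot := by
  refine (lift'_neBot_iff ?_).2 fun U hU => ?_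
  · exact fun U V hUV g hg => ⟨hg.1, hg.2.1, fun r hr => hUV (hg.2.2 r hr)⟩
  obtain ⟨g, hg⟩ := exists_cc_bump μ hU
  exact ⟨g, hg⟩

omit [IsTopologicalGroup G] [BorelSpace G] [T2Space G] [LocallyCompactSpace G] [μ.IsHaarMeasure]
  [μ.Regular] in
theorem eventually_bumpFilter {U : Set G} (hU : U ∈ 𝓝 (1 : G)) :
    ∀ᶠ g in bumpFilter μ, ∫ r, g r ∂μ = 1 ∧ ∫ r, ‖g r‖ ∂μ = 1 ∧ ∀ r, g r ≠ 0 → r ∈ U :=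
  mem_lift' hU

theorem tendsto_integral_bumpFilter {F : G → ℂ} (hF : Continuous F) :
    Tendsto (fun g : C_c(G, ℂ) => ∫ r, g r * F r ∂μ) (bumpFilter μ) (𝓝 (F 1)) := by
  refine Metric.tendsto_nhds.2 fun ε hε => ?_
  have hU : {r | dist (F r) (F 1) < ε / 2} ∈ 𝓝 (1 : G) :=
    Metric.tendsto_nhds.1 (hF.tendsto 1) (ε / 2) (by positivity)
  filter_upwards [eventually_bumpFilter μ hU] with g ⟨h1, h2, h3⟩
  have h4 : ∫ r, g r * F r ∂μ - F 1 = ∫ r, g r * (F r - F 1) ∂μ := by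
    have h5 := integrable_cc μ g hF
    have h6 := integrable_cc μ g (continuous_const (y := F 1))
    simp only [smul_eq_mul] at h5 h6
    simp only [mul_sub]
    rw [integral_sub h5 h6, integral_mul_const, h1, one_mul]
  rw [dist_eq_norm, h4]
  have h7 : ‖∫ r, g r * (F r - F 1) ∂μ‖ ≤ ∫ r, ‖g r‖ * (ε / 2) ∂μ := by
    refine norm_integral_le_of_norm_le ((integrable_norm_cc μ g).mul_const _)
      (.of_forall fun r => ?_)
    rw [norm_mul]
    by_cases hr : g r = 0
    · simp [hr]
    · refine mul_le_mul_of_nonneg_left ?_ (norm_nonneg _)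
      rw [← dist_eq_norm]
      exact (h3 r hr).le
  rw [integral_mul_const, h2, one_mul] at h7
  linarith

/-- A GNS construction: completing C_c(G) for `B` yields the representation, the domination makes `f
↦ ∫ fφ` a bounded functional on it represented by `η`, and `ξ` plays the part of the image of the
point mass at 1. -/
theorem exists_coeff_eq_of_isDominatedPair {φ : G → ℂ} (hφ : Continuous φ)
    {B : C_c(G, ℂ) → C_c(G, ℂ) → ℂ}
    (hB : IsDominatedPair (fun f : C_c(G, ℂ) => ∫ t, ‖f t‖ ∂μ)
      (fun s f => twistedTranslate σ s f) (fun f => ∫ t, f t * φ t ∂μ, B)) :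
    φ ∈ twistedFourierStieltjes σ := by
  obtain ⟨H, _, _, _, j, hj, hjB⟩ := exists_hilbertSpace_of_form B hB.add_left hB.smul_left
    hB.conj_symm hB.nonneg
  have hsq : ∀ f, ‖j f‖ ^ 2 = (B f f).re := fun f => by
    rw [← hjB, ← inner_self_eq_norm_sq (𝕜 := ℂ)]; rfl
  have hN : ∀ f : C_c(G, ℂ), 0 ≤ ∫ t, ‖f t‖ ∂μ := fun f => integral_nonneg fun _ => norm_nonneg _
  have hbound : ∀ f, ‖j f‖ ≤ ∫ t, ‖f t‖ ∂μ := fun f => by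
    refine abs_le_of_sq_le_sq' ?_ (hN f) |>.2
    rw [hsq, sq]
    exact (Complex.re_le_norm _).trans (hB.norm_snd_le f f)
  obtain ⟨π, hπ⟩ := exists_twistedRep_of_denseRange μ (σ := σ) hj (fun s f => by
    rw [← sq_eq_sq₀ (norm_nonneg _) (norm_nonneg _), hsq, hsq]
    exact congrArg Complex.re (hB.invariant s f f)) hbound
  let ℓ : C_c(G, ℂ) →ₗ[ℂ] ℂ := ⟨⟨fun f => ∫ t, f t * φ t ∂μ, hB.map_add⟩, hB.map_smul⟩
  have hℓ : ∀ f, ‖ℓ f‖ ≤ 1 * ‖j f‖ := fun f => by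
    rw [one_mul]
    refine abs_le_of_sq_le_sq' ?_ (norm_nonneg _) |>.2
    rw [hsq]
    exact hB.norm_sq_le f
  obtain ⟨η, hη⟩ : ∃ η : H, ∀ f, inner ℂ η (j f) = ∫ t, f t * φ t ∂μ :=
    ⟨(InnerProductSpace.toDual ℂ H).symm (ℓ.extendOfNorm j), fun f => by
      rw [InnerProductSpace.toDual_symm_apply]
      exact LinearMap.extendOfNorm_eq hj ⟨1, hℓ⟩ f⟩
  have := bumpFilter_neBot μ
  -- The vectors `j g` of an approximate identity have norm at most 1, so they converge weakly along
  -- an ultrafilter. Pairing π(s) j(g) with `η` gives `∫ g(t) σ(s,t) φ(st) dt`, which tends to `φ s`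
  -- since `σ(s,1) = 1`.
  obtain ⟨ξ, hξ⟩ := exists_tendsto_inner_ultrafilter (Ultrafilter.of (bumpFilter μ)) (fun g => j g)
    (R := 1) (Ultrafilter.of_le _ (by
      filter_upwards [eventually_bumpFilter μ univ_mem] with g hg
      exact (hbound g).trans_eq hg.2.1))
  refine ⟨H, _, _, _, π, ξ, η, funext fun s => ?_⟩
  have h1 := hξ (ContinuousLinearMap.adjoint (π.toFun s : H →L[ℂ] H) η)
  have h2 : Continuous fun t => (σ s t : ℂ) * φ (s * t) :=
    (σ.continuous_coe.comp (by fun_prop : Continuous fun t : G => (s, t))).mul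
      (hφ.comp (continuous_const.mul continuous_id))
  have h3 := (tendsto_integral_bumpFilter μ h2).mono_left (Ultrafilter.of_le (bumpFilter μ))
  rw [σ.map_one_right, Circle.coe_one, one_mul, mul_one] at h3
  rw [ContinuousLinearMap.adjoint_inner_left] at h1
  refine tendsto_nhds_unique h3 (h1.congr fun g => ?_)
  rw [ContinuousLinearMap.adjoint_inner_left, hπ, hη,
    ← integral_mul_left_eq_self (fun t => twistedTranslate σ s g t * φ t) s]
  refine integral_congr_ae (.of_forall fun t => ?_)
  simp only
  rw [twistedTranslate_apply, inv_mul_cancel_left]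
  ring

end FormRepresentation

/-! ### Multipliers are coefficients, and the conclusion -/

section Main

open scoped CompactlySupported

variable {G : Type u} [Group G] [TopologicalSpace G] [IsTopologicalGroup G]
  [MeasurableSpace G] [BorelSpace G] [T2Space G] [LocallyCompactSpace G]
  (μ : Measure G) [μ.IsHaarMeasure] [μ.Regular] {σ : ContinuousTwoCocycle G}

/-- These are the model pairs: domination is Cauchy–Schwarz and invariance comes from λ_σ(s) being
isometric with `λ_σ(s)λ_σ(f)` the integrated form of the translate. They make the support function
of the dominated pairs at least `‖λ_σ(f)‖`. -/
theorem isDominatedPair_integratedRegular {ξ η : Lp ℂ 2 μ} (hξ : ‖ξ‖ ≤ 1) (hη : ‖η‖ ≤ 1) :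
    IsDominatedPair (fun f : C_c(G, ℂ) => ∫ t, ‖f t‖ ∂μ) (fun s f => twistedTranslate σ s f)
      (fun f => inner ℂ η (integratedRegular μ σ f ξ),
        fun f g => inner ℂ (integratedRegular μ σ f ξ) (integratedRegular μ σ g ξ)) := by
  have hN : ∀ f : C_c(G, ℂ), 0 ≤ ∫ t, ‖f t‖ ∂μ := fun f => integral_nonneg fun _ => norm_nonneg _
  have h1 : ∀ f, ‖integratedRegular μ σ f ξ‖ ≤ ∫ t, ‖f t‖ ∂μ := fun f =>
    (norm_integratedRegular_apply_le μ σ f ξ).trans (mul_le_of_le_one_right (hN f) hξ)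
  have h2 : ∀ f, ‖inner ℂ η (integratedRegular μ σ f ξ)‖ ≤ ‖integratedRegular μ σ f ξ‖ := fun f =>
    (norm_inner_le_norm _ _).trans (mul_le_of_le_one_left (norm_nonneg _) hη)
  have h3 : ∀ f, (inner ℂ (integratedRegular μ σ f ξ) (integratedRegular μ σ f ξ)).re =
      ‖integratedRegular μ σ f ξ‖ ^ 2 := fun f => inner_self_eq_norm_sq (𝕜 := ℂ) _
  constructor
  · intro f g
    simp only [integratedRegular_add, add_apply, inner_add_right]
  · intro c f
    simp only [integratedRegular_smul, smul_apply, inner_smul_right]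
  · intro f g h
    simp only [integratedRegular_add, add_apply, inner_add_left]
  · intro c f g
    simp only [integratedRegular_smul, smul_apply, inner_smul_left]
  · intro f g
    exact inner_conj_symm _ _
  · intro f
    simp only [h3]
    positivity
  · intro f
    simp only [h3]
    exact pow_le_pow_left₀ (norm_nonneg _) (h2 f) 2
  · intro s f g
    simp only [← leftRegular_integratedRegular, inner_leftRegular]
  · exact fun f => (h2 f).trans (h1 f)
  · exact fun f g => (norm_inner_le_norm _ _).trans
      (mul_le_mul (h1 f) (h1 g) (norm_nonneg _) (hN f))

/-- Functions with `|∫ fφ| ≤ C ‖λ_σ(f)‖` belong to `B(G,σ)`. -/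
theorem mem_twistedFourierStieltjes_of_norm_integral_le {φ : G → ℂ} (hφ : Continuous φ) {C : ℝ}
    (hC : 0 < C) (h : ∀ f : C_c(G, ℂ), ‖∫ t, f t * φ t ∂μ‖ ≤ C * ‖integratedRegular μ σ f‖) :
    φ ∈ twistedFourierStieltjes σ := by
  obtain ⟨φ₀, hφ₀⟩ : ∃ φ₀ : G → ℂ, φ₀ = fun t => (C : ℂ)⁻¹ * φ t := ⟨_, rfl⟩
  have hc₀ : Continuous φ₀ := by rw [hφ₀]; exact continuous_const.mul hφ
  have hint : ∀ f : C_c(G, ℂ), Integrable (fun t => f t * φ₀ t) μ := fun f =>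
    integrable_cc μ f hc₀
  let ℓ : C_c(G, ℂ) →ₗ[ℂ] ℂ :=
    { toFun := fun f => ∫ t, f t * φ₀ t ∂μ
      map_add' := fun f g => by
        rw [← integral_add (hint f) (hint g)]
        simp only [CompactlySupportedContinuousMap.add_apply, add_mul]
      map_smul' := fun c f => by
        rw [RingHom.id_apply, ← integral_smul]
        simp only [CompactlySupportedContinuousMap.smul_apply, smul_eq_mul, mul_assoc] }
  have hℓ : ∀ f, ‖ℓ f‖ ≤ ‖integratedRegular μ σ f‖ := by
    intro f
    have h1 : ℓ f = (C : ℂ)⁻¹ * ∫ t, f t * φ t ∂μ := by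
      change ∫ t, f t * φ₀ t ∂μ = _
      rw [← integral_const_mul, hφ₀]
      simp only [mul_left_comm]
    rw [h1, norm_mul, norm_inv, Complex.norm_of_nonneg hC.le]
    exact (inv_mul_le_iff₀ hC).2 (h f)
  obtain ⟨B, hB⟩ := exists_isDominatedPair (fun f : C_c(G, ℂ) => ∫ t, ‖f t‖ ∂μ)
    (fun s f => twistedTranslate σ s f) ℓ fun f u hu => by
      refine (hℓ f).trans ?_
      -- The zero pair shows `0 < u`, the sign condition required by the operator norm bound.
      have h0 := hu _ (isDominatedPair_integratedRegular μ (σ := σ) (ξ := 0) (η := 0)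
        (by simp) (by simp))
      simp only [map_zero, inner_zero_left, Complex.zero_re] at h0
      refine ContinuousLinearMap.opNorm_le_of_re_inner_le h0.le fun ξ η hξ hη => ?_
      have h1 := hu _ (isDominatedPair_integratedRegular μ (σ := σ) hξ.le hη.le)
      rw [← inner_conj_symm]
      exact h1.le
  obtain ⟨H, _, _, _, π, ξ, η, h1⟩ := exists_coeff_eq_of_isDominatedPair μ hc₀ hB
  refine ⟨H, _, _, _, π, (C : ℂ) • ξ, η, funext fun s => ?_⟩
  have h2 := congrFun h1 s
  rw [hφ₀] at h2
  simp only [TwistedRep.coeff] at h2 ⊢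
  rw [map_smul, inner_smul_right, ← h2, mul_inv_cancel_left₀ (Complex.ofReal_ne_zero.2 hC.ne')]

theorem exists_bound_of_continuous {E F : Type*} [SeminormedAddCommGroup E] [NormedSpace ℂ E]
    [SeminormedAddCommGroup F] [NormedSpace ℂ F] (f : E →ₗ[ℂ] F) (hf : Continuous f) :
    ∃ C, 0 < C ∧ ∀ x, ‖f x‖ ≤ C * ‖x‖ :=
  (⟨f, hf⟩ : E →L[ℂ] F).bound

theorem multiplierSpace_subset_twistedFourierStieltjes (hG : IsAmenableGroup μ) :
    multiplierSpace μ 1 σ ⊆ twistedFourierStieltjes σ := by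
  rintro φ ⟨T, hT⟩
  obtain ⟨C, hC, hTC⟩ := exists_bound_of_continuous (E := twistedFourier μ 1)
    (F := twistedFourier μ σ) T T.cont
  -- Reiter's property with the empty compact set is used here merely to produce a nonzero vector of
  -- L²(G).
  obtain ⟨u, hu, -⟩ := exists_norm_leftRegular_sub_le μ hG isCompact_empty one_pos
  have hu0 : u ≠ 0 := by
    rintro rfl
    rw [norm_zero] at hu
    linarith
  have hφ := continuous_of_isMultiplicationBy μ hu0 hT
  exact mem_twistedFourierStieltjes_of_norm_integral_le μ hφ hC
    (norm_integral_mul_le_of_isMultiplicationBy μ hG hφ hT hC.le hTC)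

end Main

theorem mainTheorem2 {G : Type u} [Group G] [TopologicalSpace G] [IsTopologicalGroup G]
    [T2Space G] [LocallyCompactSpace G] [MeasurableSpace G] [BorelSpace G]
    (μ : Measure G) [μ.IsHaarMeasure] [μ.Regular] (hG : IsAmenableGroup μ)
    (σ : ContinuousTwoCocycle G) :
    twistedFourierStieltjes σ = cbMultiplierSpace μ 1 σ ∧
      cbMultiplierSpace μ 1 σ = multiplierSpace μ 1 σ := by
  have h1 := twistedFourierStieltjes_subset_cbMultiplierSpace μ σ
  have h2 := cbMultiplierSpace_subset_multiplierSpace μ (σ := σ) (τ := 1)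
  have h3 := multiplierSpace_subset_twistedFourierStieltjes μ hG (σ := σ)
  exact ⟨h1.antisymm (h2.trans h3), h2.antisymm (h3.trans h1)⟩


end
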